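/- Throughout, $I=(0,1]$, Landau's $O$ and all limits of nets indexed by $I$ are for $\varepsilon\to0^+$, locally convex spaces are complex and Hausdorff, $L(E,F)$ denotes the continuous linear maps, $L_b$ and $L_\sigma$ refer to the topologies of bounded and of pointwise convergence, $\operatorname{csn}$ denotes the set of continuous seminorms, and $V\Subset U$ means that $V,U$ are open and $\overline V$ is compact and contained in $U$. **Scales.** A set $\mathcal A\subseteq[0,\infty)^I$ is an asymptotic growth scale if for all $\lambda,\mu\in\mathcal A$ there are $\nu,\nu'\in\mathcal A$ with $\lambda_\varepsilon+\mu_\varepsilon=O(\nu_\varepsilon)$ and $\lambda_\varepsilon\mu_\varepsilon=O(\nu'_\varepsilon)$, and some $\lambda\in\mathcal A$ has $\liminf\lambda_\varepsilon>0$. A set $\mathcal I\subseteq[0,\infty)^I$ is an asymptotic decay scale if for every $\lambda\in\mathcal I$ there are $\mu,\nu\in\mathcal I$ with $\mu_\varepsilon+\nu_\varepsilon=O(\lambda_\varepsilon)$ and $\mu',\nu'\in\mathcal I$ with $\mu'_\varepsilon\nu'_\varepsilon=O(\lambda_\varepsilon)$, and some $\lambda\in\mathcal I$ tends to $0$. The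 pair $\mathcal S=(\mathcal A,\mathcal I)$ is admissible if, moreover, for all $\lambda\in\mathcal I$, $\mu\in\mathcal A$ there is $\nu\in\mathcal I$ with $\mu_\varepsilon\nu_\varepsilon=O(\lambda_\varepsilon)$, and there are $\lambda\in\mathcal A$, $\mu\in\mathcal I$ with $\mu_\varepsilon=O(\lambda_\varepsilon)$. **Sheaves.** Let $X$ be a Hausdorff, locally compact, paracompact topological space. A presheaf of vector spaces with restriction maps $\rho_{V,U}$ is a sheaf if for every open $U\subseteq X$ and every open covering $(U_i)_i$ of $U$: (S1) if $\rho_{U_i,U}(u)=0$ for all $i$ then $u=0$; (S2) if $u_i$ are sections over $U_i$ with $\rho_{U_i\cap U_j,U_i}(u_i)=\rho_{U_i\cap U_j,U_j}(u_j)$ for all $i,j$, then there is a section $u$ over $U$ with $\rho_{U_i,U}(u)=u_i$ for all $i$. A locally convex sheaf is a sheaf of locally convex spaces with continuous linear restriction maps such that, for every open covering $(U_i)_i$ of an open $U$, the topology of $E(U)$ is the projective topology with respect to the maps $\rho_{U_i,U}$. A test pair of sheaves $(E,F)$ consists of locally convex sheaves $E,F$ on $X$ such that $F$ is a subsheaf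 of $E$, the topology of $F(U)$ is finer than the one induced by $E(U)$ for every open $U$, and for every open $U$ and every open covering $(U_i)_i$ of $U$ there are sheaf endomorphisms $\eta^i$ of $E|_U$ (families of continuous linear maps commuting with restrictions), each restricting to a sheaf endomorphism of the locally convex sheaf $F|_U$, whose supports form a locally finite family in $U$, with $\operatorname{supp}\eta^i\subseteq U_i$ and $\sum_i\eta^i=\mathrm{id}$. **Test objects.** Put $\mathrm{RO}(U)=L(E(U),F(U))$. Let $\mathrm{TO}(U)$ be the set of all $(\Phi_\varepsilon)\in\mathrm{RO}(U)^I$ such that for all $p\in\operatorname{csn}(L_\sigma(E(U),F(U)))$ there is $\lambda\in\mathcal A$ with $p(\Phi_\varepsilon)=O(\lambda_\varepsilon)$; for all $p\in\operatorname{csn}(L_\sigma(F(U),F(U)))$ and $\lambda\in\mathcal I$, $p(\Phi_\varepsilon|_{F(U)}-\mathrm{id})=O(\lambda_\varepsilon)$; and $\Phi_\varepsilon\to\mathrm{id}$ in $L_\sigma(E(U),E(U))$. Let $\mathrm{TO}^0(U)$ be defined in the same way with $\mathrm{id}$ replaced by $0$ in the last two conditions. A net $(\Phi_\varepsilon)\in\mathrm{RO}(U)^I$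 is localizing if for all $V\Subset V_0\Subset U$ there is $\varepsilon_0\in I$ such that for all $\varepsilon<\varepsilon_0$ and $u\in E(U)$, $\rho_{V_0,U}(u)=0$ implies $\rho_{V,U}(\Phi_\varepsilon(u))=0$. Let $\mathrm{TO}_{\mathrm{loc}}(U)$ and $\mathrm{TO}^0_{\mathrm{loc}}(U)$ be the sets of localizing elements of $\mathrm{TO}(U)$ and $\mathrm{TO}^0(U)$. **The quotient.** Let $\mathcal E_{\mathrm{loc}}(U)$ be the vector space of all maps $R\colon L_b(E(U),F(U))\to F(U)$ that are smooth in the sense of convenient calculus (they map smooth curves to smooth curves) and local: for all open $V\subseteq U$ and all $\Phi_1,\Phi_2\in\mathrm{RO}(U)$, $\rho_{V,U}\circ\Phi_1=\rho_{V,U}\circ\Phi_2$ implies $\rho_{V,U}(R(\Phi_1))=\rho_{V,U}(R(\Phi_2))$. Such an $R$ is moderate if for all $p\in\operatorname{csn}(F(U))$, $l\in\mathbb N$, $(\Phi_\varepsilon)\in\mathrm{TO}_{\mathrm{loc}}(U)$ and $(\Psi_{1,\varepsilon}),\dots,(\Psi_{l,\varepsilon})\in\mathrm{TO}^0_{\mathrm{loc}}(U)$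 there is $\lambda\in\mathcal A$ with $$p\big(\mathrm d^lR(\Phi_\varepsilon)(\Psi_{1,\varepsilon},\dots,\Psi_{l,\varepsilon})\big)=O(\lambda_\varepsilon),$$ and negligible if for all such $p,l,\Phi,\Psi_j$ this estimate holds for every $\lambda\in\mathcal I$. **Proposition.** Let $(E,F)$ be a test pair of sheaves on $X$ and $\mathcal S=(\mathcal A,\mathcal I)$ an admissible pair of scales such that $\mathrm{TO}_{\mathrm{loc}}(U)\neq\emptyset$ for every open $U\subseteq X$. Then: 1. the moderate elements of $\mathcal E_{\mathrm{loc}}(U)$ form a subspace $\mathcal E_{\mathcal M,\mathrm{loc}}(U)$, and the negligible ones a subspace $\mathcal E_{\mathcal N,\mathrm{loc}}(U)$ of it; put $\mathcal G_{\mathrm{loc}}(U)=\mathcal E_{\mathcal M,\mathrm{loc}}(U)/\mathcal E_{\mathcal N,\mathrm{loc}}(U)$; 2. for open $V\subseteq U$ there is a unique linear map $\rho^{\mathcal E}_{V,U}\colon\mathcal E_{\mathrm{loc}}(U)\to\mathcal E_{\mathrm{loc}}(V)$ such that, for all $R\in\mathcal E_{\mathrm{loc}}(U)$, $W\Subset V$,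 $\Phi\in\mathrm{RO}(V)$ and $\Phi'\in\mathrm{RO}(U)$ with $\rho_{W,V}\circ\Phi\circ\rho_{V,U}=\rho_{W,U}\circ\Phi'$, one has $\rho_{W,V}(\rho^{\mathcal E}_{V,U}(R)(\Phi))=\rho_{W,U}(R(\Phi'))$; 3. $\rho^{\mathcal G}_{V,U}([R])=[\rho^{\mathcal E}_{V,U}(R)]$ is well defined as a linear map $\mathcal G_{\mathrm{loc}}(U)\to\mathcal G_{\mathrm{loc}}(V)$, and with these restriction maps $U\mapsto\mathcal G_{\mathrm{loc}}(U)$ is a sheaf of vector spaces, that is, a presheaf satisfying (S1) and (S2). -/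

import Mathlib

open TopologicalSpace Filter Topology Asymptotics
open scoped NNReal ENNReal

universe u v w

namespace NonlinearExt

/-! ### Asymptotic scales -/

/-- The parameter interval `I = (0,1]`. -/
abbrev Eps : Type := Set.Ioc (0 : ℝ) 1

/-- The filter `ε → 0⁺` on `I = (0,1]`. -/
def epsZero : Filter Eps := comap Subtype.val (𝓝[>] (0 : ℝ))

/-- Landau's `f = O(g)` for `ε → 0⁺`, for nonnegative nets. -/
def BigO (f g : Eps → ℝ≥0) : Prop :=
  (fun ε => (f ε : ℝ)) =O[epsZero] (fun ε => (g ε : ℝ))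

structure IsGrowthScale (A : Set (Eps → ℝ≥0)) : Prop where
  add : ∀ l ∈ A, ∀ m ∈ A, ∃ n ∈ A, BigO (fun ε => l ε + m ε) n
  mul : ∀ l ∈ A, ∀ m ∈ A, ∃ n ∈ A, BigO (fun ε => l ε * m ε) n
  liminf_pos : ∃ l ∈ A, 0 < liminf (fun ε => (l ε : ℝ≥0∞)) epsZero

structure IsDecayScale (D : Set (Eps → ℝ≥0)) : Prop where
  add : ∀ l ∈ D, ∃ m ∈ D, ∃ n ∈ D, BigO (fun ε => m ε + n ε) l
  mul : ∀ l ∈ D, ∃ m ∈ D, ∃ n ∈ D, BigO (fun ε => m ε * n ε) l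
  tendsto_zero : ∃ l ∈ D, Tendsto l epsZero (𝓝 0)

/-- Admissible pairs of scales (growth scale `A`, decay scale `D`). -/
structure IsAdmissible (A D : Set (Eps → ℝ≥0)) : Prop where
  growth : IsGrowthScale A
  decay : IsDecayScale D
  mul : ∀ l ∈ D, ∀ m ∈ A, ∃ n ∈ D, BigO (fun ε => m ε * n ε) l
  compare : ∃ l ∈ A, ∃ m ∈ D, BigO m l

/-! ### Smooth maps between locally convex spaces (convenient calculus) -/

section Calculus

variable {E : Type v} {F : Type w}

/-- The curve `c` has derivative `y` at `t`: its difference quotients at `t` converge to `y`. -/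
def HasCurveDerivAt [AddCommGroup E] [Module ℝ E] [TopologicalSpace E]
    (c : ℝ → E) (y : E) (t : ℝ) : Prop :=
  Tendsto (slope c t) (𝓝[≠] t) (𝓝 y)

/-- The derivative of a curve (meaningful when the limit of the difference quotients exists). -/
noncomputable def curveDeriv [AddCommGroup E] [Module ℝ E] [TopologicalSpace E]
    (c : ℝ → E) (t : ℝ) : E :=
  limUnder (𝓝[≠] t) (slope c t)

/-- A curve is smooth if its derivatives of all orders exist. -/
def IsSmoothCurve [AddCommGroup E] [Module ℝ E] [TopologicalSpace E] (c : ℝ → E) : Prop :=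
  ∃ d : ℕ → ℝ → E, d 0 = c ∧ ∀ n t, HasCurveDerivAt (d n) (d (n + 1) t) t

/-- A map is smooth in the sense of convenient calculus if it maps smooth curves to smooth
curves. -/
def IsSmoothMap [AddCommGroup E] [Module ℝ E] [TopologicalSpace E]
    [AddCommGroup F] [Module ℝ F] [TopologicalSpace F] (f : E → F) : Prop :=
  ∀ c : ℝ → E, IsSmoothCurve c → IsSmoothCurve (f ∘ c)

/-- The `l`-th differential `d^l f(x)(v₁, …, v_l)`, by iterating
`d^l f(x)(v₁, …, v_l) = d/dt|_{t=0} d^{l-1} f(x + t v₁)(v₂, …, v_l)`. -/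
noncomputable def iterDifferential [AddCommGroup E] [Module ℝ E]
    [AddCommGroup F] [Module ℝ F] [TopologicalSpace F] (f : E → F) :
    (l : ℕ) → E → (Fin l → E) → F
  | 0, x, _ => f x
  | l + 1, x, v =>
      curveDeriv (fun t : ℝ => iterDifferential f l (x + t • v 0) (Fin.tail v)) 0

theorem HasCurveDerivAt.add [AddCommGroup E] [Module ℝ E] [TopologicalSpace E]
    [IsTopologicalAddGroup E] {c d : ℝ → E} {y z : E} {t : ℝ}
    (hc : HasCurveDerivAt c y t) (hd : HasCurveDerivAt d z t) :
    HasCurveDerivAt (c + d) (y + z) t := by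
  refine (Tendsto.add hc hd).congr fun s => ?_
  simp only [slope, vsub_eq_sub, Pi.add_apply, ← smul_add]
  congr 1
  abel

theorem HasCurveDerivAt.smul [AddCommGroup E] [Module ℂ E] [TopologicalSpace E]
    [ContinuousSMul ℂ E] {c : ℝ → E} {y : E} {t : ℝ} (a : ℂ)
    (hc : HasCurveDerivAt c y t) : HasCurveDerivAt (a • c) (a • y) t := by
  refine (Tendsto.const_smul hc a).congr fun s => ?_
  simp only [slope, vsub_eq_sub, Pi.smul_apply, ← smul_sub]
  rw [smul_comm]

theorem IsSmoothMap.zero [AddCommGroup E] [Module ℝ E] [TopologicalSpace E]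
    [AddCommGroup F] [Module ℝ F] [TopologicalSpace F] :
    IsSmoothMap (0 : E → F) := by
  intro c _
  refine ⟨fun _ _ => 0, rfl, fun n t => ?_⟩
  refine tendsto_const_nhds.congr fun s => ?_
  simp [slope]

theorem IsSmoothMap.add [AddCommGroup E] [Module ℝ E] [TopologicalSpace E]
    [AddCommGroup F] [Module ℝ F] [TopologicalSpace F] [IsTopologicalAddGroup F]
    {f g : E → F} (hf : IsSmoothMap f) (hg : IsSmoothMap g) : IsSmoothMap (f + g) := by
  intro c hc
  obtain ⟨d, hd0, hd⟩ := hf c hc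
  obtain ⟨e, he0, he⟩ := hg c hc
  refine ⟨fun n => d n + e n, ?_, fun n t => (hd n t).add (he n t)⟩
  simp only [hd0, he0]
  rfl

theorem IsSmoothMap.smul [AddCommGroup E] [Module ℝ E] [TopologicalSpace E]
    [AddCommGroup F] [Module ℂ F] [TopologicalSpace F] [ContinuousSMul ℂ F]
    {f : E → F} (a : ℂ) (hf : IsSmoothMap f) : IsSmoothMap (a • f) := by
  intro c hc
  obtain ⟨d, hd0, hd⟩ := hf c hc
  refine ⟨fun n => a • d n, ?_, fun n t => (hd n t).smul a⟩
  simp only [hd0]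
  rfl

end Calculus

/-! ### Test objects, moderateness and negligibility for a test pair of locally convex spaces -/

section TestObjects

variable {E : Type v} {F : Type w}
  [AddCommGroup E] [Module ℂ E] [TopologicalSpace E] [IsTopologicalAddGroup E]
  [ContinuousSMul ℂ E]
  [AddCommGroup F] [Module ℂ F] [TopologicalSpace F] [IsTopologicalAddGroup F]
  [ContinuousSMul ℂ F]

/-- `p(Φ_ε) = O(λ_ε)` for a seminorm `p` on `L_σ(E, F)`, the space of continuous linear maps with
the topology of pointwise convergence. -/
def SeminormBigO (p : Seminorm ℂ (E →Lₚₜ[ℂ] F)) (Φ : Eps → (E →L[ℂ] F)) (l : Eps → ℝ≥0) : Prop :=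
  (fun ε => p (ContinuousLinearMap.toPointwiseConvergenceCLM ℂ (RingHom.id ℂ) E F (Φ ε)))
    =O[epsZero] (fun ε => (l ε : ℝ))

/-- Test objects of the test pair `(E, F)`, where `j : F → E` is the inclusion. -/
structure IsTestObject (j : F →L[ℂ] E) (A D : Set (Eps → ℝ≥0)) (Φ : Eps → (E →L[ℂ] F)) :
    Prop where
  moderate : ∀ p : Seminorm ℂ (E →Lₚₜ[ℂ] F), Continuous p → ∃ l ∈ A, SeminormBigO p Φ l
  approx : ∀ p : Seminorm ℂ (F →Lₚₜ[ℂ] F), Continuous p → ∀ l ∈ D,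
    SeminormBigO p (fun ε => (Φ ε).comp j - ContinuousLinearMap.id ℂ F) l
  tendsto_id : Tendsto
    (fun ε => ContinuousLinearMap.toPointwiseConvergenceCLM ℂ (RingHom.id ℂ) E E (j.comp (Φ ε)))
    epsZero
    (𝓝 (ContinuousLinearMap.toPointwiseConvergenceCLM ℂ (RingHom.id ℂ) E E
      (ContinuousLinearMap.id ℂ E)))

/-- `0`-test objects of the test pair `(E, F)`. -/
structure IsZeroTestObject (j : F →L[ℂ] E) (A D : Set (Eps → ℝ≥0)) (Ψ : Eps → (E →L[ℂ] F)) :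
    Prop where
  moderate : ∀ p : Seminorm ℂ (E →Lₚₜ[ℂ] F), Continuous p → ∃ l ∈ A, SeminormBigO p Ψ l
  approx : ∀ p : Seminorm ℂ (F →Lₚₜ[ℂ] F), Continuous p → ∀ l ∈ D,
    SeminormBigO p (fun ε => (Ψ ε).comp j) l
  tendsto_zero : Tendsto
    (fun ε => ContinuousLinearMap.toPointwiseConvergenceCLM ℂ (RingHom.id ℂ) E E (j.comp (Ψ ε)))
    epsZero (𝓝 0)

/-- `R` is moderate with respect to the sets `Λ`, `Λ₀` of test objects and the growth scale `A`. -/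
def IsModerate (A : Set (Eps → ℝ≥0)) (Λ Λ₀ : Set (Eps → (E →L[ℂ] F)))
    (R : (E →L[ℂ] F) → F) : Prop :=
  ∀ p : Seminorm ℂ F, Continuous p → ∀ l : ℕ, ∀ Φ ∈ Λ, ∀ Ψ : Fin l → Eps → (E →L[ℂ] F),
    (∀ i, Ψ i ∈ Λ₀) → ∃ a ∈ A,
      (fun ε => p (iterDifferential R l (Φ ε) (fun i => Ψ i ε))) =O[epsZero]
        (fun ε => (a ε : ℝ))

/-- `R` is negligible with respect to the sets `Λ`, `Λ₀` of test objects and the decay scale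
`D`. -/
def IsNegligible (D : Set (Eps → ℝ≥0)) (Λ Λ₀ : Set (Eps → (E →L[ℂ] F)))
    (R : (E →L[ℂ] F) → F) : Prop :=
  ∀ p : Seminorm ℂ F, Continuous p → ∀ l : ℕ, ∀ Φ ∈ Λ, ∀ Ψ : Fin l → Eps → (E →L[ℂ] F),
    (∀ i, Ψ i ∈ Λ₀) → ∀ a ∈ D,
      (fun ε => p (iterDifferential R l (Φ ε) (fun i => Ψ i ε))) =O[epsZero]
        (fun ε => (a ε : ℝ))

end TestObjects

/-! ### Sheaves -/

/-- The spaces `S U` (`U ⊆ X` open) with the maps `res U V h : S U → S V` for `h : V ≤ U` form a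
sheaf of complex vector spaces: `res_self` and `res_res` say that they form a presheaf, and
`separated`, `glue` are the two sheaf axioms. -/
structure IsVectorSheaf {X : Type u} [TopologicalSpace X] (S : Opens X → Type v)
    [∀ U, AddCommGroup (S U)] [∀ U, Module ℂ (S U)]
    (res : ∀ U V : Opens X, V ≤ U → (S U →ₗ[ℂ] S V)) : Prop where
  res_self : ∀ (U : Opens X) (s : S U), res U U le_rfl s = s
  res_res : ∀ (U V W : Opens X) (hVU : V ≤ U) (hWV : W ≤ V) (s : S U),
    res V W hWV (res U V hVU s) = res U W (hWV.trans hVU) s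
  separated : ∀ (U : Opens X) (ι : Type u) (c : ι → Opens X) (hc : ∀ i, c i ≤ U),
    U ≤ ⨆ i, c i → ∀ s : S U, (∀ i, res U (c i) (hc i) s = 0) → s = 0
  glue : ∀ (U : Opens X) (ι : Type u) (c : ι → Opens X) (hc : ∀ i, c i ≤ U),
    U ≤ ⨆ i, c i → ∀ s : ∀ i, S (c i),
      (∀ i j, res (c i) (c i ⊓ c j) inf_le_left (s i) = res (c j) (c i ⊓ c j) inf_le_right (s j)) →
      ∃ t : S U, ∀ i, res U (c i) (hc i) t = s i

/-- A sheaf of (Hausdorff, complex) locally convex spaces. -/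
structure LCSheaf (X : Type u) [TopologicalSpace X] where
  Sec : Opens X → Type v
  [addCommGroup : ∀ U, AddCommGroup (Sec U)]
  [module : ∀ U, Module ℂ (Sec U)]
  [topology : ∀ U, TopologicalSpace (Sec U)]
  [topologicalAddGroup : ∀ U, IsTopologicalAddGroup (Sec U)]
  [continuousSMul : ∀ U, ContinuousSMul ℂ (Sec U)]
  [locallyConvex : ∀ U, LocallyConvexSpace ℝ (Sec U)]
  [t2 : ∀ U, T2Space (Sec U)]
  res : ∀ U V : Opens X, V ≤ U → (Sec U →L[ℂ] Sec V)
  isSheaf : IsVectorSheaf Sec (fun U V h => (res U V h : Sec U →ₗ[ℂ] Sec V))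
  /-- The topology on `Sec U` is the projective one with respect to the restrictions to the
  members of any open covering of `U`. -/
  projective : ∀ (U : Opens X) (ι : Type u) (c : ι → Opens X) (hc : ∀ i, c i ≤ U),
    U ≤ ⨆ i, c i → topology U = ⨅ i, (topology (c i)).induced (res U (c i) (hc i))

attribute [instance] LCSheaf.addCommGroup LCSheaf.module LCSheaf.topology
  LCSheaf.topologicalAddGroup LCSheaf.continuousSMul LCSheaf.locallyConvex LCSheaf.t2

variable {X : Type u} [TopologicalSpace X]

/-- `V ⋐ U`: the closure of `V` is compact and contained in `U`. -/
def CompactlyIn (V U : Opens X) : Prop :=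
  closure (V : Set X) ⊆ U ∧ IsCompact (closure (V : Set X))

theorem CompactlyIn.le {V U : Opens X} (h : CompactlyIn V U) : V ≤ U :=
  fun _ hx => h.1 (subset_closure hx)

/-- Elements of `Hom(E|_U, E|_U)`. -/
structure SheafEnd (E : LCSheaf.{u, v} X) (U : Opens X) where
  map : ∀ V : Opens X, V ≤ U → (E.Sec V →L[ℂ] E.Sec V)
  comm : ∀ (V W : Opens X) (hVU : V ≤ U) (hWV : W ≤ V) (s : E.Sec V),
    E.res V W hWV (map V hVU s) = map W (hWV.trans hVU) (E.res V W hWV s)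

/-- The restriction of `η ∈ Hom(E|_U, E|_U)` to `V ⊆ U` is zero. -/
def SheafEnd.VanishesOn {E : LCSheaf.{u, v} X} {U : Opens X} (η : SheafEnd E U)
    (V : Opens X) : Prop :=
  ∀ (W : Opens X) (hWU : W ≤ U), W ≤ V → η.map W hWU = 0

/-- The support of `η ∈ Hom(E|_U, E|_U)`: the complement in `U` of the union of all open sets on
which `η` vanishes. -/
def SheafEnd.supp {E : LCSheaf.{u, v} X} {U : Opens X} (η : SheafEnd E U) : Set X :=
  {x | x ∈ U ∧ ∀ V : Opens X, V ≤ U → η.VanishesOn V → x ∉ V}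

/-- A test pair of sheaves `(E, F)`. The inclusion of the subsheaf `F` of `E` is given by injective
maps compatible with the restrictions; they are continuous because the topology of `F(U)` is finer
than the one induced by `E(U)`. -/
structure TestPair (E : LCSheaf.{u, v} X) (F : LCSheaf.{u, w} X) where
  incl : ∀ U : Opens X, F.Sec U →L[ℂ] E.Sec U
  incl_injective : ∀ U, Function.Injective (incl U)
  incl_res : ∀ (U V : Opens X) (h : V ≤ U) (s : F.Sec U),
    E.res U V h (incl U s) = incl V (F.res U V h s)
  /-- For every open `U` and every open covering `c` of `U` there is a partition of unity
  `η i ∈ Hom(E|_U, E|_U)` subordinate to `c` whose members restrict to elements of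
  `Hom(F|_U, F|_U)`. The sum `∑ i, η i = id` is locally finite: on an open set met by the supports
  of the `η i` for `i ∈ J` only, it is the sum over `J`. -/
  partition : ∀ (U : Opens X) (ι : Type u) (c : ι → Opens X), (∀ i, c i ≤ U) → U ≤ ⨆ i, c i →
    ∃ η : ι → SheafEnd E U,
      (∀ i, ∃ θ : SheafEnd F U, ∀ (V : Opens X) (hVU : V ≤ U) (s : F.Sec V),
        incl V (θ.map V hVU s) = (η i).map V hVU (incl V s)) ∧
      (∀ i, (η i).supp ⊆ c i) ∧
      (∀ x ∈ U, ∃ V : Opens X, x ∈ V ∧ {i | ((η i).supp ∩ V).Nonempty}.Finite) ∧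
      (∀ (V : Opens X) (hVU : V ≤ U) (J : Finset ι),
        (∀ i, i ∉ J → Disjoint (η i).supp (V : Set X)) →
        ∀ s : E.Sec V, ∑ i ∈ J, (η i).map V hVU s = s)

namespace TestPair

variable {E : LCSheaf.{u, v} X} {F : LCSheaf.{u, w} X}

/-- Regularization operators on `U`: continuous linear maps `E(U) → F(U)`, with the topology of
bounded convergence. -/
abbrev RO (_T : TestPair E F) (U : Opens X) : Type (max v w) := E.Sec U →L[ℂ] F.Sec U

variable (T : TestPair E F)

/-- Localizing nets of regularization operators. -/
def IsLocalizing (U : Opens X) (Φ : Eps → T.RO U) : Prop :=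
  ∀ (V V₀ : Opens X) (hV : CompactlyIn V V₀) (hV₀ : CompactlyIn V₀ U),
    ∃ ε₀ : Eps, ∀ ε < ε₀, ∀ s : E.Sec U,
      E.res U V₀ hV₀.le s = 0 → F.res U V (hV.le.trans hV₀.le) (Φ ε s) = 0

/-- Localizing test objects on `U`. -/
def TOloc (A D : Set (Eps → ℝ≥0)) (U : Opens X) : Set (Eps → T.RO U) :=
  {Φ | IsTestObject (T.incl U) A D Φ ∧ T.IsLocalizing U Φ}

/-- Localizing `0`-test objects on `U`. -/
def TOzloc (A D : Set (Eps → ℝ≥0)) (U : Opens X) : Set (Eps → T.RO U) :=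
  {Ψ | IsZeroTestObject (T.incl U) A D Ψ ∧ T.IsLocalizing U Ψ}

/-- `R` is local: if two regularization operators agree after restriction to an open `V ⊆ U`, so do
their images under `R`. -/
def IsLocal (U : Opens X) (R : T.RO U → F.Sec U) : Prop :=
  ∀ (V : Opens X) (h : V ≤ U) (Φ₁ Φ₂ : T.RO U),
    (F.res U V h).comp Φ₁ = (F.res U V h).comp Φ₂ → F.res U V h (R Φ₁) = F.res U V h (R Φ₂)

/-- The local elements of the basic space `C^∞(L_b(E(U), F(U)), F(U))`, as a subspace of the space
of all maps. -/
def locSubmodule (U : Opens X) : Submodule ℂ (T.RO U → F.Sec U) where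
  carrier := {R | IsSmoothMap R ∧ T.IsLocal U R}
  zero_mem' := ⟨IsSmoothMap.zero, fun _ _ _ _ _ => rfl⟩
  add_mem' := by
    rintro R S ⟨hR, hR'⟩ ⟨hS, hS'⟩
    refine ⟨hR.add hS, fun V h Φ₁ Φ₂ hΦ => ?_⟩
    simp only [Pi.add_apply, map_add, hR' V h Φ₁ Φ₂ hΦ, hS' V h Φ₁ Φ₂ hΦ]
  smul_mem' := by
    rintro a R ⟨hR, hR'⟩
    refine ⟨hR.smul a, fun V h Φ₁ Φ₂ hΦ => ?_⟩
    simp only [Pi.smul_apply, map_smul, hR' V h Φ₁ Φ₂ hΦ]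

/-- The vector space of local elements of the basic space `C^∞(L_b(E(U), F(U)), F(U))`. -/
def LocBasic (U : Opens X) : Type (max v w) := ↥(T.locSubmodule U)

noncomputable instance (U : Opens X) : AddCommGroup (T.LocBasic U) :=
  inferInstanceAs (AddCommGroup (T.locSubmodule U))

noncomputable instance (U : Opens X) : Module ℂ (T.LocBasic U) :=
  inferInstanceAs (Module ℂ (T.locSubmodule U))

/-- The map `L(E(U), F(U)) → F(U)` given by an element of `LocBasic U`. -/
def LocBasic.toFun {T : TestPair E F} {U : Opens X} (R : T.LocBasic U) : T.RO U → F.Sec U :=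
  Subtype.val (p := fun R => R ∈ T.locSubmodule U) R

/-- The linear map `r` is a restriction map from `U` to `V` for local smooth maps: `r R (Φ)` and
`R (Φ')` agree on every `W ⋐ V` on which `Φ` and `Φ'` agree. -/
def IsLocRestriction (U V : Opens X) (hVU : V ≤ U) (r : T.LocBasic U →ₗ[ℂ] T.LocBasic V) : Prop :=
  ∀ (R : T.LocBasic U) (W : Opens X) (hW : CompactlyIn W V) (Φ : T.RO V) (Φ' : T.RO U),
    ((F.res V W hW.le).comp Φ).comp (E.res U V hVU) = (F.res U W (hW.le.trans hVU)).comp Φ' →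
    F.res V W hW.le ((r R).toFun Φ) =
      F.res U W (hW.le.trans hVU) (R.toFun Φ')

/-- The moderate elements of `LocBasic U`. -/
def IsModerateLoc (A D : Set (Eps → ℝ≥0)) (U : Opens X) (R : T.LocBasic U) : Prop :=
  IsModerate A (T.TOloc A D U) (T.TOzloc A D U) R.toFun

/-- The negligible elements of `LocBasic U`. -/
def IsNegligibleLoc (A D : Set (Eps → ℝ≥0)) (U : Opens X) (R : T.LocBasic U) : Prop :=
  IsNegligible D (T.TOloc A D U) (T.TOzloc A D U) R.toFun

end TestPair

end NonlinearExt

namespace NonlinearExt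

open scoped ContDiff

/-! ### Calculus of curves in topological vector spaces -/

section Curves

variable {E F : Type*}
  [AddCommGroup E] [Module ℝ E] [TopologicalSpace E]
  [AddCommGroup F] [Module ℝ F] [TopologicalSpace F]
  {c d : ℝ → E} {y z : E} {t : ℝ}

/-! Moderateness and negligibility both say that the nets `d^l R(Φ_ε)(Ψ_ε)` lie, after any
continuous seminorm, in a class of nets stable under sums and domination. `IsBoundClass` abstracts
such a class, so most arguments are made once and applied to `growthBound` and `decayBound`.

Linearity in `R` needs the differentials to exist, while `F(U)` need not be complete.
`IsSmoothMap.exists_directional` shows that a directional derivative of a smooth map is again a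
smooth map. It reduces to maps on the plane: a special curve through fast converging points bounds
directional derivatives locally, Taylor's formula turns them into finite differences, and comparing
coefficients writes each mixed derivative as a linear combination of pure directional ones
(`exists_hasCurveDerivAt_dirDeriv`). The latter exist by the definition of smoothness, so no
completeness is needed.

Restriction: for `W ⋐ V ⊆ U` a cutoff turns an operator over `V` into one over `U` that agrees with
it on `W`. Locality of `R` makes `R` of this operator, restricted to `W`, independent of the choice,
and these sections glue over all `W ⋐ V`.

Being bounded is a local property of `R`. For `W ⋐ U ∩ V` a localizing test object `Φ` over `U` is
replaced by `χ Φ(χ' ·) + (1 - χ) Θ` over `V`, with cutoffs `χ`, `χ'` and any test object `Θ` over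
`V` (`exists_transfer`). On `W` and for small `ε` it agrees with `Φ`, hence so do the differentials
of `R` and of its restriction. This gives the induced maps on quotients and (S1).

For (S2), given `R_i` over `U_i` with negligible differences on overlaps, put `S(Φ) = ∑ η^i
(R_i(Φ_i))`, where `η^i` is a partition of unity and `Φ_i` is `Φ` cut off to `U_i` by a cutoff equal
to `1` near the support of `η^i`. Since `∑ η^i = id`, locally `S - R_j` is `∑ η^i (R_i - R_j)`,
which is negligible. -/

theorem HasCurveDerivAt.unique [T2Space E] (h : HasCurveDerivAt c y t)
    (h' : HasCurveDerivAt c z t) : y = z :=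
  tendsto_nhds_unique h h'

theorem HasCurveDerivAt.curveDeriv_eq [T2Space E] (h : HasCurveDerivAt c y t) :
    curveDeriv c t = y :=
  Tendsto.limUnder_eq h

omit [TopologicalSpace E] in
theorem slope_eventuallyEq (e : c =ᶠ[𝓝 t] d) : slope c t =ᶠ[𝓝[≠] t] slope d t := by
  filter_upwards [e.filter_mono nhdsWithin_le_nhds] with s hs
  rw [slope, slope, hs, e.eq_of_nhds]

theorem curveDeriv_congr (e : c =ᶠ[𝓝 t] d) : curveDeriv c t = curveDeriv d t := by
  unfold curveDeriv limUnder
  rw [Filter.map_congr (slope_eventuallyEq e)]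

theorem HasCurveDerivAt.const (x : E) (t : ℝ) : HasCurveDerivAt (fun _ => x) 0 t := by
  refine tendsto_const_nhds.congr fun s => ?_
  simp [slope]

theorem HasCurveDerivAt.map (h : HasCurveDerivAt c y t) (L : E →L[ℝ] F) :
    HasCurveDerivAt (fun s => L (c s)) (L y) t := by
  refine ((L.continuous.tendsto y).comp h).congr fun s => ?_
  simp [slope, map_smul, map_sub]

theorem hasCurveDerivAt_real_iff {f : ℝ → ℝ} {a t : ℝ} :
    HasCurveDerivAt f a t ↔ HasDerivAt f a t :=
  hasDerivAt_iff_tendsto_slope.symm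

theorem HasCurveDerivAt.prodMk {f : ℝ → F} {x : F} (h : HasCurveDerivAt c y t)
    (h' : HasCurveDerivAt f x t) : HasCurveDerivAt (fun s => (c s, f s)) (y, x) t :=
  (h.prodMk_nhds h').congr fun s => by simp [slope]

section TVS

variable [ContinuousSMul ℝ E]

theorem HasCurveDerivAt.const_smul (h : HasCurveDerivAt c y t) (a : ℝ) :
    HasCurveDerivAt (fun s => a • c s) (a • y) t := by
  refine (Tendsto.const_smul h a).congr fun s => ?_
  simp only [slope, vsub_eq_sub, ← smul_sub]
  rw [smul_comm]

theorem HasCurveDerivAt.continuousAt [IsTopologicalAddGroup E] (h : HasCurveDerivAt c y t) : ContinuousAt c t := by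
  rw [continuousAt_iff_punctured_nhds]
  have h1 : Tendsto (fun s : ℝ => (s - t) • slope c t s + c t) (𝓝[≠] t) (𝓝 ((t - t) • y + c t)) :=
    ((((continuous_id.sub continuous_const).tendsto t).mono_left nhdsWithin_le_nhds).smul h).add
      tendsto_const_nhds
  simpa using h1.congr fun s => by simp

theorem HasCurveDerivAt.comp {γ : ℝ → ℝ} {a : ℝ} (h : HasCurveDerivAt c y (γ t))
    (hγ : HasDerivAt γ a t) : HasCurveDerivAt (fun s => c (γ s)) (a • y) t := by
  classical
  -- Filling the gap of the difference quotient with `y` makes it continuous at `γ t`. The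
  -- factorization `slope γ t s • Q (γ s)` then also holds at points with `γ s = γ t`.
  set Q : ℝ → E := Function.update (slope c (γ t)) (γ t) y with hQ
  have hQc : ContinuousAt Q (γ t) := by
    rw [hQ, continuousAt_update_same]
    exact h
  have h1 : Tendsto (fun s => slope γ t s • Q (γ s)) (𝓝[≠] t) (𝓝 (a • Q (γ t))) :=
    (hasDerivAt_iff_tendsto_slope.1 hγ).smul
      ((hQc.tendsto.comp hγ.continuousAt).mono_left nhdsWithin_le_nhds)
  have h2 : Q (γ t) = y := by simp [hQ]
  rw [h2] at h1
  refine h1.congr fun s => ?_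
  by_cases hs : γ s = γ t
  · simp [slope, hs]
  · rw [hQ, Function.update_of_ne hs]
    simp only [slope, vsub_eq_sub, smul_eq_mul, smul_smul]
    rw [mul_assoc, mul_inv_cancel₀ (sub_ne_zero.2 hs), mul_one]

variable [IsTopologicalAddGroup E]

theorem HasCurveDerivAt.smul_real {φ : ℝ → ℝ} {a : ℝ} (h : HasCurveDerivAt c y t)
    (hφ : HasDerivAt φ a t) :
    HasCurveDerivAt (fun s => φ s • c s) (a • c t + φ t • y) t := by
  have h1 : Tendsto (fun s => slope φ t s • c s + φ t • slope c t s) (𝓝[≠] t)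
      (𝓝 (a • c t + φ t • y)) :=
    ((hasDerivAt_iff_tendsto_slope.1 hφ).smul
      (h.continuousAt.tendsto.mono_left nhdsWithin_le_nhds)).add (Tendsto.const_smul h _)
  refine h1.congr fun s => ?_
  simp only [slope, vsub_eq_sub, smul_eq_mul, smul_sub, mul_sub, sub_smul, smul_smul]
  rw [mul_comm (φ t) (s - t)⁻¹]
  abel

end TVS

/-- Curves in a set closed under derivatives are smooth. -/
theorem isSmoothCurve_of_mem {S : Set (ℝ → E)}
    (h : ∀ c ∈ S, ∃ c' ∈ S, ∀ t, HasCurveDerivAt c (c' t) t) (hc : c ∈ S) : IsSmoothCurve c := by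
  choose! D hD hD' using h
  have hS : ∀ n, D^[n] c ∈ S := fun n => by
    induction n with
    | zero => exact hc
    | succ n ih => rw [Function.iterate_succ_apply']; exact hD _ ih
  refine ⟨fun n => D^[n] c, rfl, fun n t => ?_⟩
  beta_reduce
  rw [Function.iterate_succ_apply']
  exact hD' _ (hS n) t

theorem IsSmoothCurve.exists_deriv (hc : IsSmoothCurve c) :
    ∃ c', IsSmoothCurve c' ∧ ∀ t, HasCurveDerivAt c (c' t) t := by
  obtain ⟨d, rfl, hd⟩ := hc
  exact ⟨d 1, ⟨fun n => d (n + 1), rfl, fun n t => hd (n + 1) t⟩, hd 0⟩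

theorem IsSmoothCurve.hasCurveDerivAt [T2Space E] (hc : IsSmoothCurve c) (t : ℝ) :
    HasCurveDerivAt c (curveDeriv c t) t := by
  obtain ⟨c', -, h⟩ := hc.exists_deriv
  rw [(h t).curveDeriv_eq]
  exact h t

theorem IsSmoothCurve.curveDeriv [T2Space E] (hc : IsSmoothCurve c) :
    IsSmoothCurve (curveDeriv c) := by
  obtain ⟨c', hc', h⟩ := hc.exists_deriv
  rwa [show NonlinearExt.curveDeriv c = c' from funext fun t => (h t).curveDeriv_eq]

theorem IsSmoothCurve.iterate [T2Space E] (hc : IsSmoothCurve c) (n : ℕ) :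
    IsSmoothCurve (NonlinearExt.curveDeriv^[n] c) := by
  induction n with
  | zero => exact hc
  | succ n ih => rw [Function.iterate_succ_apply']; exact ih.curveDeriv

theorem IsSmoothCurve.hasCurveDerivAt_iterate [T2Space E] (hc : IsSmoothCurve c) (n : ℕ) (t : ℝ) :
    HasCurveDerivAt (NonlinearExt.curveDeriv^[n] c) (NonlinearExt.curveDeriv^[n + 1] c t) t := by
  rw [Function.iterate_succ_apply']
  exact (hc.iterate n).hasCurveDerivAt t

theorem iterate_curveDeriv_congr (e : c =ᶠ[𝓝 t] d) (n : ℕ) :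
    curveDeriv^[n] c =ᶠ[𝓝 t] curveDeriv^[n] d := by
  induction n with
  | zero => exact e
  | succ n ih =>
    rw [Function.iterate_succ_apply', Function.iterate_succ_apply']
    exact ih.eventuallyEq_nhds.mono fun s hs => curveDeriv_congr hs

theorem IsSmoothCurve.const (x : E) : IsSmoothCurve (fun _ : ℝ => x) :=
  isSmoothCurve_of_mem (S := Set.range fun x : E => fun _ : ℝ => x)
    (by rintro _ ⟨x, rfl⟩; exact ⟨_, ⟨0, rfl⟩, fun t => HasCurveDerivAt.const x t⟩) ⟨x, rfl⟩

theorem IsSmoothCurve.map (hc : IsSmoothCurve c) (L : E →L[ℝ] F) :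
    IsSmoothCurve (fun s => L (c s)) := by
  obtain ⟨d, rfl, hd⟩ := hc
  exact ⟨fun n s => L (d n s), rfl, fun n t => (hd n t).map L⟩

theorem IsSmoothCurve.prodMk {f : ℝ → F} (hc : IsSmoothCurve c) (hf : IsSmoothCurve f) :
    IsSmoothCurve (fun s => (c s, f s)) := by
  obtain ⟨d, rfl, hd⟩ := hc
  obtain ⟨e, rfl, he⟩ := hf
  exact ⟨fun n s => (d n s, e n s), rfl, fun n t => (hd n t).prodMk (he n t)⟩

theorem IsSmoothCurve.add [IsTopologicalAddGroup E] (hc : IsSmoothCurve c)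
    (hd : IsSmoothCurve d) : IsSmoothCurve (fun s => c s + d s) := by
  obtain ⟨e, rfl, he⟩ := hc
  obtain ⟨e', rfl, he'⟩ := hd
  exact ⟨fun n => e n + e' n, rfl, fun n t => (he n t).add (he' n t)⟩

theorem isSmoothCurve_real_iff {f : ℝ → ℝ} : IsSmoothCurve f ↔ ContDiff ℝ ∞ f := by
  constructor
  · rintro ⟨d, rfl, hd⟩
    have hd' : ∀ n t, HasDerivAt (d n) (d (n + 1) t) t := fun n t =>
      hasCurveDerivAt_real_iff.1 (hd n t)
    have : ∀ n, iteratedDeriv n (d 0) = d n := fun n => by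
      induction n with
      | zero => exact iteratedDeriv_zero
      | succ n ih => rw [iteratedDeriv_succ, ih]; exact funext fun t => (hd' n t).deriv
    refine contDiff_of_differentiable_iteratedDeriv fun m _ => ?_
    rw [this]
    exact fun t => (hd' m t).differentiableAt
  · intro hf
    refine ⟨fun n => iteratedDeriv n f, iteratedDeriv_zero, fun n t => ?_⟩
    beta_reduce
    rw [hasCurveDerivAt_real_iff, iteratedDeriv_succ]
    exact (hf.differentiable_iteratedDeriv n (by exact_mod_cast WithTop.coe_lt_top _)
      t).hasDerivAt

variable [IsTopologicalAddGroup E] [ContinuousSMul ℝ E]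

theorem IsSmoothCurve.continuous (hc : IsSmoothCurve c) : Continuous c := by
  obtain ⟨c', -, h⟩ := hc.exists_deriv
  exact continuous_iff_continuousAt.2 fun t => (h t).continuousAt

/-- A linear span of curves is closed under derivatives as soon as its generators are. -/
theorem isSmoothCurve_of_mem_span {S : Set (ℝ → E)}
    (h : ∀ c ∈ S, ∃ c' ∈ Submodule.span ℝ S, ∀ t, HasCurveDerivAt c (c' t) t)
    (hc : c ∈ Submodule.span ℝ S) : IsSmoothCurve c := by
  refine isSmoothCurve_of_mem (S := (Submodule.span ℝ S : Set (ℝ → E))) (fun c hc => ?_) hc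
  refine Submodule.span_induction h ⟨0, zero_mem _, fun t => HasCurveDerivAt.const 0 t⟩ ?_ ?_ hc
  · rintro c d - - ⟨c', hc', h⟩ ⟨d', hd', h'⟩
    exact ⟨c' + d', add_mem hc' hd', fun t => (h t).add (h' t)⟩
  · rintro a c - ⟨c', hc', h⟩
    exact ⟨a • c', Submodule.smul_mem _ a hc', fun t => (h t).const_smul a⟩

/-- For fixed `γ`, the derivative `φ' • c ∘ γ + (φ γ') • c' ∘ γ` is a sum of two curves of the same
shape, so the span of these curves is closed under derivatives. -/
theorem IsSmoothCurve.smul_comp (hc : IsSmoothCurve c) {φ γ : ℝ → ℝ} (hφ : ContDiff ℝ ∞ φ)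
    (hγ : ContDiff ℝ ∞ γ) : IsSmoothCurve (fun s => φ s • c (γ s)) := by
  refine isSmoothCurve_of_mem_span (S := {f | ∃ φ : ℝ → ℝ, ContDiff ℝ ∞ φ ∧ ∃ c : ℝ → E,
    IsSmoothCurve c ∧ f = fun s => φ s • c (γ s)}) ?_
    (Submodule.subset_span ⟨φ, hφ, c, hc, rfl⟩)
  rintro _ ⟨φ, hφ, c, hc, rfl⟩
  obtain ⟨c', hc', h⟩ := hc.exists_deriv
  have hφ' : ContDiff ℝ ∞ (deriv φ) := (contDiff_infty_iff_deriv.1 hφ).2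
  have hγ' : ContDiff ℝ ∞ (deriv γ) := (contDiff_infty_iff_deriv.1 hγ).2
  refine ⟨(fun s => deriv φ s • c (γ s)) + fun s => (φ s * deriv γ s) • c' (γ s),
    add_mem (Submodule.subset_span ⟨_, hφ', c, hc, rfl⟩)
      (Submodule.subset_span ⟨_, hφ.mul hγ', c', hc', rfl⟩), fun t => ?_⟩
  have := ((h (γ t)).comp (hγ.differentiable (by simp) t).hasDerivAt).smul_real
    (hφ.differentiable (by simp) t).hasDerivAt
  simpa [smul_smul] using this

theorem IsSmoothCurve.comp (hc : IsSmoothCurve c) {γ : ℝ → ℝ} (hγ : ContDiff ℝ ∞ γ) :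
    IsSmoothCurve (fun s => c (γ s)) := by
  simpa using hc.smul_comp (φ := fun _ => 1) contDiff_const hγ

theorem IsSmoothCurve.line (x v : E) : IsSmoothCurve (fun s : ℝ => x + s • v) :=
  (IsSmoothCurve.const x).add ((IsSmoothCurve.const v).smul_comp contDiff_id contDiff_id)

omit [IsTopologicalAddGroup E] in
theorem iterate_curveDeriv_comp_affine [T2Space E] (hc : IsSmoothCurve c) (a b : ℝ) (n : ℕ) :
    curveDeriv^[n] (fun s => c (a * s + b)) = fun s => a ^ n • curveDeriv^[n] c (a * s + b) := by
  induction n with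
  | zero => simp
  | succ n ih =>
    rw [Function.iterate_succ_apply', ih]
    funext t
    have hγ : HasDerivAt (fun s : ℝ => a * s + b) a t := by
      simpa using ((hasDerivAt_id t).const_mul a).add_const b
    have := (HasCurveDerivAt.comp (γ := fun s => a * s + b)
      (hc.hasCurveDerivAt_iterate n (a * t + b)) hγ).const_smul (a ^ n)
    rw [this.curveDeriv_eq, smul_smul, pow_succ]

end Curves

open scoped ContDiff

/-! ### Taylor estimates -/

section Taylor

variable {F : Type*} [AddCommGroup F] [Module ℝ F] [TopologicalSpace F] [IsTopologicalAddGroup F]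

/-- Hahn–Banach: a functional norming `x` reduces seminorm estimates for vector-valued curves to
real-valued ones. -/
theorem exists_clm_eq_seminorm (p : Seminorm ℝ F) (hp : Continuous p) (x : F) :
    ∃ L : F →L[ℝ] ℝ, L x = p x ∧ ∀ y, |L y| ≤ p y := by
  have key : ∃ g : Module.Dual ℝ F, g x = p x ∧ ∀ y, |g y| ≤ p y := by
    by_cases hx : x = 0
    · exact ⟨0, by simp [hx], fun y => by simp⟩
    · set f : F →ₗ.[ℝ] ℝ := LinearPMap.mkSpanSingleton (K := ℝ) x (p x) hx with hf
      obtain ⟨g, hg, hgp⟩ := Module.Dual.exists_extension_of_le_seminorm_real (p := p)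
        f.domain f.toFun (by
          rintro ⟨y, hy⟩
          obtain ⟨a, rfl⟩ := Submodule.mem_span_singleton.1 hy
          have : f.toFun ⟨a • x, hy⟩ = a • p x := LinearPMap.mkSpanSingleton'_apply x (p x) _ a hy
          rw [this]
          simp only [map_smul_eq_mul, smul_eq_mul, Real.norm_eq_abs]
          exact mul_le_mul_of_nonneg_right (le_abs_self a) (apply_nonneg p x))
      refine ⟨g, ?_, hgp⟩
      have h1 := hg ⟨x, Submodule.mem_span_singleton_self x⟩
      simp only at h1
      rw [h1]
      exact LinearPMap.mkSpanSingleton_apply ℝ ℝ hx (p x)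
  obtain ⟨g, hgx, hg⟩ := key
  refine ⟨⟨g, ?_⟩, hgx, hg⟩
  refine continuous_of_continuousAt_zero g ?_
  rw [ContinuousAt, map_zero]
  refine squeeze_zero_norm (fun y => hg y) ?_
  simpa using hp.tendsto 0

theorem seminorm_sub_le_of_hasCurveDerivAt (p : Seminorm ℝ F) (hp : Continuous p) {c c' : ℝ → F}
    (h : ∀ t, HasCurveDerivAt c (c' t) t) {r C : ℝ} (hC : ∀ t, |t| ≤ |r| → p (c' t) ≤ C) :
    p (c r - c 0) ≤ C * |r| := by
  obtain ⟨L, hL, hLp⟩ := exists_clm_eq_seminorm p hp (c r - c 0)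
  have := Convex.norm_image_sub_le_of_norm_hasDerivWithin_le (s := Set.Icc (-|r|) |r|)
    (f := fun t => L (c t)) (f' := fun t => L (c' t)) (C := C) (x := 0) (y := r)
    (fun t _ => (hasCurveDerivAt_real_iff.1 ((h t).map L)).hasDerivWithinAt)
    (fun t ht => (hLp _).trans (hC t (abs_le.2 ht)))
    (convex_Icc _ _) (abs_le.1 (by simp)) (abs_le.1 le_rfl)
  rw [← map_sub, hL, Real.norm_of_nonneg (apply_nonneg p _), sub_zero] at this
  exact this

theorem HasCurveDerivAt.sum {ι : Type*} (s : Finset ι) {c : ι → ℝ → F} {y : ι → F} {t : ℝ}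
    (h : ∀ i ∈ s, HasCurveDerivAt (c i) (y i) t) :
    HasCurveDerivAt (fun r => ∑ i ∈ s, c i r) (∑ i ∈ s, y i) t := by
  classical
  induction s using Finset.induction_on with
  | empty => simpa using HasCurveDerivAt.const (0 : F) t
  | insert i s hi ih =>
    simp only [Finset.sum_insert hi]
    exact (h i (Finset.mem_insert_self i s)).add
      (ih fun j hj => h j (Finset.mem_insert_of_mem hj))

variable [ContinuousSMul ℝ F]

/-- Taylor's theorem for a curve with derivatives `d n`, measured by a seminorm. -/
theorem seminorm_taylor_le (p : Seminorm ℝ F) (hp : Continuous p) (n : ℕ) :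
    ∀ {d : ℕ → ℝ → F}, (∀ k t, HasCurveDerivAt (d k) (d (k + 1) t) t) → ∀ {r C : ℝ},
      (∀ t, |t| ≤ |r| → p (d n t) ≤ C) →
      p (d 0 r - ∑ k ∈ Finset.range n, (r ^ k / k.factorial) • d k 0) ≤ C * |r| ^ n := by
  induction n with
  | zero => intro d _ r C hC; simpa using hC r le_rfl
  | succ n ih =>
    intro d hd r C hC
    have hC0 : 0 ≤ C := (apply_nonneg p _).trans (hC 0 (by simp))
    -- The derivative of the remainder of order `n + 1` is the remainder of order `n` of the
    -- derivative curve. The induction hypothesis bounds it by `C * |r| ^ n`, and the mean value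
    -- inequality supplies the last factor `|r|`.
    have hder : ∀ t, HasCurveDerivAt
        (fun t => d 0 t - ∑ k ∈ Finset.range (n + 1), (t ^ k / k.factorial) • d k 0)
        (d 1 t - ∑ k ∈ Finset.range n, (t ^ k / k.factorial) • d (k + 1) 0) t := by
      intro t
      have hs : HasCurveDerivAt
          (fun t => ∑ k ∈ Finset.range n, (t ^ (k + 1) / (k + 1).factorial) • d (k + 1) 0)
          (∑ k ∈ Finset.range n, (t ^ k / k.factorial) • d (k + 1) 0) t := by
        refine HasCurveDerivAt.sum _ fun k _ => ?_
        have h1 : HasDerivAt (fun t : ℝ => t ^ (k + 1) / (k + 1).factorial)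
            (t ^ k / k.factorial) t := by
          have h2 := (hasDerivAt_pow (k + 1) t).div_const ((k + 1).factorial : ℝ)
          have h3 : ((k + 1 : ℕ) : ℝ) * t ^ (k + 1 - 1) / (k + 1).factorial
              = t ^ k / k.factorial := by
            rw [Nat.factorial_succ, Nat.add_sub_cancel]
            push_cast
            field_simp
          rwa [h3] at h2
        simpa using (HasCurveDerivAt.const (d (k + 1) 0) t).smul_real h1
      have h3 := ((hd 0 t).add (hs.const_smul (-1))).add (HasCurveDerivAt.const (-d 0 0) t)
      convert h3 using 1
      · funext t
        simp only [Finset.sum_range_succ', Pi.add_apply]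
        simp
        abel
      · simp [sub_eq_add_neg]
    have key := seminorm_sub_le_of_hasCurveDerivAt p hp hder (r := r) (C := C * |r| ^ n) ?_
    · have h0 : d 0 0 - ∑ k ∈ Finset.range (n + 1), ((0 : ℝ) ^ k / k.factorial) • d k 0 = 0 := by
        simp [Finset.sum_range_succ']
      rw [h0, sub_zero] at key
      calc _ ≤ _ := key
        _ = _ := by ring
    · intro t ht
      refine (ih (d := fun k => d (k + 1)) (fun k t => hd (k + 1) t) (r := t) (C := C)
        fun s hs => hC s (hs.trans ht)).trans ?_
      gcongr

end Taylor

/-! ### Smooth curves through prescribed line segments -/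

section SpecialCurve

/-- The `k`-th derivative of the `n`-th term is at most `C / n! * 4 ^ ((n + 1) * k) * M k`. The
factorial beats the geometric growth, so all derived series converge uniformly. -/
theorem contDiff_tsum_bumps {g : ℝ → ℝ} (hg : ContDiff ℝ ∞ g) (hsupp : HasCompactSupport g)
    {a : ℕ → ℝ} {C : ℝ} (ha : ∀ n, |a n| ≤ C / n.factorial) :
    ContDiff ℝ ∞ (fun t => ∑' n, a n * g (4 ^ (n + 1) * (t - (1 / 2) ^ n))) := by
  have hM : ∀ k : ℕ, ∃ M, ∀ x, ‖iteratedDeriv k g x‖ ≤ M := fun k => by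
    have h1 := (hsupp.iteratedFDeriv (𝕜 := ℝ) k).exists_bound_of_continuous
      (hg.continuous_iteratedFDeriv (m := k) (by exact_mod_cast le_top))
    obtain ⟨M, hM⟩ := h1
    exact ⟨M, fun x => by rw [← norm_iteratedFDeriv_eq_norm_iteratedDeriv]; exact hM x⟩
  choose M hM using hM
  refine contDiff_tsum (N := ⊤) (v := fun k n => C / n.factorial * ((4 ^ (n + 1)) ^ k * M k))
    (fun n => ?_) (fun k _ => ?_) (fun k n x _ => ?_)
  · exact contDiff_const.mul (hg.comp (contDiff_const.mul (contDiff_id.sub contDiff_const)))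
  · have := (Real.summable_pow_div_factorial ((4 : ℝ) ^ k)).mul_left (C * 4 ^ k * M k)
    refine this.congr fun n => ?_
    rw [← pow_mul, ← pow_mul]
    ring
  · rw [norm_iteratedFDeriv_eq_norm_iteratedDeriv, iteratedDeriv_const_mul_field,
      iteratedDeriv_comp_sub_const k (fun y => g (4 ^ (n + 1) * y)) ((1 / 2) ^ n),
      iteratedDeriv_comp_const_mul (hg.of_le (by exact_mod_cast le_top))]
    simp only [norm_mul, norm_pow, Real.norm_ofNat]
    exact mul_le_mul (ha n) (mul_le_mul_of_nonneg_left (hM k _) (by positivity)) (by positivity)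
      ((abs_nonneg _).trans (ha n))

/-- The bumps do not interfere: for `t` near `2⁻ⁿ` and `m ≠ n` the distance from `t` to `2⁻ᵐ` is at
least `2⁻ᵐ / 4`, which the scaling by `4 ^ (m + 1)` enlarges to at least `2 ^ m ≥ 1`. -/
theorem tsum_bumps_eventuallyEq {g : ℝ → ℝ} (hsupp : ∀ y, 1 ≤ |y| → g y = 0) (a : ℕ → ℝ) (n : ℕ) :
    (fun t => ∑' m, a m * g (4 ^ (m + 1) * (t - (1 / 2) ^ m))) =ᶠ[𝓝 ((1 / 2 : ℝ) ^ n)]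
      fun t => a n * g (4 ^ (n + 1) * (t - (1 / 2) ^ n)) := by
  filter_upwards [Metric.ball_mem_nhds ((1 / 2 : ℝ) ^ n)
    (show (0 : ℝ) < (1 / 2) ^ n / 8 by positivity)] with t ht
  refine tsum_eq_single n fun m hm => ?_
  rw [Metric.mem_ball, Real.dist_eq] at ht
  rw [hsupp, mul_zero]
  have h4 : ∀ m : ℕ, (4 : ℝ) ^ (m + 1) * (1 / 2) ^ m = 4 * 2 ^ m := fun m => by
    rw [pow_succ, mul_right_comm, ← mul_pow]; norm_num; ring
  have h1m : ∀ m : ℕ, (1 : ℝ) ≤ 2 ^ m := fun m => one_le_pow₀ (by norm_num)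
  rw [abs_mul, abs_of_pos (by positivity : (0 : ℝ) < 4 ^ (m + 1))]
  have habs := abs_le.1 ht.le
  rcases lt_or_gt_of_ne hm with hlt | hlt
  · have h1 : (1 / 2 : ℝ) ^ n ≤ (1 / 2) ^ (m + 1) :=
      pow_le_pow_of_le_one (by norm_num) (by norm_num) hlt
    rw [pow_succ] at h1
    have h2 : (1 / 2 : ℝ) ^ m / 4 ≤ |t - (1 / 2) ^ m| := by
      rw [abs_sub_comm]
      have : (0 : ℝ) < (1 / 2) ^ m := by positivity
      refine le_trans ?_ (le_abs_self _)
      linarith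
    calc (1 : ℝ) ≤ 2 ^ m := h1m m
      _ = 4 ^ (m + 1) * ((1 / 2) ^ m / 4) := by rw [← mul_div_assoc, h4]; ring
      _ ≤ _ := by gcongr
  · have h1 : (1 / 2 : ℝ) ^ m ≤ (1 / 2) ^ (n + 1) :=
      pow_le_pow_of_le_one (by norm_num) (by norm_num) hlt
    rw [pow_succ] at h1
    have h2 : (1 / 2 : ℝ) ^ m / 4 ≤ |t - (1 / 2) ^ m| := by
      have : (0 : ℝ) < (1 / 2) ^ m := by positivity
      refine le_trans ?_ (le_abs_self _)
      linarith
    calc (1 : ℝ) ≤ 2 ^ m := h1m m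
      _ = 4 ^ (m + 1) * ((1 / 2) ^ m / 4) := by rw [← mul_div_assoc, h4]; ring
      _ ≤ _ := by gcongr

/-- If `x n → x₀` fast, a smooth curve runs through all `x n` at times `2⁻ⁿ` along line segments
with velocity `v / n!`. -/
theorem exists_smooth_curve_through (x₀ v : ℝ × ℝ) {x : ℕ → ℝ × ℝ}
    (hx : ∀ n, ‖x n - x₀‖ ≤ 1 / n.factorial) :
    ∃ c : ℝ → ℝ × ℝ, IsSmoothCurve c ∧ ∀ n : ℕ, c =ᶠ[𝓝 ((1 / 2 : ℝ) ^ n)]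
      fun t => x n + ((1 / n.factorial) * (t - (1 / 2) ^ n) : ℝ) • v := by
  let b : ContDiffBump (0 : ℝ) := ⟨1 / 2, 1, by norm_num, by norm_num⟩
  have hb : ContDiff ℝ ∞ b := b.contDiff
  have hb0 : ∀ y, 1 ≤ |y| → b y = 0 := fun y hy => b.zero_of_le_dist (by simpa using hy)
  have hb1 : ∀ y, |y| ≤ 1 / 2 → b y = 1 := fun y hy =>
    b.one_of_mem_closedBall (by rw [mem_closedBall_zero_iff]; exact hy)
  have hψ : ContDiff ℝ ∞ (fun y => y * b y) := contDiff_id.mul hb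
  have hψ0 : ∀ y, 1 ≤ |y| → y * b y = 0 := fun y hy => by rw [hb0 y hy, mul_zero]
  have hbs : HasCompactSupport b := b.hasCompactSupport
  have key : ∀ (y₀ w : ℝ) (y : ℕ → ℝ), (∀ n, |y n - y₀| ≤ 1 / n.factorial) →
      ∃ c : ℝ → ℝ, ContDiff ℝ ∞ c ∧ ∀ n : ℕ, c =ᶠ[𝓝 ((1 / 2 : ℝ) ^ n)]
        fun t => y n + ((1 / n.factorial) * (t - (1 / 2) ^ n) : ℝ) * w := by
    intro y₀ w y hy
    -- The first series moves `y₀` to `y n` near `2⁻ⁿ`. The second uses `y * b y`, which is `y` near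
    -- `0`; its coefficient `1 / 4 ^ (n + 1)` undoes the scaling of the argument and leaves the
    -- slope `w / n!`.
    refine ⟨_, ((contDiff_const (c := y₀)).add (contDiff_tsum_bumps hb hbs hy)).add
      (contDiff_tsum_bumps (a := fun n => 1 / n.factorial * (1 / 4 ^ (n + 1)) * w) (C := |w|)
        hψ (hbs.mul_left) fun n => ?_), fun n => ?_⟩
    · rw [abs_mul, abs_mul, abs_of_pos (by positivity : (0 : ℝ) < 1 / n.factorial),
        abs_of_pos (by positivity : (0 : ℝ) < 1 / 4 ^ (n + 1))]
      have h1 : (1 : ℝ) / 4 ^ (n + 1) ≤ 1 :=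
        div_le_one_of_le₀ (one_le_pow₀ (by norm_num)) (by positivity)
      calc 1 / (n.factorial : ℝ) * (1 / 4 ^ (n + 1)) * |w| ≤ 1 / n.factorial * 1 * |w| := by gcongr
        _ = |w| / n.factorial := by ring
    · have hlim : ∀ᶠ t in 𝓝 ((1 / 2 : ℝ) ^ n), |4 ^ (n + 1) * (t - (1 / 2 : ℝ) ^ n)| < 1 / 2 := by
        refine ContinuousAt.eventually_lt (by fun_prop) continuousAt_const ?_
        simp
      filter_upwards [tsum_bumps_eventuallyEq hb0 (fun n => y n - y₀) n,
        tsum_bumps_eventuallyEq hψ0 (fun n => 1 / n.factorial * (1 / 4 ^ (n + 1)) * w) n,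
        hlim] with t h1 h2 h3
      rw [h1, h2, hb1 _ h3.le]
      field_simp
      ring
  obtain ⟨c₁, hc₁, h₁⟩ := key x₀.1 v.1 (fun n => (x n).1) fun n => (norm_fst_le _).trans (hx n)
  obtain ⟨c₂, hc₂, h₂⟩ := key x₀.2 v.2 (fun n => (x n).2) fun n => (norm_snd_le _).trans (hx n)
  refine ⟨fun t => (c₁ t, c₂ t), (isSmoothCurve_real_iff.2 hc₁).prodMk
    (isSmoothCurve_real_iff.2 hc₂), fun n => ?_⟩
  filter_upwards [h₁ n, h₂ n] with t ht₁ ht₂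
  rw [ht₁, ht₂]
  rfl

end SpecialCurve

open scoped ContDiff

/-! ### Iterated directional derivatives -/

section DirDeriv

/-- The `q`-th derivative of `f` at `x` along the line with direction `v`. -/
noncomputable def dirDeriv {G F : Type*} [AddCommGroup G] [Module ℝ G]
    [AddCommGroup F] [Module ℝ F] [TopologicalSpace F] (f : G → F) (v : G) (q : ℕ) (x : G) : F :=
  curveDeriv^[q] (fun t : ℝ => f (x + t • v)) 0

section General

variable {G F : Type*} [AddCommGroup G] [Module ℝ G] [TopologicalSpace G]
  [IsTopologicalAddGroup G] [ContinuousSMul ℝ G]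
  [AddCommGroup F] [Module ℝ F] [TopologicalSpace F] [IsTopologicalAddGroup F]
  [ContinuousSMul ℝ F] [T2Space F] {f : G → F}

omit [IsTopologicalAddGroup F] [ContinuousSMul ℝ F] [T2Space F] in
theorem IsSmoothMap.line (hf : IsSmoothMap f) (x v : G) :
    IsSmoothCurve (fun t : ℝ => f (x + t • v)) :=
  hf _ (IsSmoothCurve.line x v)

omit [IsTopologicalAddGroup F] in
theorem iterate_curveDeriv_line (hf : IsSmoothMap f) (x v : G) (q : ℕ) (a b t : ℝ) :
    curveDeriv^[q] (fun t : ℝ => f (x + (a * t + b) • v)) t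
      = a ^ q • dirDeriv f v q (x + (a * t + b) • v) := by
  have h1 := iterate_curveDeriv_comp_affine (hf.line x v) a b q
  have h2 := iterate_curveDeriv_comp_affine (hf.line x v) 1 (a * t + b) q
  rw [h1]
  unfold dirDeriv
  have h3 : (fun s : ℝ => f (x + (a * t + b) • v + s • v))
      = fun s => f (x + (1 * s + (a * t + b)) • v) := by
    funext s
    rw [add_assoc, ← add_smul, one_mul, add_comm s]
  rw [h3, h2]
  simp

theorem hasCurveDerivAt_dirDeriv_line (hf : IsSmoothMap f) (x v : G) (q : ℕ) (t : ℝ) :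
    HasCurveDerivAt (fun t : ℝ => dirDeriv f v q (x + t • v))
      (dirDeriv f v (q + 1) (x + t • v)) t := by
  have h := (hf.line x v).hasCurveDerivAt_iterate q t
  have h1 : ∀ q t, curveDeriv^[q] (fun t : ℝ => f (x + t • v)) t = dirDeriv f v q (x + t • v) := by
    intro q t
    simpa using iterate_curveDeriv_line hf x v q 1 0 t
  rw [h1] at h
  rwa [show curveDeriv^[q] (fun t : ℝ => f (x + t • v)) = _ from funext (h1 q)] at h

end General

theorem seminorm_sum_le {𝕜 F ι : Type*} [NormedField 𝕜] [AddCommGroup F] [Module 𝕜 F]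
    (p : Seminorm 𝕜 F) (s : Finset ι) (g : ι → F) : p (∑ i ∈ s, g i) ≤ ∑ i ∈ s, p (g i) :=
  Finset.le_sum_of_subadditive p (map_zero p).le (map_add_le_add p) s g

variable {F : Type*} [AddCommGroup F] [Module ℝ F] [TopologicalSpace F] [IsTopologicalAddGroup F]
  [ContinuousSMul ℝ F] [T2Space F] {f : ℝ × ℝ → F}

/-- Directional derivatives of a smooth map on the plane are locally bounded. -/
theorem dirDeriv_locally_bounded (hf : IsSmoothMap f) (p : Seminorm ℝ F) (hp : Continuous p)
    (v : ℝ × ℝ) (q : ℕ) (x₀ : ℝ × ℝ) : ∃ C, ∀ᶠ x in 𝓝 x₀, p (dirDeriv f v q x) ≤ C := by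
  by_contra! hcon
  -- A curve through `x n` with velocity `v / n!` gives `f ∘ c` the `q`-th derivative `(1 / n!) ^ q
  -- • dirDeriv f v q (x n)` at `2⁻ⁿ`. The points are chosen so that this exceeds `n`, contradicting
  -- continuity of that derivative at `0`.
  have hex : ∀ n : ℕ, ∃ x : ℝ × ℝ, ‖x - x₀‖ ≤ 1 / n.factorial ∧
      (n : ℝ) < (1 / n.factorial) ^ q * p (dirDeriv f v q x) := by
    intro n
    have h1 := hcon (n / (1 / n.factorial) ^ q)
    have h2 : ∀ᶠ x in 𝓝 x₀, ‖x - x₀‖ ≤ 1 / n.factorial := by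
      filter_upwards [Metric.ball_mem_nhds x₀ (show (0 : ℝ) < 1 / n.factorial by positivity)]
        with x hx
      rw [← dist_eq_norm]
      exact (Metric.mem_ball.1 hx).le
    obtain ⟨x, hx, hx'⟩ := (h1.and_eventually h2).exists
    refine ⟨x, hx', ?_⟩
    rw [div_lt_iff₀ (by positivity)] at hx
    linarith
  choose x hx hx' using hex
  obtain ⟨c, hc, hcx⟩ := exists_smooth_curve_through x₀ v hx
  have hfc : IsSmoothCurve (f ∘ c) := hf c hc
  have hval : ∀ n : ℕ, curveDeriv^[q] (f ∘ c) ((1 / 2) ^ n)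
      = (1 / n.factorial : ℝ) ^ q • dirDeriv f v q (x n) := by
    intro n
    have e : (f ∘ c) =ᶠ[𝓝 ((1 / 2 : ℝ) ^ n)] fun t : ℝ =>
        f (x n + ((1 / n.factorial) * t + -((1 / n.factorial) * (1 / 2) ^ n) : ℝ) • v) := by
      filter_upwards [hcx n] with t ht
      rw [Function.comp, ht]
      congr 3
      ring
    rw [(iterate_curveDeriv_congr e q).eq_of_nhds, iterate_curveDeriv_line hf]
    simp
  have hlim : Tendsto (fun n : ℕ => p (curveDeriv^[q] (f ∘ c) ((1 / 2) ^ n))) atTop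
      (𝓝 (p (curveDeriv^[q] (f ∘ c) 0))) :=
    ((hp.comp (hfc.iterate q).continuous).tendsto 0).comp
      (tendsto_pow_atTop_nhds_zero_of_lt_one (by norm_num) (by norm_num))
  refine not_tendsto_atTop_of_tendsto_nhds hlim
    (tendsto_atTop_mono (fun n => ?_) tendsto_natCast_atTop_atTop)
  rw [hval, map_smul_eq_mul, Real.norm_of_nonneg (by positivity)]
  exact (hx' n).le

/-- Taylor's theorem along lines, locally uniformly in the base point. -/
theorem dirDeriv_taylor (hf : IsSmoothMap f) (p : Seminorm ℝ F) (hp : Continuous p)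
    (v : ℝ × ℝ) (m : ℕ) (x₀ : ℝ × ℝ) : ∃ C, ∀ᶠ z : (ℝ × ℝ) × ℝ in 𝓝 (x₀, 0),
      p (f (z.1 + z.2 • v) - ∑ k ∈ Finset.range m, (z.2 ^ k / k.factorial) • dirDeriv f v k z.1)
        ≤ C * |z.2| ^ m := by
  obtain ⟨C, hC⟩ := dirDeriv_locally_bounded hf p hp v m x₀
  obtain ⟨r, hr, hr'⟩ := Metric.eventually_nhds_iff.1 hC
  refine ⟨C, ?_⟩
  have h1 : ∀ᶠ z : (ℝ × ℝ) × ℝ in 𝓝 (x₀, 0), ‖z.1 - x₀‖ + |z.2| * ‖v‖ < r := by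
    refine ContinuousAt.eventually_lt (by fun_prop) continuousAt_const ?_
    simpa using hr
  filter_upwards [h1] with z hz
  have := seminorm_taylor_le p hp m (d := fun k t => dirDeriv f v k (z.1 + t • v))
    (fun k t => hasCurveDerivAt_dirDeriv_line hf z.1 v k t) (r := z.2) (C := C) (fun t ht => by
      refine hr' ?_
      rw [dist_eq_norm, add_sub_right_comm]
      refine (norm_add_le _ _).trans_lt (lt_of_le_of_lt ?_ hz)
      rw [norm_smul, Real.norm_eq_abs]
      gcongr)
  simpa [dirDeriv] using this

/-- Invertibility of the Vandermonde matrix with nodes `0, …, m - 1`. The combination `∑ w j • g (j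
h)` then kills every Taylor term of `g` of order below `m` except the `q`-th. -/
theorem exists_finite_difference_weights (q m : ℕ) : ∃ w : ℕ → ℝ, ∀ i < m,
    ∑ j ∈ Finset.range m, w j * (j : ℝ) ^ i = if i = q then (q.factorial : ℝ) else 0 := by
  set V : Matrix (Fin m) (Fin m) ℝ := Matrix.vandermonde fun j => (j : ℝ) with hV
  have hdet : IsUnit V.det := by
    rw [isUnit_iff_ne_zero, hV, Matrix.det_vandermonde_ne_zero_iff]
    intro a b hab
    exact Fin.ext (Nat.cast_injective (R := ℝ) hab)
  set e : Fin m → ℝ := fun i => if (i : ℕ) = q then (q.factorial : ℝ) else 0 with he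
  set w : Fin m → ℝ := Matrix.vecMul e V⁻¹ with hw
  have hwV : Matrix.vecMul w V = e := by
    rw [hw, Matrix.vecMul_vecMul, Matrix.nonsing_inv_mul _ hdet, Matrix.vecMul_one]
  refine ⟨fun j => if h : j < m then w ⟨j, h⟩ else 0, fun i hi => ?_⟩
  have := congrFun hwV ⟨i, hi⟩
  rw [Finset.sum_range]
  simpa [Matrix.vecMul, dotProduct, hV, Matrix.vandermonde_apply, he] using this

variable [LocallyConvexSpace ℝ F]

omit [T2Space F] in
theorem tendsto_of_seminorms {α : Type*} {l : Filter α} {g : α → F} {y : F}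
    (h : ∀ p : Seminorm ℝ F, Continuous p → Tendsto (fun a => p (g a - y)) l (𝓝 0)) :
    Tendsto g l (𝓝 y) := by
  rw [(PolynormableSpace.withSeminorms ℝ F).tendsto_nhds]
  exact fun p ε hε => (h p.1 p.2).eventually_lt_const hε

omit [LocallyConvexSpace ℝ F] in
-- Multiplying by `h ^ q` turns the limit into `0`, which forces the constant coefficient of a
-- polynomial with `q ≥ 1` to vanish. Then one power of `h` cancels and induction applies.
theorem coeff_eq_of_tendsto (q : ℕ) : ∀ {b : ℕ → F} {y : F},
    Tendsto (fun h : ℝ => (h ^ q)⁻¹ • ∑ i ∈ Finset.range (q + 1), h ^ i • b i) (𝓝[≠] 0) (𝓝 y) →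
    (∀ i < q, b i = 0) ∧ b q = y := by
  induction q with
  | zero =>
    intro b y h
    refine ⟨fun i hi => absurd hi (Nat.not_lt_zero i), ?_⟩
    simp only [pow_zero, inv_one, zero_add, Finset.range_one, Finset.sum_singleton, one_smul] at h
    exact tendsto_nhds_unique tendsto_const_nhds h
  | succ q ih =>
    intro b y h
    have hid : Tendsto (fun h : ℝ => h) (𝓝[≠] 0) (𝓝 0) := nhdsWithin_le_nhds
    have hne : ∀ᶠ h : ℝ in 𝓝[≠] 0, h ≠ 0 := eventually_mem_nhdsWithin
    have h0 : b 0 = 0 := by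
      have h1 := (hid.pow (q + 1)).smul h
      rw [zero_pow (Nat.succ_ne_zero q), zero_smul] at h1
      have h2 : Tendsto (fun h : ℝ => ∑ i ∈ Finset.range (q + 2), h ^ i • b i) (𝓝[≠] 0)
          (𝓝 (∑ i ∈ Finset.range (q + 2), (0 : ℝ) ^ i • b i)) :=
        tendsto_finsetSum _ fun i _ => (hid.pow i).smul tendsto_const_nhds
      have h3 := tendsto_nhds_unique h2 (h1.congr' (by
        filter_upwards [hne] with h hh
        rw [smul_smul, mul_inv_cancel₀ (pow_ne_zero _ hh), one_smul]))
      simpa [Finset.sum_range_succ'] using h3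
    have h1 : Tendsto (fun h : ℝ => (h ^ q)⁻¹ • ∑ i ∈ Finset.range (q + 1), h ^ i • b (i + 1))
        (𝓝[≠] 0) (𝓝 y) := by
      refine h.congr' ?_
      filter_upwards [hne] with h hh
      rw [Finset.sum_range_succ', h0, smul_zero, add_zero]
      simp only [Finset.smul_sum, smul_smul]
      refine Finset.sum_congr rfl fun i _ => ?_
      congr 1
      field_simp
      ring
    obtain ⟨h2, h3⟩ := ih h1
    refine ⟨fun i hi => ?_, h3⟩
    cases i with
    | zero => exact h0
    | succ i => exact h2 i (by omega)

omit [LocallyConvexSpace ℝ F] in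
/-- The finite difference approximation of `dirDeriv`, locally uniformly in the base point. -/
theorem dirDeriv_finite_difference (hf : IsSmoothMap f) (p : Seminorm ℝ F) (hp : Continuous p)
    (v : ℝ × ℝ) {q m : ℕ} (hq : q < m) {w : ℕ → ℝ}
    (hw : ∀ i < m, ∑ j ∈ Finset.range m, w j * (j : ℝ) ^ i = if i = q then (q.factorial : ℝ) else 0)
    (x₀ : ℝ × ℝ) : ∃ C, ∀ᶠ z : (ℝ × ℝ) × ℝ in 𝓝 (x₀, 0),
      p (∑ j ∈ Finset.range m, w j • f (z.1 + (j * z.2) • v) - z.2 ^ q • dirDeriv f v q z.1)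
        ≤ C * |z.2| ^ m := by
  have h1 := fun j : ℕ => dirDeriv_taylor hf p hp v m x₀
  obtain ⟨C, hC⟩ := dirDeriv_taylor hf p hp v m x₀
  have h2 : ∀ j : ℕ, ∀ᶠ z : (ℝ × ℝ) × ℝ in 𝓝 (x₀, 0),
      p (f (z.1 + (j * z.2) • v)
        - ∑ k ∈ Finset.range m, ((j * z.2) ^ k / k.factorial) • dirDeriv f v k z.1)
        ≤ C * |j * z.2| ^ m := by
    intro j
    have h3 : Tendsto (fun z : (ℝ × ℝ) × ℝ => (z.1, (j : ℝ) * z.2)) (𝓝 (x₀, 0)) (𝓝 (x₀, 0)) := by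
      have : Continuous (fun z : (ℝ × ℝ) × ℝ => (z.1, (j : ℝ) * z.2)) := by fun_prop
      simpa using this.tendsto (x₀, 0)
    exact h3.eventually hC
  refine ⟨∑ j ∈ Finset.range m, |w j| * (C * |(j : ℝ)| ^ m), ?_⟩
  filter_upwards [(Filter.eventually_all_finset (Finset.range m)).2 fun j _ => h2 j] with z hz
  -- The weights applied to the Taylor polynomials leave only the term `k = q`, where the factor
  -- `q!` cancels.
  have h4 : z.2 ^ q • dirDeriv f v q z.1 = ∑ j ∈ Finset.range m, w j •
      ∑ k ∈ Finset.range m, ((j * z.2) ^ k / k.factorial) • dirDeriv f v k z.1 := by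
    simp only [Finset.smul_sum, smul_smul]
    rw [Finset.sum_comm]
    simp only [← Finset.sum_smul]
    rw [Finset.sum_eq_single_of_mem q (Finset.mem_range.2 hq)]
    · congr 1
      have := hw q hq
      rw [if_pos rfl] at this
      calc z.2 ^ q = (q.factorial : ℝ) * (z.2 ^ q / q.factorial) := by field_simp
        _ = _ := by
          rw [← this, Finset.sum_mul]
          refine Finset.sum_congr rfl fun j _ => ?_
          rw [mul_pow]; ring
    · intro k hk hkq
      have := hw k (Finset.mem_range.1 hk)
      rw [if_neg hkq] at this
      have h5 : ∑ j ∈ Finset.range m, w j * ((j * z.2) ^ k / k.factorial)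
          = (∑ j ∈ Finset.range m, w j * (j : ℝ) ^ k) * (z.2 ^ k / k.factorial) := by
        rw [Finset.sum_mul]
        refine Finset.sum_congr rfl fun j _ => ?_
        rw [mul_pow]; ring
      rw [h5, this, zero_mul, zero_smul]
  rw [h4, ← Finset.sum_sub_distrib, Finset.sum_mul]
  refine (seminorm_sum_le p _ _).trans (Finset.sum_le_sum fun j hj => ?_)
  rw [← smul_sub, map_smul_eq_mul, Real.norm_eq_abs, mul_assoc]
  refine mul_le_mul_of_nonneg_left ((hz j hj).trans (le_of_eq ?_)) (abs_nonneg _)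
  rw [abs_mul, mul_pow, mul_assoc]

/-- For a fixed step `k` the finite difference `S` is continuous in `h`, because `f` is smooth along
lines. It approximates `k ^ q • dirDeriv` up to `C * k ^ (q + 1)` uniformly for base points near
`x₀`, so `k` is fixed first and `h` is made small afterwards. -/
theorem continuousAt_dirDeriv_line (hf : IsSmoothMap f) (v e x₀ : ℝ × ℝ) (q : ℕ) :
    Tendsto (fun h : ℝ => dirDeriv f v q (x₀ + h • e)) (𝓝 0) (𝓝 (dirDeriv f v q x₀)) := by
  refine tendsto_of_seminorms fun p hp => ?_
  obtain ⟨w, hw⟩ := exists_finite_difference_weights q (q + 1)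
  obtain ⟨C, hC⟩ := dirDeriv_finite_difference hf p hp v (Nat.lt_succ_self q) hw x₀
  have hapx : ∀ᶠ k : ℝ in 𝓝[>] 0, ∀ᶠ h : ℝ in 𝓝 0,
      p (∑ j ∈ Finset.range (q + 1), w j • f (x₀ + h • e + (j * k) • v)
        - k ^ q • dirDeriv f v q (x₀ + h • e)) ≤ C * |k| ^ (q + 1) := by
    rw [nhds_prod_eq, eventually_swap_iff] at hC
    have h1 := hC.curry
    refine (h1.filter_mono nhdsWithin_le_nhds).mono fun k hk => ?_
    have h2 : Tendsto (fun h : ℝ => x₀ + h • e) (𝓝 0) (𝓝 x₀) := by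
      have : Continuous (fun h : ℝ => x₀ + h • e) := by fun_prop
      simpa using this.tendsto 0
    exact h2.eventually hk
  rw [Metric.tendsto_nhds]
  intro ε hε
  -- The approximation error enters twice, at `x₀ + h • e` and at `x₀`, and is divided by `k ^ q`.
  have hsmall : ∀ᶠ k : ℝ in 𝓝[>] 0, 2 * (C * k) < ε / 2 := by
    refine Filter.Eventually.filter_mono nhdsWithin_le_nhds ?_
    refine ContinuousAt.eventually_lt (by fun_prop) continuousAt_const ?_
    simpa using hε
  obtain ⟨k, ⟨hk, hkε⟩, hk0⟩ := ((hapx.and hsmall).and self_mem_nhdsWithin).exists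
  have hk0 : 0 < k := hk0
  set S : ℝ → F := fun h => ∑ j ∈ Finset.range (q + 1), w j • f (x₀ + h • e + (j * k) • v) with hS
  have hScont : Tendsto (fun h => p (S h - S 0)) (𝓝 0) (𝓝 0) := by
    have h1 : Continuous S := by
      refine continuous_finsetSum _ fun j _ => Continuous.const_smul ?_ _
      have := (hf.line (x₀ + (j * k) • v) e).continuous
      refine this.congr fun h => ?_
      rw [add_right_comm]
    have h2 : Continuous fun h => p (S h - S 0) := hp.comp (h1.sub continuous_const)
    simpa using h2.tendsto 0
  have hev := hScont.eventually_lt_const (show (0 : ℝ) < k ^ q * (ε / 2) by positivity)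
  have hk00 := hk.self_of_nhds
  filter_upwards [hk, hev] with h hh hh'
  rw [Real.dist_0_eq_abs, abs_of_nonneg (apply_nonneg p _)]
  rw [zero_smul, add_zero] at hk00
  have hS0 : S 0 = ∑ j ∈ Finset.range (q + 1), w j • f (x₀ + (j * k) • v) := by simp [hS]
  rw [← hS0] at hk00
  have key : k ^ q * p (dirDeriv f v q (x₀ + h • e) - dirDeriv f v q x₀)
      ≤ 2 * (C * k ^ (q + 1)) + p (S h - S 0) := by
    rw [← Real.norm_of_nonneg (show (0 : ℝ) ≤ k ^ q by positivity), ← map_smul_eq_mul]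
    have h3 : k ^ q • (dirDeriv f v q (x₀ + h • e) - dirDeriv f v q x₀)
        = -(S h - k ^ q • dirDeriv f v q (x₀ + h • e)) + (S 0 - k ^ q • dirDeriv f v q x₀)
          + (S h - S 0) := by
      rw [smul_sub]; abel
    rw [h3]
    refine (map_add_le_add p _ _).trans (add_le_add ((map_add_le_add p _ _).trans ?_) le_rfl)
    rw [map_neg_eq_map]
    rw [abs_of_pos hk0] at hh hk00
    linarith
  have : k ^ q * p (dirDeriv f v q (x₀ + h • e) - dirDeriv f v q x₀) < k ^ q * ε := by
    calc _ ≤ _ := key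
      _ < k ^ q * (2 * (C * k)) + k ^ q * (ε / 2) := by
        have : 2 * (C * k ^ (q + 1)) = k ^ q * (2 * (C * k)) := by ring
        linarith
      _ < k ^ q * (ε / 2) + k ^ q * (ε / 2) := by gcongr
      _ = k ^ q * ε := by ring
  exact lt_of_mul_lt_mul_left this (by positivity)

/-- The derivative of a directional derivative in another direction exists, and it is a linear
combination of directional derivatives. -/
theorem exists_hasCurveDerivAt_dirDeriv (hf : IsSmoothMap f) (v e : ℝ × ℝ) (q : ℕ) :
    ∃ a : ℕ → ℝ, ∀ x₀ : ℝ × ℝ, HasCurveDerivAt (fun h : ℝ => dirDeriv f v q (x₀ + h • e))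
      (∑ j ∈ Finset.range (q + 2), a j • dirDeriv f (e + (j : ℝ) • v) (q + 1) x₀) 0 := by
  -- Taking the step equal to `h`, the finite difference at `x₀ + h • e` samples `f` at `x₀ + h • (e
  -- + j • v)`, on lines through `x₀`. Taylor expansion along them gives `h ^ q • U h = ∑ h ^ i • a
  -- i + O(h ^ (q + 2))`. Since `U` is continuous at `0`, `a i = 0` for `i < q` and `a q = U 0`;
  -- then `a (q + 1)` is the derivative. Order `q + 2` leaves an error `O(h)` after division by `h ^
  -- (q + 1)`.
  obtain ⟨w, hw⟩ := exists_finite_difference_weights q (q + 2)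
  refine ⟨fun j => w j / (q + 1).factorial, fun x₀ => ?_⟩
  set a : ℕ → F := fun i => ∑ j ∈ Finset.range (q + 2),
    (w j / i.factorial) • dirDeriv f (e + (j : ℝ) • v) i x₀ with ha
  set U : ℝ → F := fun h => dirDeriv f v q (x₀ + h • e) with hU
  have main : ∀ p : Seminorm ℝ F, Continuous p → ∃ C, ∀ᶠ h : ℝ in 𝓝 0,
      p (h ^ q • U h - ∑ i ∈ Finset.range (q + 2), h ^ i • a i) ≤ C * |h| ^ (q + 2) := by
    intro p hp
    obtain ⟨C, hC⟩ := dirDeriv_finite_difference hf p hp v (show q < q + 2 by omega) hw x₀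
    have h1 : Tendsto (fun h : ℝ => (x₀ + h • e, h)) (𝓝 0) (𝓝 (x₀, 0)) := by
      have : Continuous (fun h : ℝ => (x₀ + h • e, h)) := by fun_prop
      simpa using this.tendsto 0
    have hC' := h1.eventually hC
    have h2 : ∀ j : ℕ, ∃ B, ∀ᶠ h : ℝ in 𝓝 0, p (f (x₀ + h • (e + (j : ℝ) • v)) -
        ∑ k ∈ Finset.range (q + 2), (h ^ k / k.factorial) •
          dirDeriv f (e + (j : ℝ) • v) k x₀) ≤ B * |h| ^ (q + 2) := by
      intro j
      obtain ⟨B, hB⟩ := dirDeriv_taylor hf p hp (e + (j : ℝ) • v) (q + 2) x₀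
      refine ⟨B, ?_⟩
      have h3 : Tendsto (fun h : ℝ => (x₀, h)) (𝓝 0) (𝓝 (x₀, 0)) :=
        (Continuous.prodMk_right x₀).tendsto 0
      exact h3.eventually hB
    choose B hB using h2
    refine ⟨C + ∑ j ∈ Finset.range (q + 2), |w j| * B j, ?_⟩
    filter_upwards [hC', (Filter.eventually_all_finset (Finset.range (q + 2))).2 fun j _ => hB j]
      with h hh hj
    have h4 : ∑ i ∈ Finset.range (q + 2), h ^ i • a i = ∑ j ∈ Finset.range (q + 2), w j •
        ∑ k ∈ Finset.range (q + 2), (h ^ k / k.factorial) •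
          dirDeriv f (e + (j : ℝ) • v) k x₀ := by
      simp only [ha, Finset.smul_sum, smul_smul]
      rw [Finset.sum_comm]
      refine Finset.sum_congr rfl fun j _ => Finset.sum_congr rfl fun i _ => ?_
      congr 1
      ring
    have h5 : ∀ j : ℕ, x₀ + h • e + ((j : ℝ) * h) • v = x₀ + h • (e + (j : ℝ) • v) := by
      intro j
      rw [smul_add, smul_smul, add_assoc, mul_comm]
    simp only [h5] at hh
    have h6 : h ^ q • U h - ∑ i ∈ Finset.range (q + 2), h ^ i • a i
        = -(∑ j ∈ Finset.range (q + 2), w j • f (x₀ + h • (e + (j : ℝ) • v)) - h ^ q • U h)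
          + ∑ j ∈ Finset.range (q + 2), w j • (f (x₀ + h • (e + (j : ℝ) • v)) -
            ∑ k ∈ Finset.range (q + 2), (h ^ k / k.factorial) •
              dirDeriv f (e + (j : ℝ) • v) k x₀) := by
      rw [h4]
      simp only [smul_sub, Finset.sum_sub_distrib]
      abel
    rw [h6, add_mul, Finset.sum_mul]
    refine (map_add_le_add p _ _).trans (add_le_add ?_ ?_)
    · rw [map_neg_eq_map]; exact hh
    · refine (seminorm_sum_le p _ _).trans (Finset.sum_le_sum fun j hj' => ?_)
      rw [map_smul_eq_mul, Real.norm_eq_abs, mul_assoc]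
      exact mul_le_mul_of_nonneg_left (hj j hj') (abs_nonneg _)
  have hid : Tendsto (fun h : ℝ => h) (𝓝[≠] 0) (𝓝 0) := nhdsWithin_le_nhds
  have hne : ∀ᶠ h : ℝ in 𝓝[≠] 0, h ≠ 0 := eventually_mem_nhdsWithin
  have hUlim : Tendsto U (𝓝[≠] 0) (𝓝 (U 0)) := by
    have := continuousAt_dirDeriv_line hf v e x₀ q
    simpa [hU] using this.mono_left nhdsWithin_le_nhds
  obtain ⟨hlow, hq⟩ := coeff_eq_of_tendsto (b := a) (y := U 0) q (by
    have h1 : Tendsto (fun h : ℝ => U h - h • a (q + 1)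
        - (h ^ q)⁻¹ • (h ^ q • U h - ∑ i ∈ Finset.range (q + 2), h ^ i • a i)) (𝓝[≠] 0)
        (𝓝 (U 0 - (0 : ℝ) • a (q + 1) - 0)) := by
      refine (hUlim.sub (hid.smul tendsto_const_nhds)).sub (tendsto_of_seminorms fun p hp => ?_)
      obtain ⟨C, hC⟩ := main p hp
      refine squeeze_zero' (g := fun h => C * |h| ^ 2) (Eventually.of_forall fun _ =>
        apply_nonneg p _) ?_ ?_
      · filter_upwards [hC.filter_mono nhdsWithin_le_nhds, hne] with h hh hh0
        rw [sub_zero, map_smul_eq_mul, norm_inv, norm_pow, Real.norm_eq_abs]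
        have : 0 < |h| := abs_pos.2 hh0
        rw [inv_mul_le_iff₀ (by positivity)]
        calc _ ≤ _ := hh
          _ = _ := by ring
      · have : Continuous fun h : ℝ => C * |h| ^ 2 := by fun_prop
        simpa using (this.tendsto 0).mono_left nhdsWithin_le_nhds
    rw [zero_smul, sub_zero, sub_zero] at h1
    refine h1.congr' ?_
    filter_upwards [hne] with h hh
    have h3 : h ^ q ≠ 0 := pow_ne_zero _ hh
    rw [smul_sub, smul_smul, inv_mul_cancel₀ h3, one_smul, Finset.sum_range_succ _ (q + 1),
      smul_add, smul_smul, pow_succ, ← mul_assoc, inv_mul_cancel₀ h3, one_mul]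
    abel)
  refine tendsto_of_seminorms fun p hp => ?_
  obtain ⟨C, hC⟩ := main p hp
  refine squeeze_zero' (g := fun h => C * |h|) (Eventually.of_forall fun _ =>
    apply_nonneg p _) ?_ ?_
  · filter_upwards [hC.filter_mono nhdsWithin_le_nhds, hne] with h hh hh0
    have hpos : 0 < |h| := abs_pos.2 hh0
    have h1 : ∑ i ∈ Finset.range (q + 2), h ^ i • a i = h ^ q • U 0 + h ^ (q + 1) • a (q + 1) := by
      rw [Finset.sum_range_succ, Finset.sum_range_succ, hq, Finset.sum_eq_zero, zero_add]
      intro i hi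
      rw [hlow i (Finset.mem_range.1 hi), smul_zero]
    have h2 : slope U 0 h - a (q + 1)
        = (h ^ (q + 1))⁻¹ • (h ^ q • U h - ∑ i ∈ Finset.range (q + 2), h ^ i • a i) := by
      rw [h1, smul_sub, smul_add, smul_smul, smul_smul, smul_smul,
        inv_mul_cancel₀ (pow_ne_zero _ hh0), one_smul]
      have h3 : (h ^ (q + 1))⁻¹ * h ^ q = h⁻¹ := by rw [pow_succ]; field_simp
      rw [h3, slope, sub_zero, vsub_eq_sub, smul_sub]
      abel
    change p (slope U 0 h - a (q + 1)) ≤ _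
    rw [h2, map_smul_eq_mul, norm_inv, norm_pow, Real.norm_eq_abs, inv_mul_le_iff₀ (by positivity)]
    calc _ ≤ _ := hh
      _ = _ := by ring
  · have : Continuous fun h : ℝ => C * |h| := by fun_prop
    simpa using (this.tendsto 0).mono_left nhdsWithin_le_nhds

/-- For fixed `x₀` and `e`, the span of these curves over all `v` and `q` is closed under
derivatives by `exists_hasCurveDerivAt_dirDeriv`. -/
theorem isSmoothCurve_dirDeriv (hf : IsSmoothMap f) (v e x₀ : ℝ × ℝ) (q : ℕ) :
    IsSmoothCurve (fun t : ℝ => dirDeriv f v q (x₀ + t • e)) := by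
  refine isSmoothCurve_of_mem_span (S := {c | ∃ (v : ℝ × ℝ) (q : ℕ),
    c = fun t : ℝ => dirDeriv f v q (x₀ + t • e)}) ?_ (Submodule.subset_span ⟨v, q, rfl⟩)
  rintro _ ⟨v, q, rfl⟩
  obtain ⟨a, ha⟩ := exists_hasCurveDerivAt_dirDeriv hf v e q
  refine ⟨∑ j ∈ Finset.range (q + 2), a j • fun t : ℝ =>
    dirDeriv f (e + (j : ℝ) • v) (q + 1) (x₀ + t • e), Submodule.sum_mem _ fun j _ =>
      Submodule.smul_mem _ _ (Submodule.subset_span ⟨_, _, rfl⟩), fun t => ?_⟩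
  have h1 : HasDerivAt (fun s : ℝ => s - t) 1 t := (hasDerivAt_id t).sub_const t
  have h2 := HasCurveDerivAt.comp (γ := fun s => s - t) (t := t)
    (by simpa using ha (x₀ + t • e)) h1
  rw [one_smul] at h2
  have h3 : (fun s : ℝ => dirDeriv f v q (x₀ + t • e + (s - t) • e))
      = fun s => dirDeriv f v q (x₀ + s • e) := by
    funext s
    rw [add_assoc, ← add_smul, add_sub_cancel]
  rw [h3] at h2
  simpa [Finset.sum_apply] using h2

end DirDeriv

/-- The derivative of a smooth map in a fixed direction exists and is a smooth map. -/
theorem IsSmoothMap.exists_directional {E F : Type*} [AddCommGroup E] [Module ℝ E]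
    [TopologicalSpace E] [IsTopologicalAddGroup E] [ContinuousSMul ℝ E]
    [AddCommGroup F] [Module ℝ F] [TopologicalSpace F] [IsTopologicalAddGroup F]
    [ContinuousSMul ℝ F] [T2Space F] [LocallyConvexSpace ℝ F] {f : E → F} (hf : IsSmoothMap f)
    (v : E) : ∃ f' : E → F, IsSmoothMap f' ∧
      ∀ x, HasCurveDerivAt (fun t : ℝ => f (x + t • v)) (f' x) 0 := by
  refine ⟨fun x => curveDeriv (fun t : ℝ => f (x + t • v)) 0, fun c hc => ?_,
    fun x => (hf.line x v).hasCurveDerivAt 0⟩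
  -- Testing smoothness of the derivative along one curve `c` only involves this map on the plane:
  -- the derivative at `c s` is the first derivative of `g` at `(s, 0)` in direction `(0, 1)`.
  set g : ℝ × ℝ → F := fun z => f (c z.1 + z.2 • v) with hg
  have hgs : IsSmoothMap g := by
    intro γ hγ
    have h1 := isSmoothCurve_real_iff.1 (hγ.map (ContinuousLinearMap.fst ℝ ℝ ℝ))
    have h2 := isSmoothCurve_real_iff.1 (hγ.map (ContinuousLinearMap.snd ℝ ℝ ℝ))
    exact hf _ ((hc.comp h1).add ((IsSmoothCurve.const v).smul_comp h2 h1))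
  have := isSmoothCurve_dirDeriv hgs (0, 1) (1, 0) 0 1
  convert this using 1
  funext s
  simp [dirDeriv, hg]

/-! ### Iterated differentials of smooth maps -/

section IterDifferential

variable {E E' F G : Type*}
  [AddCommGroup E] [Module ℝ E]
  [AddCommGroup E'] [Module ℝ E']
  [AddCommGroup G] [Module ℝ G] [TopologicalSpace G]

/-- An iterated differential only sees the function on the affine span of its arguments. Distinct
domains are allowed in order to compare maps on operators over different open sets. -/
theorem iterDifferential_congr {f : E → G} {g : E' → G} : ∀ {l : ℕ} {x : E} {x' : E'}
    {v : Fin l → E} {v' : Fin l → E'},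
    (∀ t : Fin l → ℝ, f (x + ∑ i, t i • v i) = g (x' + ∑ i, t i • v' i)) →
    iterDifferential f l x v = iterDifferential g l x' v'
  | 0, x, x', v, v', h => by simpa [iterDifferential] using h 0
  | l + 1, x, x', v, v', h => by
    unfold iterDifferential
    congr 1
    funext s
    refine iterDifferential_congr fun t => ?_
    have := h (Fin.cons s t)
    simpa [Fin.sum_univ_succ, Fin.tail, add_assoc] using this

variable [TopologicalSpace E] [IsTopologicalAddGroup E] [ContinuousSMul ℝ E]
  [AddCommGroup F] [Module ℝ F] [TopologicalSpace F] [IsTopologicalAddGroup F]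
  [ContinuousSMul ℝ F] [T2Space F] [LocallyConvexSpace ℝ F] {f g : E → F}

theorem IsSmoothMap.iterDifferential (hf : IsSmoothMap f) : ∀ (l : ℕ) (v : Fin l → E),
    IsSmoothMap (fun x => iterDifferential f l x v)
  | 0, _ => hf
  | l + 1, v => by
    obtain ⟨f', hf', h⟩ := (IsSmoothMap.iterDifferential hf l (Fin.tail v)).exists_directional (v 0)
    convert hf' using 1
    funext x
    exact (h x).curveDeriv_eq

theorem IsSmoothMap.hasCurveDerivAt_iterDifferential (hf : IsSmoothMap f) (l : ℕ) (x : E)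
    (v : Fin (l + 1) → E) : HasCurveDerivAt
      (fun t : ℝ => NonlinearExt.iterDifferential f l (x + t • v 0) (Fin.tail v))
      (NonlinearExt.iterDifferential f (l + 1) x v) 0 :=
  ((hf.iterDifferential l (Fin.tail v)).line x (v 0)).hasCurveDerivAt 0

theorem iterDifferential_add (hf : IsSmoothMap f) (hg : IsSmoothMap g) :
    ∀ (l : ℕ) (x : E) (v : Fin l → E),
      iterDifferential (f + g) l x v = iterDifferential f l x v + iterDifferential g l x v
  | 0, _, _ => rfl
  | l + 1, x, v => by
    have h := (hf.hasCurveDerivAt_iterDifferential l x v).add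
      (hg.hasCurveDerivAt_iterDifferential l x v)
    rw [← h.curveDeriv_eq, iterDifferential]
    congr 1
    funext t
    exact iterDifferential_add hf hg l _ _

omit [TopologicalSpace E] [IsTopologicalAddGroup E] [ContinuousSMul ℝ E]
  [IsTopologicalAddGroup F] [ContinuousSMul ℝ F] [LocallyConvexSpace ℝ F] in
theorem iterDifferential_zero : ∀ (l : ℕ) (x : E) (v : Fin l → E),
      iterDifferential (0 : E → F) l x v = 0
  | 0, _, _ => rfl
  | l + 1, x, v => by
    rw [← (HasCurveDerivAt.const (0 : F) 0).curveDeriv_eq, iterDifferential]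
    congr 1
    funext t
    exact iterDifferential_zero l _ _

omit [IsTopologicalAddGroup E] [ContinuousSMul ℝ E] [ContinuousSMul ℝ F]
  [T2Space F] [LocallyConvexSpace ℝ F] in
theorem IsSmoothMap.sum {ι : Type*} (s : Finset ι) {f : ι → E → F}
    (hf : ∀ i ∈ s, IsSmoothMap (f i)) : IsSmoothMap (∑ i ∈ s, f i) :=
  Finset.sum_induction f IsSmoothMap (fun _ _ => IsSmoothMap.add) IsSmoothMap.zero hf

theorem iterDifferential_sum {ι : Type*} (s : Finset ι) {f : ι → E → F}
    (hf : ∀ i ∈ s, IsSmoothMap (f i)) (l : ℕ) (x : E) (v : Fin l → E) :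
    iterDifferential (∑ i ∈ s, f i) l x v = ∑ i ∈ s, iterDifferential (f i) l x v := by
  classical
  induction s using Finset.induction_on with
  | empty => simpa using iterDifferential_zero l x v
  | insert i s hi ih =>
    have hs : ∀ j ∈ s, IsSmoothMap (f j) := fun j hj => hf j (Finset.mem_insert_of_mem hj)
    rw [Finset.sum_insert hi, Finset.sum_insert hi,
      iterDifferential_add (hf i (Finset.mem_insert_self i s)) (IsSmoothMap.sum s hs), ih hs]

theorem iterDifferential_map [T2Space G] (hf : IsSmoothMap f) (L : F →L[ℝ] G) :
    ∀ (l : ℕ) (x : E) (v : Fin l → E),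
      iterDifferential (fun x => L (f x)) l x v = L (iterDifferential f l x v)
  | 0, _, _ => rfl
  | l + 1, x, v => by
    have h := (hf.hasCurveDerivAt_iterDifferential l x v).map L
    rw [← h.curveDeriv_eq, iterDifferential]
    congr 1
    funext t
    exact iterDifferential_map hf L l _ _

omit [IsTopologicalAddGroup E] [ContinuousSMul ℝ E] [IsTopologicalAddGroup F] [ContinuousSMul ℝ F]
  [T2Space F] [LocallyConvexSpace ℝ F] in
theorem IsSmoothMap.map (hf : IsSmoothMap f) (L : F →L[ℝ] G) :
    IsSmoothMap (fun x => L (f x)) :=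
  fun c hc => (hf c hc).map L

omit [IsTopologicalAddGroup E] [ContinuousSMul ℝ E] [IsTopologicalAddGroup F] [ContinuousSMul ℝ F]
  [T2Space F] [LocallyConvexSpace ℝ F] in
theorem IsSmoothMap.comp_clm [TopologicalSpace E'] (hf : IsSmoothMap f) (L : E' →L[ℝ] E) :
    IsSmoothMap (fun x => f (L x)) :=
  fun c hc => hf (fun s => L (c s)) (hc.map L)

end IterDifferential

instance continuousSMul_real {E : Type*} [AddCommGroup E] [Module ℂ E] [TopologicalSpace E]
    [ContinuousSMul ℂ E] : ContinuousSMul ℝ E :=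
  ⟨(Complex.continuous_ofReal.comp continuous_fst).smul continuous_snd⟩

theorem iterDifferential_smul {E F : Type*} [AddCommGroup E] [Module ℝ E] [TopologicalSpace E]
    [IsTopologicalAddGroup E] [ContinuousSMul ℝ E]
    [AddCommGroup F] [Module ℂ F] [TopologicalSpace F] [IsTopologicalAddGroup F]
    [ContinuousSMul ℂ F] [T2Space F] [LocallyConvexSpace ℝ F] {f : E → F} (hf : IsSmoothMap f)
    (a : ℂ) : ∀ (l : ℕ) (x : E) (v : Fin l → E),
      iterDifferential (a • f) l x v = a • iterDifferential f l x v
  | 0, _, _ => rfl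
  | l + 1, x, v => by
    have h := (hf.hasCurveDerivAt_iterDifferential l x v).smul a
    rw [← h.curveDeriv_eq, iterDifferential]
    congr 1
    funext t
    exact iterDifferential_smul hf a l _ _

/-! ### Classes of bounds -/

/-- A class of nets of real numbers that is stable under sums and domination. -/
structure IsBoundClass (P : (Eps → ℝ) → Prop) : Prop where
  zero : P 0
  add : ∀ f g, P f → P g → P (fun ε => ‖f ε‖ + ‖g ε‖)
  mono : ∀ f g, P g → f =O[epsZero] g → P f

/-- The nets bounded by a member of the growth scale. -/
def growthBound (A : Set (Eps → ℝ≥0)) (f : Eps → ℝ) : Prop :=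
  ∃ a ∈ A, f =O[epsZero] (fun ε => (a ε : ℝ))

/-- The nets bounded by all members of the decay scale. -/
def decayBound (D : Set (Eps → ℝ≥0)) (f : Eps → ℝ) : Prop :=
  ∀ a ∈ D, f =O[epsZero] (fun ε => (a ε : ℝ))

theorem IsGrowthScale.isBoundClass {A : Set (Eps → ℝ≥0)} (hA : IsGrowthScale A) :
    IsBoundClass (growthBound A) where
  zero := by
    obtain ⟨a, ha, -⟩ := hA.liminf_pos
    exact ⟨a, ha, isBigO_zero _ _⟩
  add := by
    rintro f g ⟨a, ha, hfa⟩ ⟨b, hb, hgb⟩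
    obtain ⟨n, hn, hO⟩ := hA.add a ha b hb
    refine ⟨n, hn, IsBigO.trans (IsBigO.add ?_ ?_) hO⟩
    · refine hfa.norm_left.trans (IsBigO.of_bound 1 (Eventually.of_forall fun ε => ?_))
      rw [one_mul, Real.norm_of_nonneg (a ε).coe_nonneg, Real.norm_of_nonneg (NNReal.coe_nonneg _)]
      exact_mod_cast le_self_add
    · refine hgb.norm_left.trans (IsBigO.of_bound 1 (Eventually.of_forall fun ε => ?_))
      rw [one_mul, Real.norm_of_nonneg (b ε).coe_nonneg, Real.norm_of_nonneg (NNReal.coe_nonneg _)]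
      exact_mod_cast le_add_self
  mono := fun f g ⟨a, ha, hga⟩ hfg => ⟨a, ha, hfg.trans hga⟩

theorem isBoundClass_decayBound (D : Set (Eps → ℝ≥0)) : IsBoundClass (decayBound D) where
  zero := fun _ _ => isBigO_zero _ _
  add := fun _ _ hf hg a ha => (hf a ha).norm_left.add (hg a ha).norm_left
  mono := fun _ _ hg hfg a ha => hfg.trans (hg a ha)

theorem IsAdmissible.growthBound_of_decayBound {A D : Set (Eps → ℝ≥0)} (h : IsAdmissible A D)
    {f : Eps → ℝ} (hf : decayBound D f) : growthBound A f := by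
  obtain ⟨l, hl, m, hm, hO⟩ := h.compare
  exact ⟨l, hl, (hf m hm).trans hO⟩

theorem IsBoundClass.sum {P : (Eps → ℝ) → Prop} (hP : IsBoundClass P) {ι : Type*} (s : Finset ι)
    {f : ι → Eps → ℝ} (hf : ∀ i ∈ s, P (f i)) : P (fun ε => ∑ i ∈ s, ‖f i ε‖) := by
  classical
  induction s using Finset.induction_on with
  | empty => simp only [Finset.sum_empty]; exact hP.zero
  | insert i s hi ih =>
    refine hP.mono _ _ (hP.add _ _ (hf i (Finset.mem_insert_self i s))
      (ih fun j hj => hf j (Finset.mem_insert_of_mem hj))) (IsBigO.of_bound 1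
        (Eventually.of_forall fun ε => ?_))
    rw [Finset.sum_insert hi, one_mul,
      Real.norm_of_nonneg (Finset.sum_nonneg fun j _ => norm_nonneg (f j ε))]

section Nets

variable {F G : Type*}
  [AddCommGroup F] [Module ℂ F] [TopologicalSpace F]
  [AddCommGroup G] [Module ℂ G] [TopologicalSpace G]
  {P : (Eps → ℝ) → Prop}

/-- All continuous seminorms of the net `x` are bounded in the sense of `P`. -/
def NetBound (P : (Eps → ℝ) → Prop) (x : Eps → F) : Prop :=
  ∀ p : Seminorm ℂ F, Continuous p → P (fun ε => p (x ε))

theorem NetBound.mono {Q : (Eps → ℝ) → Prop} (h : ∀ f, P f → Q f) {x : Eps → F}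
    (hx : NetBound P x) : NetBound Q x :=
  fun p hp => h _ (hx p hp)

theorem NetBound.map {x : Eps → F} (hx : NetBound P x) (L : F →L[ℂ] G) :
    NetBound P (fun ε => L (x ε)) :=
  fun p hp => hx (p.comp (L : F →ₗ[ℂ] G)) (hp.comp L.continuous)

theorem NetBound.congr (hP : IsBoundClass P) {x y : Eps → F} (hx : NetBound P x)
    (h : x =ᶠ[epsZero] y) : NetBound P y := fun p hp =>
  hP.mono _ _ (hx p hp) (EventuallyEq.isBigO (h.mono fun ε hε => by simp only [hε]))

theorem NetBound.zero (hP : IsBoundClass P) : NetBound P (fun _ => (0 : F)) := fun p _ => by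
  simp only [map_zero]; exact hP.zero

theorem NetBound.add (hP : IsBoundClass P) {x y : Eps → F} (hx : NetBound P x)
    (hy : NetBound P y) : NetBound P (fun ε => x ε + y ε) := fun p hp =>
  hP.mono _ _ (hP.add _ _ (hx p hp) (hy p hp)) (IsBigO.of_bound 1 (Eventually.of_forall fun ε => by
    rw [one_mul, Real.norm_of_nonneg (apply_nonneg p _), Real.norm_of_nonneg (apply_nonneg p _),
      Real.norm_of_nonneg (apply_nonneg p _),
      Real.norm_of_nonneg (add_nonneg (apply_nonneg p _) (apply_nonneg p _))]
    exact map_add_le_add p _ _))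

theorem NetBound.smul (hP : IsBoundClass P) {x : Eps → F} (hx : NetBound P x) (a : ℂ) :
    NetBound P (fun ε => a • x ε) := fun p hp =>
  hP.mono _ _ (hx p hp) (IsBigO.of_bound ‖a‖ (Eventually.of_forall fun ε => by
    rw [map_smul_eq_mul, norm_mul, norm_norm]))

theorem NetBound.neg (hP : IsBoundClass P) {x : Eps → F} (hx : NetBound P x) :
    NetBound P (fun ε => -x ε) := by
  simpa using hx.smul hP (-1)

theorem NetBound.sub (hP : IsBoundClass P) {x y : Eps → F} (hx : NetBound P x)
    (hy : NetBound P y) : NetBound P (fun ε => x ε - y ε) := by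
  simpa [sub_eq_add_neg] using hx.add hP (hy.neg hP)

theorem NetBound.sum (hP : IsBoundClass P) {ι : Type*} (s : Finset ι) {x : ι → Eps → F}
    (hx : ∀ i ∈ s, NetBound P (x i)) : NetBound P (fun ε => ∑ i ∈ s, x i ε) := fun p hp =>
  hP.mono _ _ (hP.sum s fun i hi => hx i hi p hp) (IsBigO.of_bound 1 (Eventually.of_forall
    fun ε => by
      rw [one_mul, Real.norm_of_nonneg (apply_nonneg p _),
        Real.norm_of_nonneg (Finset.sum_nonneg fun _ _ => norm_nonneg _)]
      refine (seminorm_sum_le p s _).trans (Finset.sum_le_sum fun i _ => le_abs_self _)))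

open scoped ComplexOrder in
-- In the order on `ℂ` the nonnegative scalars are the nonnegative reals, so real convexity is
-- complex convexity, and complex seminorms generate the topology.
theorem polynormableSpace_complex [IsTopologicalAddGroup F] [ContinuousSMul ℂ F]
    [LocallyConvexSpace ℝ F] : PolynormableSpace ℂ F := by
  have : LocallyConvexSpace ℂ F := ⟨fun x => by
    refine (LocallyConvexSpace.convex_basis (𝕜 := ℝ) x).to_hasBasis (fun s hs => ⟨s, ⟨hs.1, ?_⟩,
      le_rfl⟩) fun s hs => ⟨s, ⟨hs.1, hs.2.lift ℝ⟩, le_rfl⟩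
    exact convex_of_nonneg_surjective_algebraMap _
      (fun z hz => by
        obtain ⟨r, hr, h⟩ := (RCLike.nonneg_iff_exists_ofReal (K := ℂ)).1 hz
        exact ⟨r, hr, h⟩) hs.2⟩
  infer_instance

/-- Bounds may be verified after applying a family of maps that induces the topology. -/
theorem NetBound.of_family (hP : IsBoundClass P) {ι : Type*} {H : Type*} [AddCommGroup H]
    [Module ℂ H] [tH : TopologicalSpace H]
    {G : ι → Type*} [∀ i, AddCommGroup (G i)]
    [∀ i, Module ℂ (G i)] [tG : ∀ i, TopologicalSpace (G i)] [∀ i, IsTopologicalAddGroup (G i)]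
    [∀ i, ContinuousSMul ℂ (G i)] [∀ i, LocallyConvexSpace ℝ (G i)]
    (L : ∀ i, H →ₗ[ℂ] G i) (htop : tH = ⨅ i, (tG i).induced (L i)) {x : Eps → H}
    (hx : ∀ i, NetBound P (fun ε => L i (x ε))) : NetBound P x := by
  intro p hp
  have hpoly : ∀ i, PolynormableSpace ℂ (G i) := fun i => polynormableSpace_complex
  have hw := withSeminorms_iInf (t := fun i => (tG i).induced (L i))
    (p := fun i => SeminormFamily.comp (fun p : {p : Seminorm ℂ (G i) // Continuous p} => p.1) (L i))
    fun i => (L i).withSeminorms_induced (PolynormableSpace.withSeminorms ℂ (G i))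
  rw [← htop] at hw
  -- In a projective topology `p` is dominated by finitely many seminorms pulled back along the maps
  -- `L i`.
  obtain ⟨s, C, -, hC⟩ := Seminorm.bound_of_continuous hw p hp
  refine hP.mono _ _ (hP.sum s (f := fun k ε => k.2.1 (L k.1 (x ε))) fun k _ => hx k.1 k.2.1 k.2.2)
    (IsBigO.of_bound C (Eventually.of_forall fun ε => ?_))
  rw [Real.norm_of_nonneg (apply_nonneg p _),
    Real.norm_of_nonneg (Finset.sum_nonneg fun _ _ => norm_nonneg _)]
  refine (hC (x ε)).trans ?_
  rw [smul_apply, NNReal.smul_def, smul_eq_mul]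
  refine mul_le_mul_of_nonneg_left ?_ C.coe_nonneg
  refine Seminorm.finset_sup_apply_le (Finset.sum_nonneg fun _ _ => norm_nonneg _) fun k hk => ?_
  exact (le_abs_self _).trans (Finset.single_le_sum (f := fun k : Σ i, {p : Seminorm ℂ (G i) //
    Continuous p} => ‖k.2.1 (L k.1 (x ε))‖) (fun _ _ => norm_nonneg _) hk)

end Nets

/-! ### Pointwise description of test objects -/

section PointwiseTest

variable {E : Type v} {F : Type w}
  [AddCommGroup E] [Module ℂ E] [TopologicalSpace E] [IsTopologicalAddGroup E]
  [ContinuousSMul ℂ E]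
  [AddCommGroup F] [Module ℂ F] [TopologicalSpace F] [IsTopologicalAddGroup F]
  [ContinuousSMul ℂ F] [LocallyConvexSpace ℝ F]

omit [IsTopologicalAddGroup E] in
-- The topology of pointwise convergence is projective with respect to the evaluations, so
-- `NetBound.of_family` applies.
theorem netBound_pointwise_iff {P : (Eps → ℝ) → Prop} (hP : IsBoundClass P)
    (Φ : Eps → (E →L[ℂ] F)) :
    (∀ p : Seminorm ℂ (E →Lₚₜ[ℂ] F), Continuous p → P (fun ε =>
      p (ContinuousLinearMap.toPointwiseConvergenceCLM ℂ (RingHom.id ℂ) E F (Φ ε)))) ↔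
    ∀ x : E, NetBound P (fun ε => Φ ε x) := by
  constructor
  · intro h x
    have h1 : NetBound P (fun ε =>
        ContinuousLinearMap.toPointwiseConvergenceCLM ℂ (RingHom.id ℂ) E F (Φ ε)) := h
    exact h1.map (PointwiseConvergenceCLM.evalCLM (RingHom.id ℂ) F x)
  · intro h
    refine NetBound.of_family hP (fun x : E =>
      (PointwiseConvergenceCLM.evalCLM (RingHom.id ℂ) F x : (E →Lₚₜ[ℂ] F) →ₗ[ℂ] F)) ?_ h
    refine (PointwiseConvergenceCLM.isEmbedding_coeFn (RingHom.id ℂ) E F).isInducing.eq_induced.trans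
      ?_
    rw [Pi.topologicalSpace, induced_iInf]
    simp only [induced_compose]
    rfl

theorem isTestObject_iff {A D : Set (Eps → ℝ≥0)} (hA : IsBoundClass (growthBound A))
    (j : F →L[ℂ] E) (Φ : Eps → (E →L[ℂ] F)) :
    IsTestObject j A D Φ ↔ (∀ x, NetBound (growthBound A) (fun ε => Φ ε x)) ∧
      (∀ s, NetBound (decayBound D) (fun ε => Φ ε (j s) - s)) ∧
      ∀ x, Tendsto (fun ε => j (Φ ε x)) epsZero (𝓝 x) := by
  have h1 := netBound_pointwise_iff hA Φ
  have h2 := netBound_pointwise_iff (isBoundClass_decayBound D)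
    (fun ε => (Φ ε).comp j - ContinuousLinearMap.id ℂ F)
  have h3 := PointwiseConvergenceCLM.tendsto_iff_forall_tendsto (p := epsZero)
    (a := fun ε => ContinuousLinearMap.toPointwiseConvergenceCLM ℂ (RingHom.id ℂ) E E
      (j.comp (Φ ε))) (a₀ := ContinuousLinearMap.toPointwiseConvergenceCLM ℂ (RingHom.id ℂ) E E
      (ContinuousLinearMap.id ℂ E))
  exact ⟨fun h => ⟨h1.1 h.moderate, h2.1 h.approx, h3.1 h.tendsto_id⟩,
    fun h => ⟨h1.2 h.1, h2.2 h.2.1, h3.2 h.2.2⟩⟩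

theorem isZeroTestObject_iff {A D : Set (Eps → ℝ≥0)} (hA : IsBoundClass (growthBound A))
    (j : F →L[ℂ] E) (Φ : Eps → (E →L[ℂ] F)) :
    IsZeroTestObject j A D Φ ↔ (∀ x, NetBound (growthBound A) (fun ε => Φ ε x)) ∧
      (∀ s, NetBound (decayBound D) (fun ε => Φ ε (j s))) ∧
      ∀ x, Tendsto (fun ε => j (Φ ε x)) epsZero (𝓝 0) := by
  have h1 := netBound_pointwise_iff hA Φ
  have h2 := netBound_pointwise_iff (isBoundClass_decayBound D) (fun ε => (Φ ε).comp j)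
  have h3 := PointwiseConvergenceCLM.tendsto_iff_forall_tendsto (p := epsZero)
    (a := fun ε => ContinuousLinearMap.toPointwiseConvergenceCLM ℂ (RingHom.id ℂ) E E
      (j.comp (Φ ε))) (a₀ := 0)
  exact ⟨fun h => ⟨h1.1 h.moderate, h2.1 h.approx, h3.1 h.tendsto_zero⟩,
    fun h => ⟨h1.2 h.1, h2.2 h.2.1, h3.2 h.2.2⟩⟩

end PointwiseTest

theorem exists_forall_lt_iff_eventually {Q : Eps → Prop} :
    (∃ ε₀ : Eps, ∀ ε < ε₀, Q ε) ↔ ∀ᶠ ε in epsZero, Q ε := by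
  unfold epsZero
  rw [eventually_comap]
  constructor
  · rintro ⟨ε₀, h⟩
    filter_upwards [Ioo_mem_nhdsGT ε₀.2.1] with b hb a hab
    exact h a (by rw [← Subtype.coe_lt_coe, hab]; exact hb.2)
  · intro h
    obtain ⟨b, hb, hb'⟩ := (mem_nhdsGT_iff_exists_Ioo_subset' (zero_lt_one' ℝ)).1 h
    refine ⟨⟨min b 1, lt_min hb one_pos, min_le_right _ _⟩, fun ε hε => ?_⟩
    exact hb' ⟨ε.2.1, (Subtype.coe_lt_coe.2 hε).trans_le (min_le_left _ _)⟩ ε rfl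

/-! ### Locally convex sheaves -/

section LCSheafLemmas

variable {X : Type u} [TopologicalSpace X] (S : LCSheaf.{u, v} X)

namespace LCSheaf

theorem res_self_apply {U : Opens X} (s : S.Sec U) : S.res U U le_rfl s = s :=
  S.isSheaf.res_self U s

theorem res_res_apply {U V W : Opens X} (hVU : V ≤ U) (hWV : W ≤ V) (s : S.Sec U) :
    S.res V W hWV (S.res U V hVU s) = S.res U W (hWV.trans hVU) s :=
  S.isSheaf.res_res U V W hVU hWV s

theorem res_eq_zero_mono {U V W : Opens X} {s : S.Sec U} (hVU : V ≤ U) (hWV : W ≤ V)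
    (h : S.res U V hVU s = 0) : S.res U W (hWV.trans hVU) s = 0 := by
  rw [← S.res_res_apply hVU hWV, h, map_zero]

theorem eq_zero_of_locally {U : Opens X} (s : S.Sec U)
    (h : ∀ x ∈ U, ∃ (V : Opens X) (hV : V ≤ U), x ∈ V ∧ S.res U V hV s = 0) : s = 0 := by
  refine S.isSheaf.separated U {V : Opens X // ∃ hV : V ≤ U, S.res U V hV s = 0} (fun V => V.1)
    (fun V => V.2.1) ?_ s fun V => V.2.2
  intro x hx
  obtain ⟨V, hV, hxV, hs⟩ := h x hx
  exact Opens.mem_iSup.2 ⟨⟨V, hV, hs⟩, hxV⟩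

theorem ext_of_locally {U : Opens X} {s t : S.Sec U}
    (h : ∀ x ∈ U, ∃ (V : Opens X) (hV : V ≤ U), x ∈ V ∧ S.res U V hV s = S.res U V hV t) :
    s = t := by
  refine sub_eq_zero.1 (S.eq_zero_of_locally _ fun x hx => ?_)
  obtain ⟨V, hV, hxV, hst⟩ := h x hx
  exact ⟨V, hV, hxV, by rw [map_sub, hst, sub_self]⟩

/-- Continuous linear maps into sections can be glued. -/
theorem exists_glue_clm {H : Type*} [AddCommGroup H] [Module ℂ H] [TopologicalSpace H]
    {U : Opens X} {ι : Type u} {c : ι → Opens X} (hc : ∀ i, c i ≤ U) (hU : U ≤ ⨆ i, c i)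
    (L : ∀ i, H →L[ℂ] S.Sec (c i))
    (hL : ∀ i j h, S.res (c i) (c i ⊓ c j) inf_le_left (L i h)
      = S.res (c j) (c i ⊓ c j) inf_le_right (L j h)) :
    ∃ M : H →L[ℂ] S.Sec U, ∀ i h, S.res U (c i) (hc i) (M h) = L i h := by
  choose M hM using fun h : H => S.isSheaf.glue U ι c hc hU (fun i => L i h) fun i j => hL i j h
  have hM' : ∀ h i, S.res U (c i) (hc i) (M h) = L i h := hM
  have hext : ∀ s t : S.Sec U, (∀ i, S.res U (c i) (hc i) s = S.res U (c i) (hc i) t) → s = t := by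
    intro s t hst
    refine sub_eq_zero.1 (S.isSheaf.separated U ι c hc hU _ fun i => ?_)
    change S.res U (c i) (hc i) (s - t) = 0
    rw [map_sub, hst, sub_self]
  refine ⟨⟨⟨⟨M, fun a b => hext _ _ fun i => ?_⟩, fun a b => hext _ _ fun i => ?_⟩, ?_⟩,
    fun i h => hM' h i⟩
  · rw [map_add, hM', hM', hM', map_add]
  · change S.res U (c i) (hc i) (M (a • b)) = S.res U (c i) (hc i) (a • M b)
    rw [map_smul, hM', hM', map_smul]
  · change Continuous M
    rw [S.projective U ι c hc hU, continuous_iInf_rng]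
    intro i
    rw [continuous_induced_rng]
    exact (L i).continuous.congr fun h => (hM' h i).symm

/-- Sections over the two members of a covering can be glued. -/
theorem exists_glue_clm_two {H : Type*} [AddCommGroup H] [Module ℂ H] [TopologicalSpace H]
    {U V W : Opens X} (hV : V ≤ U) (hW : W ≤ U) (hU : U ≤ V ⊔ W)
    (L : H →L[ℂ] S.Sec V) (L' : H →L[ℂ] S.Sec W)
    (hL : ∀ h, S.res V (V ⊓ W) inf_le_left (L h) = S.res W (V ⊓ W) inf_le_right (L' h)) :
    ∃ M : H →L[ℂ] S.Sec U, (∀ h, S.res U V hV (M h) = L h) ∧ ∀ h, S.res U W hW (M h) = L' h := by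
  have hswap : ∀ h, S.res W (W ⊓ V) inf_le_left (L' h) = S.res V (W ⊓ V) inf_le_right (L h) := by
    intro h
    have := congrArg (S.res (V ⊓ W) (W ⊓ V) (inf_comm W V).le) (hL h)
    rw [S.res_res_apply, S.res_res_apply] at this
    exact this.symm
  obtain ⟨M, hM⟩ := S.exists_glue_clm (U := U) (ι := ULift.{u} Bool)
    (c := fun b => match b with | ⟨true⟩ => V | ⟨false⟩ => W)
    (by rintro ⟨_ | _⟩ <;> assumption)
    (by
      refine hU.trans (sup_le ?_ ?_)
      · exact le_iSup (fun b : ULift.{u} Bool => match b with | ⟨true⟩ => V | ⟨false⟩ => W) ⟨true⟩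
      · exact le_iSup (fun b : ULift.{u} Bool => match b with | ⟨true⟩ => V | ⟨false⟩ => W) ⟨false⟩)
    (fun b => match b with | ⟨true⟩ => L | ⟨false⟩ => L')
    (by
      rintro ⟨_ | _⟩ ⟨_ | _⟩ h
      · rfl
      · exact hswap h
      · exact hL h
      · rfl)
  exact ⟨M, hM ⟨true⟩, hM ⟨false⟩⟩

theorem netBound_of_cover {P : (Eps → ℝ) → Prop} (hP : IsBoundClass P) {U : Opens X} {ι : Type u}
    {c : ι → Opens X} (hc : ∀ i, c i ≤ U) (hU : U ≤ ⨆ i, c i) {s : Eps → S.Sec U}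
    (h : ∀ i, NetBound P (fun ε => S.res U (c i) (hc i) (s ε))) : NetBound P s :=
  NetBound.of_family hP (fun i => (S.res U (c i) (hc i) : S.Sec U →ₗ[ℂ] S.Sec (c i)))
    (S.projective U ι c hc hU) h

theorem tendsto_of_cover {α : Type*} {l : Filter α} {U : Opens X} {ι : Type u}
    {c : ι → Opens X} (hc : ∀ i, c i ≤ U) (hU : U ≤ ⨆ i, c i) {s : α → S.Sec U} {t : S.Sec U}
    (h : ∀ i, Tendsto (fun a => S.res U (c i) (hc i) (s a)) l (𝓝 (S.res U (c i) (hc i) t))) :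
    Tendsto s l (𝓝 t) := by
  have h1 : 𝓝 t = ⨅ i, comap (S.res U (c i) (hc i)) (𝓝 (S.res U (c i) (hc i) t)) := by
    refine (congrArg (fun τ => @nhds _ τ t) (S.projective U ι c hc hU)).trans ?_
    simp only [nhds_iInf, nhds_induced]
  rw [h1, tendsto_iInf]
  exact fun i => tendsto_comap_iff.2 (h i)

theorem netBound_of_locally {P : (Eps → ℝ) → Prop} (hP : IsBoundClass P) {U : Opens X}
    {s : Eps → S.Sec U}
    (h : ∀ x ∈ U, ∃ (V : Opens X) (hV : V ≤ U), x ∈ V ∧ NetBound P (fun ε => S.res U V hV (s ε))) :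
    NetBound P s := by
  refine S.netBound_of_cover hP (ι := {V : Opens X // ∃ hV : V ≤ U,
    NetBound P (fun ε => S.res U V hV (s ε))}) (c := Subtype.val) (fun V => V.2.1) ?_
    fun V => V.2.2
  intro x hx
  obtain ⟨V, hV, hxV, hs⟩ := h x hx
  exact Opens.mem_iSup.2 ⟨⟨V, hV, hs⟩, hxV⟩

/-- A map into sections is smooth if it is locally so. -/
theorem isSmoothMap_of_locally {H : Type*} [AddCommGroup H] [Module ℝ H] [TopologicalSpace H]
    {U : Opens X} {f : H → S.Sec U} {ι : Type u} {c : ι → Opens X} (hc : ∀ i, c i ≤ U)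
    (hU : U ≤ ⨆ i, c i) (h : ∀ i, IsSmoothMap (fun y => S.res U (c i) (hc i) (f y))) :
    IsSmoothMap f := by
  intro γ hγ
  choose d hd0 hd using fun i => h i γ hγ
  have hmap : ∀ (V W : Opens X) (hWV : W ≤ V) (a : ℝ → S.Sec V) (b : S.Sec V) (t : ℝ),
      HasCurveDerivAt a b t → HasCurveDerivAt (fun s => S.res V W hWV (a s)) (S.res V W hWV b) t :=
    fun V W hWV a b t h => h.map ((S.res V W hWV).restrictScalars ℝ)
  -- Local derivatives of every order agree on overlaps by uniqueness of limits, so they glue to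
  -- candidates for the global derivatives.
  have hcompat : ∀ n t i j, S.res (c i) (c i ⊓ c j) inf_le_left (d i n t)
      = S.res (c j) (c i ⊓ c j) inf_le_right (d j n t) := by
    intro n
    induction n with
    | zero =>
      intro t i j
      rw [hd0, hd0]
      simp only [Function.comp]
      rw [S.res_res_apply, S.res_res_apply]
    | succ n ih =>
      intro t i j
      have h1 := hmap _ _ (inf_le_left : c i ⊓ c j ≤ c i) _ _ t (hd i n t)
      have h2 := hmap _ _ (inf_le_right : c i ⊓ c j ≤ c j) _ _ t (hd j n t)
      rw [funext fun s => ih s i j] at h1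
      exact h1.unique h2
  choose e he using fun n t => S.isSheaf.glue U ι c hc hU (fun i => d i n t) (hcompat n t)
  have he' : ∀ n t i, S.res U (c i) (hc i) (e n t) = d i n t := he
  have hext : ∀ s t : S.Sec U, (∀ i, S.res U (c i) (hc i) s = S.res U (c i) (hc i) t) → s = t := by
    intro s t hst
    refine sub_eq_zero.1 (S.isSheaf.separated U ι c hc hU _ fun i => ?_)
    change S.res U (c i) (hc i) (s - t) = 0
    rw [map_sub, hst, sub_self]
  refine ⟨e, funext fun t => hext _ _ fun i => ?_, fun n t => ?_⟩
  · rw [he', hd0]; rfl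
  · refine S.tendsto_of_cover hc hU fun i => ?_
    rw [he']
    refine Tendsto.congr (fun s => ?_) (hd i n t)
    simp only [slope, vsub_eq_sub, ← he', ← map_sub]
    exact (((S.res U (c i) (hc i)).restrictScalars ℝ).map_smul _ _).symm

end LCSheaf

/-! ### Sheaf endomorphisms and extension by zero -/

namespace SheafEnd

variable {S} {U : Opens X} (θ : SheafEnd S U)

/-- The largest open set on which an endomorphism vanishes. -/
def zeroSet : Opens X := sSup {V | V ≤ U ∧ θ.VanishesOn V}

theorem mem_zeroSet_iff {x : X} : x ∈ θ.zeroSet ↔ x ∈ U ∧ x ∉ θ.supp := by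
  constructor
  · intro hx
    obtain ⟨V, ⟨hVU, hV⟩, hxV⟩ := Opens.mem_sSup.1 hx
    exact ⟨hVU hxV, fun hs => hs.2 V hVU hV hxV⟩
  · rintro ⟨hxU, hx⟩
    have : ¬ ∀ V : Opens X, V ≤ U → θ.VanishesOn V → x ∉ V := fun h => hx ⟨hxU, h⟩
    push Not at this
    obtain ⟨V, hVU, hV, hxV⟩ := this
    exact Opens.mem_sSup.2 ⟨V, ⟨hVU, hV⟩, hxV⟩

theorem map_eq_zero_of_le {W : Opens X} (hWU : W ≤ U) (hW : W ≤ θ.zeroSet) (s : S.Sec W) :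
    θ.map W hWU s = 0 := by
  refine S.eq_zero_of_locally _ fun x hx => ?_
  obtain ⟨V, ⟨hVU, hV⟩, hxV⟩ := Opens.mem_sSup.1 (hW hx)
  refine ⟨W ⊓ V, inf_le_left, ⟨hx, hxV⟩, ?_⟩
  rw [θ.comm, hV (W ⊓ V) (inf_le_left.trans hWU) inf_le_right]
  rfl

/-- The section `θ s` on `O ⊓ Q` is glued with `0` on `O ⊓ θ.zeroSet`; they match because `θ`
vanishes on the overlap. -/
theorem exists_extension {O Q : Opens X} (hO : O ≤ U) (h : O ≤ Q ⊔ θ.zeroSet) :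
    ∃ M : S.Sec Q →L[ℂ] S.Sec O,
      (∀ s, S.res O (O ⊓ Q) inf_le_left (M s)
        = θ.map (O ⊓ Q) (inf_le_left.trans hO) (S.res Q (O ⊓ Q) inf_le_right s)) ∧
      ∀ s, S.res O (O ⊓ θ.zeroSet) inf_le_left (M s) = 0 := by
  refine S.exists_glue_clm_two (U := O) (V := O ⊓ Q) (W := O ⊓ θ.zeroSet) inf_le_left inf_le_left
    (by rw [← inf_sup_left]; exact le_inf le_rfl h)
    ((θ.map (O ⊓ Q) (inf_le_left.trans hO)).comp (S.res Q (O ⊓ Q) inf_le_right)) 0 fun s => ?_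
  rw [ContinuousLinearMap.comp_apply, θ.comm, zero_apply, map_zero]
  exact θ.map_eq_zero_of_le _ (inf_le_right.trans inf_le_right) _

/-- Apply an endomorphism with support (within `O`) in `Q` to a section over `Q` and extend the
result by zero to `O`. -/
noncomputable def extend {O Q : Opens X} (hO : O ≤ U) (_hQ : Q ≤ U) (h : O ≤ Q ⊔ θ.zeroSet) :
    S.Sec Q →L[ℂ] S.Sec O :=
  Classical.choose (θ.exists_extension hO h)

variable {θ} {O Q : Opens X} {hO : O ≤ U} {hQ : Q ≤ U} {h : O ≤ Q ⊔ θ.zeroSet}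

theorem res_extend (s : S.Sec Q) {W : Opens X} (hWO : W ≤ O) (hWQ : W ≤ Q) :
    S.res O W hWO (θ.extend hO hQ h s) = θ.map W (hWO.trans hO) (S.res Q W hWQ s) := by
  have h1 := (Classical.choose_spec (θ.exists_extension hO h)).1 s
  have h2 := congrArg (S.res (O ⊓ Q) W (le_inf hWO hWQ)) h1
  rwa [S.res_res_apply, θ.comm, S.res_res_apply] at h2

theorem res_extend_zero (s : S.Sec Q) {W : Opens X} (hWO : W ≤ O) (hW : W ≤ θ.zeroSet) :
    S.res O W hWO (θ.extend hO hQ h s) = 0 := by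
  have h1 := (Classical.choose_spec (θ.exists_extension hO h)).2 s
  have h2 := congrArg (S.res (O ⊓ θ.zeroSet) W (le_inf hWO hW)) h1
  rwa [S.res_res_apply, map_zero] at h2

theorem extend_unique {s : S.Sec Q} {t : S.Sec O}
    (h1 : S.res O (O ⊓ Q) inf_le_left t
      = θ.map (O ⊓ Q) (inf_le_left.trans hO) (S.res Q (O ⊓ Q) inf_le_right s))
    (h2 : S.res O (O ⊓ θ.zeroSet) inf_le_left t = 0) : t = θ.extend hO hQ h s := by
  refine S.ext_of_locally fun x hx => ?_
  rcases h hx with hxQ | hxZ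
  · exact ⟨O ⊓ Q, inf_le_left, ⟨hx, hxQ⟩, by rw [h1, res_extend _ inf_le_left inf_le_right]⟩
  · exact ⟨O ⊓ θ.zeroSet, inf_le_left, ⟨hx, hxZ⟩, by
      rw [h2, res_extend_zero _ inf_le_left inf_le_right]⟩

/-- Extension by zero is local. -/
theorem res_extend_eq_zero {s : S.Sec Q} {W Q' : Opens X} (hWO : W ≤ O) (hQ' : Q' ≤ Q)
    (hW : W ≤ Q' ⊔ θ.zeroSet) (hs : S.res Q Q' hQ' s = 0) :
    S.res O W hWO (θ.extend hO hQ h s) = 0 := by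
  refine S.eq_zero_of_locally _ fun x hx => ?_
  rcases hW hx with hxQ | hxZ
  · refine ⟨W ⊓ Q', inf_le_left, ⟨hx, hxQ⟩, ?_⟩
    rw [S.res_res_apply, res_extend s (inf_le_left.trans hWO) (inf_le_right.trans hQ'),
      S.res_eq_zero_mono hQ' inf_le_right hs, map_zero]
  · refine ⟨W ⊓ θ.zeroSet, inf_le_left, ⟨hx, hxZ⟩, ?_⟩
    rw [S.res_res_apply, res_extend_zero s _ inf_le_right]

/-- Restricting the source and the target of an extension by zero. -/
theorem res_extend_res {s : S.Sec Q} {W Q' : Opens X} (hWO : W ≤ O) (hQ' : Q' ≤ Q)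
    (hW : W ≤ Q' ⊔ θ.zeroSet) :
    S.res O W hWO (θ.extend hO hQ h s)
      = θ.extend (hWO.trans hO) (hQ'.trans hQ) hW (S.res Q Q' hQ' s) := by
  refine extend_unique ?_ ?_
  · rw [S.res_res_apply, res_extend s _ (inf_le_right.trans hQ'), S.res_res_apply]
  · rw [S.res_res_apply, res_extend_zero s _ inf_le_right]

/-- An endomorphism is the extension by zero of its restriction. -/
theorem map_eq_extend {t : S.Sec O} {V : Opens X} {r : S.Sec V} (hOV : O ≤ V) (hQV : Q ≤ V)
    (hr : S.res V O hOV r = t) :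
    θ.map O hO t = θ.extend hO hQ h (S.res V Q hQV r) := by
  subst hr
  refine extend_unique ?_ ?_
  · rw [θ.comm, S.res_res_apply, S.res_res_apply]
  · rw [θ.comm]
    exact θ.map_eq_zero_of_le _ inf_le_right _

end SheafEnd

end LCSheafLemmas

/-! ### Relatively compact open sets. -/

variable {X : Type u} [TopologicalSpace X]

theorem CompactlyIn.mono {V U U' : Opens X} (h : CompactlyIn V U) (hU : U ≤ U') :
    CompactlyIn V U' :=
  ⟨h.1.trans hU, h.2⟩

theorem exists_compactlyIn_of_isCompact [T2Space X] [LocallyCompactSpace X] {K : Set X}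
    (hK : IsCompact K) {U : Opens X} (hKU : K ⊆ U) : ∃ W : Opens X, K ⊆ W ∧ CompactlyIn W U := by
  obtain ⟨L, hL, hKL, hLU⟩ := exists_compact_between hK U.isOpen hKU
  have hcl : closure (interior L) ⊆ L := hL.isClosed.closure_subset_iff.2 interior_subset
  exact ⟨⟨interior L, isOpen_interior⟩, hKL, hcl.trans hLU,
    hL.of_isClosed_subset isClosed_closure hcl⟩

theorem CompactlyIn.exists_between [T2Space X] [LocallyCompactSpace X] {V U : Opens X}
    (h : CompactlyIn V U) : ∃ W : Opens X, CompactlyIn V W ∧ CompactlyIn W U := by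
  obtain ⟨W, hVW, hWU⟩ := exists_compactlyIn_of_isCompact h.2 h.1
  exact ⟨W, ⟨hVW, h.2⟩, hWU⟩

theorem exists_compactlyIn_of_mem [T2Space X] [LocallyCompactSpace X] {x : X} {U : Opens X}
    (hx : x ∈ U) : ∃ W : Opens X, x ∈ W ∧ CompactlyIn W U := by
  obtain ⟨W, h1, h2⟩ := exists_compactlyIn_of_isCompact isCompact_singleton
    (Set.singleton_subset_iff.2 hx : {x} ⊆ (U : Set X))
  exact ⟨W, Set.singleton_subset_iff.1 h1, h2⟩

/-! ### Cutoffs and the transfer of test objects between open sets. -/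

namespace TestPair

variable {E : LCSheaf.{u, v} X} {F : LCSheaf.{u, w} X} (T : TestPair E F)

/-- `θ` is the restriction of `η` to the subsheaf `F`. -/
def Restricts {U : Opens X} (η : SheafEnd E U) (θ : SheafEnd F U) : Prop :=
  ∀ (V : Opens X) (hVU : V ≤ U) (s : F.Sec V),
    T.incl V (θ.map V hVU s) = η.map V hVU (T.incl V s)

variable {T} in
theorem Restricts.zeroSet_le {U : Opens X} {η : SheafEnd E U} {θ : SheafEnd F U}
    (h : T.Restricts η θ) : η.zeroSet ≤ θ.zeroSet := by
  refine sSup_le fun V hV => le_sSup ⟨hV.1, fun W hWU hWV => ?_⟩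
  ext s
  apply T.incl_injective
  rw [h, hV.2 W hWU hWV]
  simp

variable {T} in
theorem Restricts.incl_extend {U : Opens X} {η : SheafEnd E U} {θ : SheafEnd F U}
    (h : T.Restricts η θ) {O Q : Opens X} (hO : O ≤ U) (hQ : Q ≤ U) (hη : O ≤ Q ⊔ η.zeroSet)
    (hθ : O ≤ Q ⊔ θ.zeroSet) (s : F.Sec Q) :
    T.incl O (θ.extend hO hQ hθ s) = η.extend hO hQ hη (T.incl Q s) := by
  refine SheafEnd.extend_unique ?_ ?_
  · rw [T.incl_res, SheafEnd.res_extend s inf_le_left inf_le_right, h, T.incl_res]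
  · rw [T.incl_res, SheafEnd.res_extend_zero s inf_le_left (inf_le_right.trans h.zeroSet_le),
      map_zero]

/-- Multiplication of sections over `A` by a cutoff function that is `1` on `N` and has support in
`A`, with values in the sections over `B`. -/
structure Cutoff (A B N : Opens X) where
  le : A ≤ B
  subset : N ≤ A
  mapE : E.Sec A →L[ℂ] E.Sec B
  mapF : F.Sec A →L[ℂ] F.Sec B
  incl_map : ∀ s, T.incl B (mapF s) = mapE (T.incl A s)
  res_mapE : ∀ s, E.res B N (subset.trans le) (mapE s) = E.res A N subset s
  res_mapF : ∀ s, F.res B N (subset.trans le) (mapF s) = F.res A N subset s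
  localE : ∀ (O : Opens X) (hO : O ≤ B) (s : E.Sec A), E.res A (O ⊓ A) inf_le_right s = 0 →
    E.res B O hO (mapE s) = 0
  localF : ∀ (O : Opens X) (hO : O ≤ B) (s : F.Sec A), F.res A (O ⊓ A) inf_le_right s = 0 →
    F.res B O hO (mapF s) = 0

/-- For a partition of unity subordinate to `A`, `C`, the first member has support in `A` and so
extends by zero from `A` to `B`. It is the identity where the second member vanishes; that set is
`N`, and it contains every point outside `C`. -/
theorem exists_cutoff {A B C : Opens X} (hAB : A ≤ B) (hCB : C ≤ B) (hB : B ≤ A ⊔ C) :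
    ∃ N : Opens X, B ≤ N ⊔ C ∧ Nonempty (T.Cutoff A B N) := by
  obtain ⟨η, hη, hsupp, -, hsum⟩ := T.partition B (ULift.{u} Bool)
    (fun b => match b with | ⟨true⟩ => A | ⟨false⟩ => C) (by rintro ⟨_ | _⟩ <;> assumption)
    (by
      refine hB.trans (sup_le ?_ ?_)
      · exact le_iSup (fun b : ULift.{u} Bool => match b with | ⟨true⟩ => A | ⟨false⟩ => C) ⟨true⟩
      · exact le_iSup (fun b : ULift.{u} Bool => match b with | ⟨true⟩ => A | ⟨false⟩ => C) ⟨false⟩)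
  obtain ⟨θ, hθ⟩ : ∃ θ, T.Restricts (η ⟨true⟩) θ := hη ⟨true⟩
  have hA : B ≤ A ⊔ (η ⟨true⟩).zeroSet := by
    intro x hx
    by_cases hxs : x ∈ (η ⟨true⟩).supp
    · exact Or.inl (hsupp ⟨true⟩ hxs)
    · exact Or.inr ((η ⟨true⟩).mem_zeroSet_iff.2 ⟨hx, hxs⟩)
  have hA' : B ≤ A ⊔ θ.zeroSet := hA.trans (sup_le_sup_left hθ.zeroSet_le _)
  have hid : ∀ (W : Opens X) (hW : W ≤ B) (_ : W ≤ A ⊓ (η ⟨false⟩).zeroSet) (s : E.Sec W),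
      (η ⟨true⟩).map W hW s = s := by
    intro W hW hW' s
    have := hsum W hW {⟨true⟩} (by
      rintro ⟨_ | _⟩ hb
      · refine Set.disjoint_left.2 fun x hx hxW => ?_
        exact ((η ⟨false⟩).mem_zeroSet_iff.1 (hW' hxW).2).2 hx
      · simp at hb) s
    simpa using this
  refine ⟨A ⊓ (η ⟨false⟩).zeroSet, ?_, ⟨⟨hAB, inf_le_left,
    (η ⟨true⟩).extend le_rfl hAB hA, θ.extend le_rfl hAB hA', fun s => ?_, fun s => ?_, fun s => ?_,
    fun O hO s hs => ?_, fun O hO s hs => ?_⟩⟩⟩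
  · intro x hx
    by_cases hxs : x ∈ (η ⟨false⟩).supp
    · exact Or.inr (hsupp ⟨false⟩ hxs)
    · rcases hB hx with hxA | hxC
      · exact Or.inl ⟨hxA, (η ⟨false⟩).mem_zeroSet_iff.2 ⟨hx, hxs⟩⟩
      · exact Or.inr hxC
  · exact hθ.incl_extend _ _ _ _ s
  · rw [SheafEnd.res_extend s _ inf_le_left, hid _ _ le_rfl]
  · apply T.incl_injective
    rw [SheafEnd.res_extend s _ inf_le_left, hθ, hid _ _ le_rfl]
  · exact SheafEnd.res_extend_eq_zero hO inf_le_right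
      ((le_inf le_rfl (hO.trans hA)).trans (by
        rw [inf_sup_left]; exact sup_le_sup_left inf_le_right _)) hs
  · exact SheafEnd.res_extend_eq_zero hO inf_le_right
      ((le_inf le_rfl (hO.trans hA')).trans (by
        rw [inf_sup_left]; exact sup_le_sup_left inf_le_right _)) hs

theorem exists_cutoff_of_isCompact [T2Space X] {A B : Opens X} (hAB : A ≤ B) {K : Set X}
    (hK : IsCompact K) (hKA : K ⊆ A) :
    ∃ N : Opens X, K ⊆ N ∧ Nonempty (T.Cutoff A B N) := by
  obtain ⟨N, hN, hc⟩ := T.exists_cutoff (A := A) (B := B)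
    (C := ⟨B ∩ Kᶜ, B.isOpen.inter hK.isClosed.isOpen_compl⟩) hAB (fun x hx => hx.1) (by
      intro x hx
      by_cases hxK : x ∈ K
      · exact Or.inl (hKA hxK)
      · exact Or.inr ⟨hx, hxK⟩)
  refine ⟨N, fun x hx => ?_, hc⟩
  rcases hN (hAB (hKA hx)) with h | h
  · exact h
  · exact absurd hx h.2

theorem isLocalizing_iff {U : Opens X} {Φ : Eps → T.RO U} : T.IsLocalizing U Φ ↔
    ∀ (V V₀ : Opens X) (hV : CompactlyIn V V₀) (hV₀ : CompactlyIn V₀ U),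
      ∀ᶠ ε in epsZero, ∀ s : E.Sec U, E.res U V₀ hV₀.le s = 0 →
        F.res U V (hV.le.trans hV₀.le) (Φ ε s) = 0 :=
  forall₄_congr fun _ _ _ _ => exists_forall_lt_iff_eventually

theorem IsLocalizing.add {U : Opens X} {Φ Ψ : Eps → T.RO U} (hΦ : T.IsLocalizing U Φ)
    (hΨ : T.IsLocalizing U Ψ) : T.IsLocalizing U (fun ε => Φ ε + Ψ ε) := by
  rw [isLocalizing_iff] at *
  intro V V₀ hV hV₀
  filter_upwards [hΦ V V₀ hV hV₀, hΨ V V₀ hV hV₀] with ε h1 h2 s hs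
  rw [add_apply, map_add, h1 s hs, h2 s hs, add_zero]

/-- The nets `Φ` over `U` and `Ψ` over `V` agree on `W` for sections that agree near `W`. -/
def AgreeOn (U V W : Opens X) (Φ : Eps → T.RO U) (Ψ : Eps → T.RO V) : Prop :=
  ∀ (W' W₀ : Opens X) (_ : W' ≤ W) (h : CompactlyIn W' W₀) (hU : W₀ ≤ U) (hV : W₀ ≤ V),
    ∀ᶠ ε in epsZero, ∀ (a : E.Sec U) (b : E.Sec V), E.res U W₀ hU a = E.res V W₀ hV b →
      F.res U W' (h.le.trans hU) (Φ ε a) = F.res V W' (h.le.trans hV) (Ψ ε b)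

section Transfer

variable {T} {U V W₁ N₁ N₂ : Opens X} (eV : T.Cutoff W₁ V N₁) (eU : T.Cutoff (U ⊓ V) U N₂)
  (hW₁ : W₁ ≤ U ⊓ V)

/-- Transport of an operator over `U` to `V` by means of cutoffs. -/
noncomputable def transport (Φ : T.RO U) : T.RO V :=
  eV.mapF.comp ((F.res U W₁ (hW₁.trans inf_le_left)).comp
    (Φ.comp (eU.mapE.comp (E.res V (U ⊓ V) inf_le_right))))

/-- The part of an operator over `V` away from the set where the cutoff is `1`. -/
noncomputable def awayPart (Θ : T.RO V) : T.RO V :=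
  Θ - eV.mapF.comp ((F.res V W₁ (hW₁.trans inf_le_right)).comp Θ)

theorem transport_apply (Φ : T.RO U) (s : E.Sec V) : transport eV eU hW₁ Φ s =
    eV.mapF (F.res U W₁ (hW₁.trans inf_le_left) (Φ (eU.mapE (E.res V (U ⊓ V) inf_le_right s)))) :=
  rfl

theorem awayPart_apply (Θ : T.RO V) (s : E.Sec V) : awayPart eV hW₁ Θ s =
    Θ s - eV.mapF (F.res V W₁ (hW₁.trans inf_le_right) (Θ s)) :=
  rfl

theorem isLocalizing_awayPart {Θ : Eps → T.RO V} (hΘ : T.IsLocalizing V Θ) :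
    T.IsLocalizing V (fun ε => awayPart eV hW₁ (Θ ε)) := by
  rw [isLocalizing_iff] at *
  intro V₁ V₀ hV hV₀
  filter_upwards [hΘ V₁ V₀ hV hV₀] with ε hε s hs
  rw [awayPart_apply, map_sub, hε s hs, eV.localF V₁ (hV.le.trans hV₀.le), sub_zero]
  rw [F.res_res_apply]
  exact F.res_eq_zero_mono _ inf_le_left (hε s hs)

/-- The outer cutoff only sees `V₁ ⊓ W₁`, whose closure is compact in `V₀ ⊓ (U ⊓ V)`. An input
vanishing on `V₀` stays zero on `A₀` after the inner cutoff, and localization of `Φ` from `A₀` to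
`A₁` covers `V₁ ⊓ W₁`. -/
theorem isLocalizing_transport [T2Space X] [LocallyCompactSpace X]
    (hW₁c : CompactlyIn W₁ (U ⊓ V)) {Φ : Eps → T.RO U} (hΦ : T.IsLocalizing U Φ) :
    T.IsLocalizing V (fun ε => transport eV eU hW₁ (Φ ε)) := by
  rw [isLocalizing_iff] at *
  intro V₁ V₀ hV hV₀
  obtain ⟨A₀, hKA₀, hA₀⟩ := exists_compactlyIn_of_isCompact (U := V₀ ⊓ (U ⊓ V))
    (hV.2.inter hW₁c.2) (Set.inter_subset_inter hV.1 hW₁c.1)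
  obtain ⟨A₁, hKA₁, hA₁⟩ := exists_compactlyIn_of_isCompact (hV.2.inter hW₁c.2) hKA₀
  filter_upwards [hΦ A₁ A₀ hA₁ (hA₀.mono (inf_le_right.trans inf_le_left))] with ε hε s hs
  rw [transport_apply]
  refine eV.localF V₁ _ _ ?_
  rw [F.res_res_apply]
  have hle : V₁ ⊓ W₁ ≤ A₁ := fun x hx => hKA₁ ⟨subset_closure hx.1, subset_closure hx.2⟩
  refine F.res_eq_zero_mono (hA₁.le.trans (hA₀.le.trans (inf_le_right.trans inf_le_left))) hle
    (hε _ (eU.localE A₀ _ _ ?_))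
  rw [E.res_res_apply]
  exact E.res_eq_zero_mono hV₀.le (inf_le_left.trans (hA₀.le.trans inf_le_left)) hs

/-- If `a` and `b` agree on `W₀`, then `a` minus the cut off `b` vanishes on `W₂ ⊆ N₂`, so
localization makes `Φ` take equal values on `W'`. There the outer cutoff is the identity and `Θ`
contributes nothing. -/
theorem agreeOn_transport [T2Space X] [LocallyCompactSpace X] {W : Opens X}
    (hWW₁ : CompactlyIn W W₁) (hN₁ : W ≤ N₁) (hN₂ : W₁ ≤ N₂) {Φ : Eps → T.RO U}
    (hΦ : T.IsLocalizing U Φ) (Θ : Eps → T.RO V) (hΘ : ∀ ε s, F.res V N₁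
      (eV.subset.trans eV.le) (Θ ε s) = 0) :
    T.AgreeOn U V W Φ (fun ε => transport eV eU hW₁ (Φ ε) + Θ ε) := by
  intro W' W₀ hW'W hW'W₀ hU hV
  obtain ⟨W₂, hW₂, hW₂'⟩ := exists_compactlyIn_of_isCompact (U := W₀ ⊓ W₁) hW'W₀.2
    (Set.subset_inter hW'W₀.1 ((closure_mono hW'W).trans hWW₁.1))
  have h1 : CompactlyIn W' W₂ := ⟨hW₂, hW'W₀.2⟩
  have h2 : CompactlyIn W₂ U := hW₂'.mono (inf_le_left.trans hU)
  filter_upwards [T.isLocalizing_iff.1 hΦ W' W₂ h1 h2] with ε hε a b hab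
  have hW'N : W' ≤ N₁ := hW'W.trans hN₁
  have h3 := hε (a - eU.mapE (E.res V (U ⊓ V) inf_le_right b)) (by
    rw [map_sub, sub_eq_zero]
    have h4 := congrArg (E.res W₀ W₂ (hW₂'.le.trans inf_le_left)) hab
    have h5 := congrArg (E.res N₂ W₂ (hW₂'.le.trans (inf_le_right.trans hN₂)))
      (eU.res_mapE (E.res V (U ⊓ V) inf_le_right b))
    simp only [E.res_res_apply] at h4 h5
    rw [h4, h5])
  rw [map_sub, map_sub, sub_eq_zero] at h3
  rw [h3, add_apply, map_add]
  have h6 := congrArg (F.res N₁ W' hW'N) (hΘ ε b)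
  have h7 := congrArg (F.res N₁ W' hW'N) (eV.res_mapF (F.res U W₁ (hW₁.trans inf_le_left)
    (Φ ε (eU.mapE (E.res V (U ⊓ V) inf_le_right b)))))
  simp only [F.res_res_apply, map_zero] at h6 h7
  rw [h6, add_zero, transport_apply, h7]

end Transfer

variable {A D : Set (Eps → ℝ≥0)} [T2Space X] [LocallyCompactSpace X]

/-- The new net is `χ Φ(χ' ·) + (1 - χ) Θ`: the second term, built from an arbitrary test object
over `V`, restores the approximation of the identity away from `W`. A `0`-test object needs no such
correction. -/
theorem exists_transfer (hA : IsGrowthScale A) (hTO : ∀ U : Opens X, (T.TOloc A D U).Nonempty)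
    {U V W : Opens X} (hW : CompactlyIn W (U ⊓ V)) :
    (∀ Φ ∈ T.TOloc A D U, ∃ Φ' ∈ T.TOloc A D V, T.AgreeOn U V W Φ Φ') ∧
    (∀ Ψ ∈ T.TOzloc A D U, ∃ Ψ' ∈ T.TOzloc A D V, T.AgreeOn U V W Ψ Ψ') := by
  have hgb := hA.isBoundClass
  have hdb := isBoundClass_decayBound D
  obtain ⟨W₁, hWW₁, hW₁⟩ := hW.exists_between
  obtain ⟨N₁, hN₁, ⟨eV⟩⟩ := T.exists_cutoff_of_isCompact (hW₁.le.trans inf_le_right) hWW₁.2 hWW₁.1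
  obtain ⟨N₂, hN₂, ⟨eU⟩⟩ := T.exists_cutoff_of_isCompact (A := U ⊓ V) (B := U) inf_le_left hW₁.2
    hW₁.1
  have hWN₁ : W ≤ N₁ := fun x hx => hN₁ (subset_closure hx)
  have hW₁N₂ : W₁ ≤ N₂ := fun x hx => hN₂ (subset_closure hx)
  -- The continuous linear map that is applied to the values of the given operator.
  set L : F.Sec U →L[ℂ] F.Sec V := eV.mapF.comp (F.res U W₁ (hW₁.le.trans inf_le_left)) with hL
  set LE : E.Sec U →L[ℂ] E.Sec V := eV.mapE.comp (E.res U W₁ (hW₁.le.trans inf_le_left)) with hLE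
  set M : F.Sec V →L[ℂ] F.Sec V := eV.mapF.comp (F.res V W₁ (hW₁.le.trans inf_le_right)) with hM
  set ME : E.Sec V →L[ℂ] E.Sec V := eV.mapE.comp (E.res V W₁ (hW₁.le.trans inf_le_right)) with hME
  have hLincl : ∀ t, T.incl V (L t) = LE (T.incl U t) := fun t => by
    simp only [hL, hLE, ContinuousLinearMap.comp_apply, eV.incl_map, T.incl_res]
  have hMincl : ∀ t, T.incl V (M t) = ME (T.incl V t) := fun t => by
    simp only [hM, hME, ContinuousLinearMap.comp_apply, eV.incl_map, T.incl_res]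
  have hinclU : ∀ s : F.Sec V, eU.mapE (E.res V (U ⊓ V) inf_le_right (T.incl V s))
      = T.incl U (eU.mapF (F.res V (U ⊓ V) inf_le_right s)) := fun s => by
    rw [T.incl_res, eU.incl_map]
  -- The map `L` only sees its argument on `W₁`, where the inner cutoff is the identity; thus `χ (χ'
  -- s) = χ s`.
  have hLM : ∀ s : F.Sec V, L (eU.mapF (F.res V (U ⊓ V) inf_le_right s)) = M s := by
    intro s
    simp only [hL, hM, ContinuousLinearMap.comp_apply]
    congr 1
    have := congrArg (F.res N₂ W₁ hW₁N₂) (eU.res_mapF (F.res V (U ⊓ V) inf_le_right s))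
    simpa only [F.res_res_apply] using this
  have hLME : ∀ s : E.Sec V, LE (eU.mapE (E.res V (U ⊓ V) inf_le_right s)) = ME s := by
    intro s
    simp only [hLE, hME, ContinuousLinearMap.comp_apply]
    congr 1
    have := congrArg (E.res N₂ W₁ hW₁N₂) (eU.res_mapE (E.res V (U ⊓ V) inf_le_right s))
    simpa only [E.res_res_apply] using this
  constructor
  · rintro Φ ⟨hΦ, hΦl⟩
    obtain ⟨Θ, hΘ, hΘl⟩ := hTO V
    rw [isTestObject_iff hgb] at hΦ hΘ
    refine ⟨fun ε => transport eV eU hW₁.le (Φ ε) + awayPart eV hW₁.le (Θ ε), ⟨?_, ?_⟩, ?_⟩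
    · rw [isTestObject_iff hgb]
      refine ⟨fun s => ?_, fun s => ?_, fun s => ?_⟩
      · exact ((hΦ.1 _).map L).add hgb ((hΘ.1 s).sub hgb ((hΘ.1 s).map M))
      · set t := eU.mapF (F.res V (U ⊓ V) inf_le_right s) with ht
        -- The total error is `L (Φ t - t) + (Θ s - s) - M (Θ s - s)`, since `L t = M s` cancels the
        -- remaining terms.
        have h1 := (((hΦ.2.1 t).map L).add hdb (hΘ.2.1 s)).sub hdb ((hΘ.2.1 s).map M)
        refine h1.congr hdb (Eventually.of_forall fun ε => ?_)
        have h2 : transport eV eU hW₁.le (Φ ε) (T.incl V s) = L (Φ ε (T.incl U t)) := by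
          rw [transport_apply, hinclU]; rfl
        have h3 : awayPart eV hW₁.le (Θ ε) (T.incl V s)
          = Θ ε (T.incl V s) - M (Θ ε (T.incl V s)) := rfl
        simp only [add_apply, h2, h3, map_sub, show L t = M s from hLM s]
        abel
      · have h1 := (LE.continuous.tendsto _).comp
          (hΦ.2.2 (eU.mapE (E.res V (U ⊓ V) inf_le_right s)))
        have h2 := hΘ.2.2 s
        have h3 := h1.add (h2.sub ((ME.continuous.tendsto _).comp h2))
        rw [hLME, add_sub_cancel] at h3
        refine h3.congr fun ε => ?_
        have h4 : transport eV eU hW₁.le (Φ ε) s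
          = L (Φ ε (eU.mapE (E.res V (U ⊓ V) inf_le_right s))) := rfl
        have h5 : awayPart eV hW₁.le (Θ ε) s = Θ ε s - M (Θ ε s) := rfl
        simp only [add_apply, h4, h5, map_add, map_sub, hLincl, hMincl, Function.comp]
    · exact IsLocalizing.add T (isLocalizing_transport eV eU hW₁.le hW₁ hΦl)
        (isLocalizing_awayPart eV hW₁.le hΘl)
    · refine agreeOn_transport eV eU hW₁.le hWW₁ hWN₁ hW₁N₂ hΦl _ fun ε s => ?_
      rw [awayPart_apply, map_sub, eV.res_mapF, F.res_res_apply, sub_self]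
  · rintro Φ ⟨hΦ, hΦl⟩
    rw [isZeroTestObject_iff hgb] at hΦ
    refine ⟨fun ε => transport eV eU hW₁.le (Φ ε), ⟨?_, ?_⟩, ?_⟩
    · rw [isZeroTestObject_iff hgb]
      refine ⟨fun s => (hΦ.1 _).map L, fun s => ?_, fun s => ?_⟩
      · refine ((hΦ.2.1 (eU.mapF (F.res V (U ⊓ V) inf_le_right s))).map L).congr hdb
          (Eventually.of_forall fun ε => ?_)
        simp only [transport_apply, hinclU]
        rfl
      · have h1 := (LE.continuous.tendsto _).comp
          (hΦ.2.2 (eU.mapE (E.res V (U ⊓ V) inf_le_right s)))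
        rw [map_zero] at h1
        refine h1.congr fun ε => ?_
        rw [Function.comp, ← hLincl]
        rfl
    · exact isLocalizing_transport eV eU hW₁.le hW₁ hΦl
    · have := agreeOn_transport eV eU hW₁.le hWW₁ hWN₁ hW₁N₂ hΦl (fun _ => 0)
        fun ε s => by simp
      simpa only [add_zero] using this

end TestPair

namespace TestPair

variable {X : Type u} [TopologicalSpace X] {E : LCSheaf.{u, v} X} {F : LCSheaf.{u, w} X}
  {T : TestPair E F}

/-! ### Local smooth maps and their restrictions -/

namespace LocBasic

variable {U : Opens X}

theorem smooth (R : T.LocBasic U) : IsSmoothMap R.toFun :=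
  (Subtype.property (p := fun R => R ∈ T.locSubmodule U) R).1

theorem isLocal (R : T.LocBasic U) : T.IsLocal U R.toFun :=
  (Subtype.property (p := fun R => R ∈ T.locSubmodule U) R).2

/-- The element of `LocBasic U` given by a smooth local map. -/
def ofMap (f : T.RO U → F.Sec U) (hf : IsSmoothMap f) (hf' : T.IsLocal U f) : T.LocBasic U :=
  Subtype.mk (p := fun R => R ∈ T.locSubmodule U) f ⟨hf, hf'⟩

theorem toFun_ofMap (f : T.RO U → F.Sec U) (hf : IsSmoothMap f) (hf' : T.IsLocal U f) :
    (ofMap f hf hf').toFun = f := rfl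

theorem toFun_injective : Function.Injective (toFun : T.LocBasic U → T.RO U → F.Sec U) :=
  Subtype.val_injective

theorem toFun_add (R S : T.LocBasic U) : (R + S).toFun = R.toFun + S.toFun := rfl

theorem toFun_smul (a : ℂ) (R : T.LocBasic U) : (a • R).toFun = a • R.toFun := rfl

theorem toFun_zero : (0 : T.LocBasic U).toFun = 0 := rfl

end LocBasic

variable (T) in
/-- The linear map `Φ ↦ m ∘ Φ ∘ r` between spaces of regularization operators. -/
noncomputable def sandwich {U V : Opens X} (m : F.Sec U →L[ℂ] F.Sec V)
    (r : E.Sec V →L[ℂ] E.Sec U) : T.RO U →L[ℝ] T.RO V :=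
  ((ContinuousLinearMap.precomp (F.Sec V) r).comp
    (ContinuousLinearMap.postcomp (E.Sec U) m)).restrictScalars ℝ

theorem sandwich_apply {U V : Opens X} (m : F.Sec U →L[ℂ] F.Sec V)
    (r : E.Sec V →L[ℂ] E.Sec U) (Φ : T.RO U) (s : E.Sec V) :
    T.sandwich m r Φ s = m (Φ (r s)) := rfl

section Restriction

variable [T2Space X] [LocallyCompactSpace X]

theorem mem_iSup_compactlyIn (V : Opens X) :
    V ≤ ⨆ W : {W : Opens X // CompactlyIn W V}, W.1 := by
  intro x hx
  obtain ⟨W, hxW, hW⟩ := exists_compactlyIn_of_mem hx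
  exact Opens.mem_iSup.2 ⟨⟨W, hW⟩, hxW⟩

variable (T) in
omit [LocallyCompactSpace X] in
-- The operator `χ ∘ Φ ∘ ρ`, with a cutoff `χ` equal to `1` near `closure W`, is an admissible `Φ'`
-- in `IsLocRestriction`. Continuous linear dependence on `Φ` keeps compositions smooth.
theorem exists_extension_operator {U V W : Opens X} (hVU : V ≤ U) (hW : CompactlyIn W V) :
    ∃ e : T.RO V →L[ℝ] T.RO U, ∀ Φ : T.RO V,
      ((F.res V W hW.le).comp Φ).comp (E.res U V hVU) = (F.res U W (hW.le.trans hVU)).comp (e Φ) := by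
  obtain ⟨N, hN, ⟨c⟩⟩ := T.exists_cutoff_of_isCompact hVU hW.2 hW.1
  have hWN : W ≤ N := fun x hx => hN (subset_closure hx)
  refine ⟨T.sandwich c.mapF (E.res U V hVU), fun Φ => ?_⟩
  ext s
  have := congrArg (F.res N W hWN) (c.res_mapF (Φ (E.res U V hVU s)))
  simp only [F.res_res_apply] at this
  simp only [ContinuousLinearMap.comp_apply, sandwich_apply, this]

theorem IsLocRestriction.unique {U V : Opens X} {hVU : V ≤ U}
    {r r' : T.LocBasic U →ₗ[ℂ] T.LocBasic V} (hr : T.IsLocRestriction U V hVU r)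
    (hr' : T.IsLocRestriction U V hVU r') : r = r' := by
  ext R
  refine LocBasic.toFun_injective (funext fun Φ => ?_)
  refine F.ext_of_locally fun x hx => ?_
  obtain ⟨W, hxW, hW⟩ := exists_compactlyIn_of_mem hx
  obtain ⟨e, he⟩ := T.exists_extension_operator hVU hW
  exact ⟨W, hW.le, hxW, by rw [hr R W hW Φ _ (he Φ), hr' R W hW Φ _ (he Φ)]⟩

variable (T) in
-- By locality of `R`, the section `R (e W Φ)` on an open subset of `W` is the same for every
-- operator over `U` that agrees with `Φ` there. So the sections for varying `W ⋐ V` glue, and each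
-- local piece is smooth as a composite with `e W`.
theorem exists_isLocRestriction {U V : Opens X} (hVU : V ≤ U) :
    ∃ r : T.LocBasic U →ₗ[ℂ] T.LocBasic V, T.IsLocRestriction U V hVU r := by
  choose e he using fun W : {W : Opens X // CompactlyIn W V} =>
    T.exists_extension_operator hVU W.2
  have hloc : ∀ (R : T.LocBasic U) (W : {W : Opens X // CompactlyIn W V}) (O : Opens X)
      (hOW : O ≤ W.1) (Φ : T.RO V) (Φ' : T.RO U),
      ((F.res V O (hOW.trans W.2.le)).comp Φ).comp (E.res U V hVU)
        = (F.res U O ((hOW.trans W.2.le).trans hVU)).comp Φ' →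
      F.res U O ((hOW.trans W.2.le).trans hVU) (R.toFun (e W Φ))
        = F.res U O ((hOW.trans W.2.le).trans hVU) (R.toFun Φ') := by
    intro R W O hOW Φ Φ' hΦ
    refine R.isLocal O _ _ _ ?_
    rw [← hΦ]
    ext s
    have := congrArg (fun L : E.Sec U →L[ℂ] F.Sec W.1 => F.res W.1 O hOW (L s)) (he W Φ)
    simp only [ContinuousLinearMap.comp_apply, F.res_res_apply] at this
    simp only [ContinuousLinearMap.comp_apply, this]
  have hcompat : ∀ (R : T.LocBasic U) (Φ : T.RO V) (W W' : {W : Opens X // CompactlyIn W V}),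
      F.res W.1 (W.1 ⊓ W'.1) inf_le_left (F.res U W.1 (W.2.le.trans hVU) (R.toFun (e W Φ)))
        = F.res W'.1 (W.1 ⊓ W'.1) inf_le_right
          (F.res U W'.1 (W'.2.le.trans hVU) (R.toFun (e W' Φ))) := by
    intro R Φ W W'
    rw [F.res_res_apply, F.res_res_apply]
    refine hloc R W _ inf_le_left Φ _ ?_
    ext s
    have := congrArg (fun L : E.Sec U →L[ℂ] F.Sec W'.1 =>
      F.res W'.1 (W.1 ⊓ W'.1) inf_le_right (L s)) (he W' Φ)
    simp only [ContinuousLinearMap.comp_apply, F.res_res_apply] at this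
    simp only [ContinuousLinearMap.comp_apply, this]
  choose f hf using fun (R : T.LocBasic U) (Φ : T.RO V) =>
    F.isSheaf.glue V _ Subtype.val (fun W : {W : Opens X // CompactlyIn W V} => W.2.le)
      (mem_iSup_compactlyIn V) _ (hcompat R Φ)
  have hf' : ∀ R Φ (W : {W : Opens X // CompactlyIn W V}), F.res V W.1 W.2.le (f R Φ)
      = F.res U W.1 (W.2.le.trans hVU) (R.toFun (e W Φ)) := hf
  have hres : ∀ (R : T.LocBasic U) (W : Opens X) (hW : CompactlyIn W V) (Φ : T.RO V)
      (Φ' : T.RO U), ((F.res V W hW.le).comp Φ).comp (E.res U V hVU)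
        = (F.res U W (hW.le.trans hVU)).comp Φ' →
      F.res V W hW.le (f R Φ) = F.res U W (hW.le.trans hVU) (R.toFun Φ') := by
    intro R W hW Φ Φ' h
    rw [hf' R Φ ⟨W, hW⟩]
    exact hloc R ⟨W, hW⟩ W le_rfl Φ Φ' h
  have hext : ∀ s t : F.Sec V, (∀ W : {W : Opens X // CompactlyIn W V},
      F.res V W.1 W.2.le s = F.res V W.1 W.2.le t) → s = t := fun s t hst =>
    F.ext_of_locally fun x hx => by
      obtain ⟨W, hxW, hW⟩ := exists_compactlyIn_of_mem hx
      exact ⟨W, hW.le, hxW, hst ⟨W, hW⟩⟩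
  have hsmooth : ∀ R, IsSmoothMap (f R) := fun R => by
    refine F.isSmoothMap_of_locally (c := Subtype.val)
      (fun W : {W : Opens X // CompactlyIn W V} => W.2.le) (mem_iSup_compactlyIn V) fun W => ?_
    have h1 := (R.smooth.comp_clm (e W)).map
      ((F.res U W.1 (W.2.le.trans hVU)).restrictScalars ℝ)
    simp only [hf']
    exact h1
  have hlocal : ∀ R, T.IsLocal V (f R) := by
    intro R O hO Φ₁ Φ₂ h
    refine F.ext_of_locally fun x hx => ?_
    obtain ⟨W, hxW, hW⟩ := exists_compactlyIn_of_mem hx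
    refine ⟨W, hW.le, hxW, ?_⟩
    rw [F.res_res_apply, F.res_res_apply, hf' R Φ₁ ⟨W, hW.mono hO⟩]
    refine (hres R W (hW.mono hO) Φ₂ _ ?_).symm
    rw [← he ⟨W, hW.mono hO⟩ Φ₁]
    ext s
    have := congrArg (fun L : E.Sec V →L[ℂ] F.Sec O =>
      F.res O W hW.le (L (E.res U V hVU s))) h
    simp only [ContinuousLinearMap.comp_apply, F.res_res_apply] at this
    simp only [ContinuousLinearMap.comp_apply, this]
  refine ⟨⟨⟨fun R => LocBasic.ofMap (f R) (hsmooth R) (hlocal R), fun R S => ?_⟩, fun a R => ?_⟩,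
    fun R W hW Φ Φ' h => hres R W hW Φ Φ' h⟩
  · refine LocBasic.toFun_injective (funext fun Φ => hext _ _ fun W => ?_)
    simp only [LocBasic.toFun_add, LocBasic.toFun_ofMap, Pi.add_apply, map_add, hf']
  · refine LocBasic.toFun_injective (funext fun Φ => hext _ _ fun W => ?_)
    simp only [LocBasic.toFun_smul, LocBasic.toFun_ofMap, Pi.smul_apply, map_smul, hf',
      RingHom.id_apply]

variable (T) in
/-- The restriction map of local smooth maps. -/
noncomputable def locRes (U V : Opens X) (hVU : V ≤ U) : T.LocBasic U →ₗ[ℂ] T.LocBasic V :=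
  Classical.choose (T.exists_isLocRestriction hVU)

variable (T) in
theorem isLocRestriction_locRes (U V : Opens X) (hVU : V ≤ U) :
    T.IsLocRestriction U V hVU (T.locRes U V hVU) :=
  Classical.choose_spec (T.exists_isLocRestriction hVU)

theorem locRes_self (U : Opens X) : T.locRes U U le_rfl = LinearMap.id := by
  refine (T.isLocRestriction_locRes U U le_rfl).unique fun R W hW Φ Φ' h => ?_
  refine R.isLocal W _ _ _ ?_
  rw [← h]
  ext s
  simp only [ContinuousLinearMap.comp_apply, E.res_self_apply]

theorem locRes_locRes (U V W : Opens X) (hVU : V ≤ U) (hWV : W ≤ V) :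
    (T.locRes V W hWV).comp (T.locRes U V hVU) = T.locRes U W (hWV.trans hVU) := by
  refine IsLocRestriction.unique (fun R O hO Φ Φ' h => ?_)
    (T.isLocRestriction_locRes U W (hWV.trans hVU))
  -- An intermediate operator over `V` links `Φ` over `W` with `Φ'` over `U`; uniqueness of
  -- restrictions then gives the composition law.
  obtain ⟨e, he⟩ := T.exists_extension_operator hWV hO
  rw [LinearMap.comp_apply, T.isLocRestriction_locRes V W hWV _ O hO Φ _ (he Φ)]
  refine T.isLocRestriction_locRes U V hVU R O (hO.mono hWV) (e Φ) Φ' ?_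
  rw [← h, ← he Φ]
  ext s
  simp only [ContinuousLinearMap.comp_apply, E.res_res_apply]

end Restriction

/-! ### Comparison of differentials along agreeing nets -/

section Agree

theorem AgreeOn.symm {U V W : Opens X} {Φ : Eps → T.RO U} {Ψ : Eps → T.RO V}
    (h : T.AgreeOn U V W Φ Ψ) : T.AgreeOn V U W Ψ Φ :=
  fun W' W₀ h1 h2 hV hU => (h W' W₀ h1 h2 hU hV).mono fun _ hε a b hab => (hε b a hab.symm).symm

/-- The range of small `ε` must not depend on `t`, since a differential at fixed `ε` uses all `t`.
Linearity and finiteness of the number of directions provide this. -/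
theorem AgreeOn.eventually_affine {U V W : Opens X} {Φ : Eps → T.RO U} {Φ' : Eps → T.RO V} {l : ℕ}
    {Ψ : Fin l → Eps → T.RO U} {Ψ' : Fin l → Eps → T.RO V} (hΦ : T.AgreeOn U V W Φ Φ')
    (hΨ : ∀ i, T.AgreeOn U V W (Ψ i) (Ψ' i)) {W' W₀ : Opens X} (hW' : W' ≤ W)
    (h : CompactlyIn W' W₀) (hU : W₀ ≤ U) (hV : W₀ ≤ V) :
    ∀ᶠ ε in epsZero, ∀ (t : Fin l → ℝ) (a : E.Sec U) (b : E.Sec V),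
      E.res U W₀ hU a = E.res V W₀ hV b →
      F.res U W' (h.le.trans hU) ((Φ ε + ∑ i, t i • Ψ i ε) a)
        = F.res V W' (h.le.trans hV) ((Φ' ε + ∑ i, t i • Ψ' i ε) b) := by
  filter_upwards [hΦ W' W₀ hW' h hU hV,
    eventually_all.2 fun i => hΨ i W' W₀ hW' h hU hV] with ε h1 h2 t a b hab
  have hsmul : ∀ (O : Opens X) (r : ℝ) (Θ : T.RO O) (s : E.Sec O), (r • Θ) s = (r : ℂ) • Θ s :=
    fun _ _ _ _ => rfl
  simp only [add_apply, sum_apply, map_add, map_sum, hsmul, map_smul,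
    h1 a b hab, h2 _ a b hab]

theorem res_iterDifferential_eq {U V W : Opens X} (R : T.LocBasic U) (S : T.LocBasic V)
    (hU : W ≤ U) (hV : W ≤ V) {l : ℕ} {Φ : T.RO U} {Ψ : Fin l → T.RO U} {Φ' : T.RO V}
    {Ψ' : Fin l → T.RO V}
    (h : ∀ t : Fin l → ℝ, F.res U W hU (R.toFun (Φ + ∑ i, t i • Ψ i))
      = F.res V W hV (S.toFun (Φ' + ∑ i, t i • Ψ' i))) :
    F.res U W hU (iterDifferential R.toFun l Φ Ψ)
      = F.res V W hV (iterDifferential S.toFun l Φ' Ψ') := by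
  have h1 := iterDifferential_map R.smooth ((F.res U W hU).restrictScalars ℝ) l Φ Ψ
  have h2 := iterDifferential_map S.smooth ((F.res V W hV).restrictScalars ℝ) l Φ' Ψ'
  exact h1.symm.trans ((iterDifferential_congr h).trans h2)

variable [T2Space X] [LocallyCompactSpace X]

theorem AgreeOn.eventually_iterDifferential_locRes {U V W : Opens X} (hVU : V ≤ U)
    (hW : CompactlyIn W V) (R : T.LocBasic U) {Φ : Eps → T.RO U} {Φ' : Eps → T.RO V} {l : ℕ}
    {Ψ : Fin l → Eps → T.RO U} {Ψ' : Fin l → Eps → T.RO V} (hΦ : T.AgreeOn U V W Φ Φ')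
    (hΨ : ∀ i, T.AgreeOn U V W (Ψ i) (Ψ' i)) :
    ∀ᶠ ε in epsZero, F.res U W (hW.le.trans hVU)
        (iterDifferential R.toFun l (Φ ε) (fun i => Ψ i ε))
      = F.res V W hW.le
        (iterDifferential (T.locRes U V hVU R).toFun l (Φ' ε) (fun i => Ψ' i ε)) := by
  filter_upwards [hΦ.eventually_affine hΨ le_rfl hW hVU le_rfl] with ε hε
  refine res_iterDifferential_eq R _ _ _ fun t => ?_
  refine (T.isLocRestriction_locRes U V hVU R W hW _ _ ?_).symm
  ext a
  exact (hε t a (E.res U V hVU a) (by rw [E.res_self_apply])).symm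

end Agree

/-! ### Moderate and negligible maps -/

section Bound

variable (T) in
/-- All differentials of `R` along localizing test objects are bounded in the sense of `P`. -/
def IsBoundLoc (A D : Set (Eps → ℝ≥0)) (P : (Eps → ℝ) → Prop) (U : Opens X)
    (R : T.LocBasic U) : Prop :=
  ∀ l : ℕ, ∀ Φ ∈ T.TOloc A D U, ∀ Ψ : Fin l → Eps → T.RO U, (∀ i, Ψ i ∈ T.TOzloc A D U) →
    NetBound P (fun ε => iterDifferential R.toFun l (Φ ε) (fun i => Ψ i ε))

variable {A D : Set (Eps → ℝ≥0)} {P : (Eps → ℝ) → Prop} {U : Opens X}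

theorem isModerateLoc_iff {R : T.LocBasic U} :
    T.IsModerateLoc A D U R ↔ T.IsBoundLoc A D (growthBound A) U R :=
  ⟨fun h l Φ hΦ Ψ hΨ p hp => h p hp l Φ hΦ Ψ hΨ, fun h p hp l Φ hΦ Ψ hΨ => h l Φ hΦ Ψ hΨ p hp⟩

theorem isNegligibleLoc_iff {R : T.LocBasic U} :
    T.IsNegligibleLoc A D U R ↔ T.IsBoundLoc A D (decayBound D) U R :=
  ⟨fun h l Φ hΦ Ψ hΨ p hp => h p hp l Φ hΦ Ψ hΨ, fun h p hp l Φ hΦ Ψ hΨ => h l Φ hΦ Ψ hΨ p hp⟩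

variable (T A D U) in
/-- The subspace of maps whose differentials along test objects are bounded. -/
def boundSubmodule (hP : IsBoundClass P) : Submodule ℂ (T.LocBasic U) where
  carrier := {R | T.IsBoundLoc A D P U R}
  zero_mem' := fun l Φ _ Ψ _ => by
    simp only [LocBasic.toFun_zero, iterDifferential_zero]
    exact NetBound.zero hP
  add_mem' := fun {R S} hR hS l Φ hΦ Ψ hΨ => by
    simp only [LocBasic.toFun_add, iterDifferential_add R.smooth S.smooth]
    exact (hR l Φ hΦ Ψ hΨ).add hP (hS l Φ hΦ Ψ hΨ)
  smul_mem' := fun a R hR l Φ hΦ Ψ hΨ => by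
    simp only [LocBasic.toFun_smul, iterDifferential_smul R.smooth]
    exact (hR l Φ hΦ Ψ hΨ).smul hP a

variable [T2Space X] [LocallyCompactSpace X]

/-- Near each point, test objects over `V` are transferred to `U`, where `R` is bounded; on a small
`W` the differentials agree for small `ε`. -/
theorem IsBoundLoc.locRes (hP : IsBoundClass P) (hA : IsGrowthScale A)
    (hTO : ∀ U : Opens X, (T.TOloc A D U).Nonempty) {V : Opens X} (hVU : V ≤ U)
    {R : T.LocBasic U} (hR : T.IsBoundLoc A D P U R) :
    T.IsBoundLoc A D P V (T.locRes U V hVU R) := by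
  intro l Φ hΦ Ψ hΨ
  refine F.netBound_of_locally hP fun x hx => ?_
  obtain ⟨W, hxW, hW⟩ := exists_compactlyIn_of_mem hx
  refine ⟨W, hW.le, hxW, ?_⟩
  obtain ⟨h1, h2⟩ := T.exists_transfer hA hTO (U := V) (V := U) (hW.mono (le_inf le_rfl hVU))
  obtain ⟨Φ', hΦ', hag⟩ := h1 Φ hΦ
  choose Ψ' hΨ' hag' using fun i => h2 (Ψ i) (hΨ i)
  exact ((hR l Φ' hΦ' Ψ' hΨ').map (F.res U W (hW.le.trans hVU))).congr hP
    (hag.symm.eventually_iterDifferential_locRes hVU hW R fun i => (hag' i).symm)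

/-- Here the transfer goes from `U` to the smaller set. This yields (S1), and later moderateness of
the glued map. -/
theorem isBoundLoc_of_locally (hP : IsBoundClass P) (hA : IsGrowthScale A)
    (hTO : ∀ U : Opens X, (T.TOloc A D U).Nonempty) {R : T.LocBasic U}
    (h : ∀ x ∈ U, ∃ (V : Opens X) (hV : V ≤ U), x ∈ V ∧ T.IsBoundLoc A D P V (T.locRes U V hV R)) :
    T.IsBoundLoc A D P U R := by
  intro l Φ hΦ Ψ hΨ
  refine F.netBound_of_locally hP fun x hx => ?_
  obtain ⟨V, hVU, hxV, hV⟩ := h x hx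
  obtain ⟨W, hxW, hW⟩ := exists_compactlyIn_of_mem hxV
  refine ⟨W, hW.le.trans hVU, hxW, ?_⟩
  obtain ⟨h1, h2⟩ := T.exists_transfer hA hTO (U := U) (V := V) (hW.mono (le_inf hVU le_rfl))
  obtain ⟨Φ', hΦ', hag⟩ := h1 Φ hΦ
  choose Ψ' hΨ' hag' using fun i => h2 (Ψ i) (hΨ i)
  exact ((hV l Φ' hΦ' Ψ' hΨ').map (F.res V W hW.le)).congr hP
    ((hag.eventually_iterDifferential_locRes hVU hW R hag').mono fun ε hε => hε.symm)

end Bound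

end TestPair

namespace TestPair

variable {X : Type u} [TopologicalSpace X] {E : LCSheaf.{u, v} X} {F : LCSheaf.{u, w} X}
  {T : TestPair E F}

/-! ### Gluing of local smooth maps -/

theorem iterDifferential_toFun_sub {U : Opens X} (R S : T.LocBasic U) (l : ℕ) (Φ : T.RO U)
    (Ψ : Fin l → T.RO U) : iterDifferential (R - S).toFun l Φ Ψ
      = iterDifferential R.toFun l Φ Ψ - iterDifferential S.toFun l Φ Ψ := by
  rw [sub_eq_add_neg R S, ← neg_one_smul ℂ S, LocBasic.toFun_add,
    iterDifferential_add R.smooth (LocBasic.smooth ((-1 : ℂ) • S)), LocBasic.toFun_smul,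
    iterDifferential_smul S.smooth, neg_one_smul, sub_eq_add_neg]

/-- Local smooth maps over the members of a covering are patched together by means of a locally
finite family of sheaf endomorphisms. -/
theorem exists_sum_extend {U : Opens X} {ι : Type u} {c : ι → Opens X} (hc : ∀ i, c i ≤ U)
    (θ : ι → SheafEnd F U) (hθ : ∀ i, U ≤ c i ⊔ (θ i).zeroSet)
    (hfin : ∀ x ∈ U, ∃ V : Opens X, V ≤ U ∧ x ∈ V ∧ {i | ¬ V ≤ (θ i).zeroSet}.Finite)
    (e : ∀ i, E.Sec (c i) →L[ℂ] E.Sec U) (R : ∀ i, T.LocBasic (c i)) :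
    ∃ S : T.LocBasic U, ∀ (V : Opens X) (hV : V ≤ U) (J : Finset ι),
      (∀ i, i ∉ J → V ≤ (θ i).zeroSet) → ∀ Φ : T.RO U, F.res U V hV (S.toFun Φ)
        = ∑ i ∈ J, F.res U V hV ((θ i).extend le_rfl (hc i) (hθ i)
          ((R i).toFun (T.sandwich (F.res U (c i) (hc i)) (e i) Φ))) := by
  classical
  set g : ι → T.RO U → F.Sec U := fun i Φ => (θ i).extend le_rfl (hc i) (hθ i)
    ((R i).toFun (T.sandwich (F.res U (c i) (hc i)) (e i) Φ)) with hg
  have hgsmooth : ∀ i, IsSmoothMap (g i) := fun i =>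
    ((R i).smooth.comp_clm (T.sandwich (F.res U (c i) (hc i)) (e i))).map
      (((θ i).extend le_rfl (hc i) (hθ i)).restrictScalars ℝ)
  have hglocal : ∀ i, T.IsLocal U (g i) := by
    intro i O hO Φ₁ Φ₂ h
    rw [← sub_eq_zero, ← map_sub, hg]
    simp only
    rw [← map_sub]
    refine SheafEnd.res_extend_eq_zero (Q' := O ⊓ c i) hO inf_le_right ?_ ?_
    · exact (le_inf le_rfl (hO.trans (hθ i))).trans
        (by rw [inf_sup_left]; exact sup_le_sup_left inf_le_right _)
    · rw [map_sub, sub_eq_zero]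
      refine (R i).isLocal _ _ _ _ ?_
      ext s
      have := congrArg (fun L : E.Sec U →L[ℂ] F.Sec O =>
        F.res O (O ⊓ c i) inf_le_left (L (e i s))) h
      simp only [ContinuousLinearMap.comp_apply, F.res_res_apply] at this
      simp only [ContinuousLinearMap.comp_apply, sandwich_apply, F.res_res_apply, this]
  have hg0 : ∀ i (V : Opens X) (hV : V ≤ U), V ≤ (θ i).zeroSet → ∀ Φ, F.res U V hV (g i Φ) = 0 :=
    fun i V hV h Φ => SheafEnd.res_extend_zero _ hV h
  -- Indices with `θ i` zero on `V` contribute nothing, so finite sums over different admissible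
  -- index sets agree and can be glued.
  have hsub : ∀ (V : Opens X) (hV : V ≤ U) (J J' : Finset ι), (∀ i, i ∉ J → V ≤ (θ i).zeroSet) →
      (∀ i, i ∉ J' → V ≤ (θ i).zeroSet) → ∀ Φ,
      ∑ i ∈ J, F.res U V hV (g i Φ) = ∑ i ∈ J', F.res U V hV (g i Φ) := by
    intro V hV J J' hJ hJ' Φ
    rw [Finset.sum_subset (Finset.subset_union_left : J ⊆ J ∪ J')
        fun i _ hi => hg0 i V hV (hJ i hi) Φ,
      Finset.sum_subset (Finset.subset_union_right : J' ⊆ J ∪ J')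
        fun i _ hi => hg0 i V hV (hJ' i hi) Φ]
  let κ : Type u := {V : Opens X // V ≤ U ∧ {i | ¬ V ≤ (θ i).zeroSet}.Finite}
  let J : κ → Finset ι := fun V => V.2.2.toFinset
  have hJ : ∀ (V : κ) i, i ∉ J V → V.1 ≤ (θ i).zeroSet := fun V i hi => by
    simpa [J] using hi
  have hκ : U ≤ ⨆ V : κ, V.1 := by
    intro x hx
    obtain ⟨V, hVU, hxV, hV⟩ := hfin x hx
    exact Opens.mem_iSup.2 ⟨⟨V, hVU, hV⟩, hxV⟩
  have hcompat : ∀ (Φ : T.RO U) (V V' : κ),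
      F.res V.1 (V.1 ⊓ V'.1) inf_le_left (∑ i ∈ J V, F.res U V.1 V.2.1 (g i Φ))
        = F.res V'.1 (V.1 ⊓ V'.1) inf_le_right (∑ i ∈ J V', F.res U V'.1 V'.2.1 (g i Φ)) := by
    intro Φ V V'
    simp only [map_sum, F.res_res_apply]
    exact hsub _ _ _ _ (fun i hi => inf_le_left.trans (hJ V i hi))
      (fun i hi => inf_le_right.trans (hJ V' i hi)) Φ
  choose S hS using fun Φ : T.RO U =>
    F.isSheaf.glue U κ Subtype.val (fun V => V.2.1) hκ _ (hcompat Φ)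
  have hS' : ∀ Φ (V : κ), F.res U V.1 V.2.1 (S Φ) = ∑ i ∈ J V, F.res U V.1 V.2.1 (g i Φ) := hS
  have hSmooth : IsSmoothMap S := by
    refine F.isSmoothMap_of_locally (c := Subtype.val) (fun V : κ => V.2.1) hκ fun V => ?_
    have := IsSmoothMap.sum (J V) fun i _ =>
      (hgsmooth i).map ((F.res U V.1 V.2.1).restrictScalars ℝ)
    convert this using 1
    funext Φ
    rw [hS', Finset.sum_apply]
    rfl
  have hSlocal : T.IsLocal U S := by
    intro O hO Φ₁ Φ₂ h
    refine F.ext_of_locally fun x hx => ?_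
    obtain ⟨V, hVU, hxV, hV⟩ := hfin x (hO hx)
    refine ⟨O ⊓ V, inf_le_left, ⟨hx, hxV⟩, ?_⟩
    have h1 : ∀ Φ, F.res U (O ⊓ V) (inf_le_left.trans hO) (S Φ)
        = ∑ i ∈ J ⟨V, hVU, hV⟩, F.res U (O ⊓ V) (inf_le_left.trans hO) (g i Φ) := fun Φ => by
      have := congrArg (F.res V (O ⊓ V) inf_le_right) (hS' Φ ⟨V, hVU, hV⟩)
      simpa only [map_sum, F.res_res_apply] using this
    rw [F.res_res_apply, F.res_res_apply, h1, h1]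
    refine Finset.sum_congr rfl fun i _ => ?_
    have := congrArg (F.res O (O ⊓ V) inf_le_left) (hglocal i O hO Φ₁ Φ₂ h)
    simpa only [F.res_res_apply] using this
  refine ⟨LocBasic.ofMap S hSmooth hSlocal, fun V hV J' hJ' Φ => ?_⟩
  rw [LocBasic.toFun_ofMap]
  have hV' : V ≤ U ∧ {i | ¬ V ≤ (θ i).zeroSet}.Finite :=
    ⟨hV, J'.finite_toSet.subset fun i hi => by
      by_contra h
      exact hi (hJ' i h)⟩
  rw [hS' Φ ⟨V, hV'⟩]
  exact hsub V hV _ _ (hJ ⟨V, hV'⟩) hJ' Φ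

variable [T2Space X] [LocallyCompactSpace X] {A D : Set (Eps → ℝ≥0)} {P : (Eps → ℝ) → Prop}

/-- The single term `R_i - R_j` of the gluing, with `C = U_i` and `B = U_j`. The test objects are
moved to `C ⊓ B`, where the hypothesis on the difference applies. On `W`, inside the set where the
cutoff is `1`, `R` of the cut off operator over `U` is the restriction of `R` at the moved one. -/
theorem netBound_res_iterDifferential_sub (hP : IsBoundClass P) (hA : IsGrowthScale A)
    (hTO : ∀ U : Opens X, (T.TOloc A D U).Nonempty) {U B C N W W' : Opens X} (hB : B ≤ U)
    (e : T.Cutoff C U N) (hW : CompactlyIn W (N ⊓ B)) (hWW' : W ≤ W') (R : T.LocBasic C)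
    (S : T.LocBasic B)
    (hRS : T.IsBoundLoc A D P (C ⊓ B)
      (T.locRes C (C ⊓ B) inf_le_left R - T.locRes B (C ⊓ B) inf_le_right S)) {l : ℕ}
    {Φ : Eps → T.RO B} {Φ' : Eps → T.RO U} {Ψ : Fin l → Eps → T.RO B}
    {Ψ' : Fin l → Eps → T.RO U} (hΦ : Φ ∈ T.TOloc A D B) (hΨ : ∀ i, Ψ i ∈ T.TOzloc A D B)
    (hag : T.AgreeOn B U W' Φ Φ') (hag' : ∀ i, T.AgreeOn B U W' (Ψ i) (Ψ' i)) :
    NetBound P fun ε => F.res C W (hW.le.trans (inf_le_left.trans e.subset))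
        (iterDifferential (fun Θ => R.toFun (T.sandwich (F.res U C e.le) e.mapE Θ)) l (Φ' ε)
          fun i => Ψ' i ε)
      - F.res B W (hW.le.trans inf_le_right)
        (iterDifferential S.toFun l (Φ ε) fun i => Ψ i ε) := by
  have hNB : N ⊓ B ≤ C ⊓ B := inf_le_inf_right B e.subset
  have hWB : CompactlyIn W B := hW.mono inf_le_right
  have hWCB : CompactlyIn W (C ⊓ B) := hW.mono hNB
  obtain ⟨h1, h2⟩ := T.exists_transfer hA hTO (U := B) (V := C ⊓ B) (W := W)
    (hWCB.mono (le_inf inf_le_right le_rfl))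
  obtain ⟨Θ, hΘ, hagΘ⟩ := h1 Φ hΦ
  choose Ξ hΞ hagΞ using fun i => h2 (Ψ i) (hΨ i)
  refine ((hRS l Θ hΘ Ξ hΞ).map (F.res (C ⊓ B) W hWCB.le)).congr hP ?_
  filter_upwards [hagΘ.eventually_iterDifferential_locRes inf_le_right hWCB S hagΞ,
    hag.eventually_affine hag' hWW' hWB le_rfl hB,
    hagΘ.eventually_affine hagΞ le_rfl hW inf_le_right hNB] with ε hS hU hN
  rw [iterDifferential_toFun_sub, map_sub, hS]
  congr 1
  have hcomp : iterDifferential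
      (fun Θ => R.toFun (T.sandwich (F.res U C e.le) e.mapE Θ)) l (Φ' ε) (fun i => Ψ' i ε)
      = iterDifferential R.toFun l (T.sandwich (F.res U C e.le) e.mapE (Φ' ε))
        (fun i => T.sandwich (F.res U C e.le) e.mapE (Ψ' i ε)) :=
    iterDifferential_congr fun t => by simp only [map_add, map_sum, map_smul]
  rw [hcomp]
  refine res_iterDifferential_eq _ R _ _ fun t => ?_
  refine T.isLocRestriction_locRes C (C ⊓ B) inf_le_left R W hWCB _ _ ?_
  ext s
  have hs : T.sandwich (F.res U C e.le) e.mapE (Φ' ε)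
      + ∑ i, t i • T.sandwich (F.res U C e.le) e.mapE (Ψ' i ε)
      = T.sandwich (F.res U C e.le) e.mapE (Φ' ε + ∑ i, t i • Ψ' i ε) := by
    simp only [map_add, map_sum, map_smul]
  -- The nets over `U` and `C ⊓ B` are compared through the net over `B`, evaluated at the cut off
  -- section; on `N ⊓ B` that section coincides with `s`.
  have h3 := hU t (E.res U B hB (e.mapE s)) (e.mapE s) (E.res_self_apply _)
  have h4 := hN t (E.res U B hB (e.mapE s)) (E.res C (C ⊓ B) inf_le_left s) (by
    rw [E.res_res_apply, E.res_res_apply]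
    have := congrArg (E.res N (N ⊓ B) inf_le_left) (e.res_mapE s)
    simpa only [E.res_res_apply] using this)
  rw [hs]
  simp only [ContinuousLinearMap.comp_apply, sandwich_apply, F.res_res_apply]
  exact h4.symm.trans h3

theorem exists_glue_locBasic (hP : IsBoundClass P) (hA : IsGrowthScale A)
    (hTO : ∀ U : Opens X, (T.TOloc A D U).Nonempty) {U : Opens X} {ι : Type u} {c : ι → Opens X}
    (hc : ∀ i, c i ≤ U) (hU : U ≤ ⨆ i, c i) (R : ∀ i, T.LocBasic (c i))
    (hR : ∀ i j, T.IsBoundLoc A D P (c i ⊓ c j)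
      (T.locRes (c i) (c i ⊓ c j) inf_le_left (R i)
        - T.locRes (c j) (c i ⊓ c j) inf_le_right (R j))) :
    ∃ S : T.LocBasic U, ∀ j, T.IsBoundLoc A D P (c j) (T.locRes U (c j) (hc j) S - R j) := by
  obtain ⟨η, hη, hsupp, hfin, hsum⟩ := T.partition U ι c hc hU
  choose θ hθ using hη
  have hrestr : ∀ i, T.Restricts (η i) (θ i) := hθ
  have hcov : ∀ i, U ≤ c i ⊔ (η i).zeroSet := by
    intro i x hx
    by_cases hxs : x ∈ (η i).supp
    · exact Or.inl (hsupp i hxs)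
    · exact Or.inr ((η i).mem_zeroSet_iff.2 ⟨hx, hxs⟩)
  have hdisj : ∀ i (V : Opens X), V ≤ U → Disjoint (η i).supp (V : Set X) → V ≤ (η i).zeroSet :=
    fun i V hV h x hx => (η i).mem_zeroSet_iff.2 ⟨hV hx, fun hxs => Set.disjoint_left.1 h hxs hx⟩
  -- With `(η i).zeroSet` as second set of the covering, `N i` contains the support of `η i`:
  -- cutting off operators is harmless where `η i` acts.
  choose N hN e using fun i => T.exists_cutoff (hc i)
    (fun x hx => ((η i).mem_zeroSet_iff.1 hx).1) (hcov i)
  replace e := fun i => (e i).some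
  obtain ⟨S, hS⟩ := exists_sum_extend hc θ
    (fun i => (hcov i).trans (sup_le_sup_left (hrestr i).zeroSet_le _)) (by
      intro x hx
      obtain ⟨V, hxV, hV⟩ := hfin x hx
      refine ⟨U ⊓ V, inf_le_left, ⟨hx, hxV⟩, hV.subset fun i hi => ?_⟩
      by_contra h
      refine hi ((hdisj i _ inf_le_left ?_).trans (hrestr i).zeroSet_le)
      exact (Set.disjoint_iff_inter_eq_empty.2 (Set.not_nonempty_iff_eq_empty.1 h)).mono_right
        fun y hy => hy.2) (fun i => (e i).mapE) R
  refine ⟨S, fun j l Φ hΦ Ψ hΨ => F.netBound_of_locally hP fun x hx => ?_⟩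
  obtain ⟨V, hxV, hV⟩ := hfin x (hc j hx)
  obtain ⟨W, hxW, hW⟩ := exists_compactlyIn_of_mem (U := c j ⊓ V) (x := x) ⟨hx, hxV⟩
  have hWj : CompactlyIn W (c j) := hW.mono inf_le_left
  have hWU : W ≤ U := hWj.le.trans (hc j)
  set J : Finset ι := hV.toFinset
  have hJ : ∀ i, i ∉ J → Disjoint (η i).supp (W : Set X) := by
    intro i hi
    rw [Set.disjoint_iff_inter_eq_empty, ← Set.not_nonempty_iff_eq_empty]
    exact fun ⟨y, hy⟩ => hi (hV.mem_toFinset.2 ⟨y, hy.1, (hW.le hy.2).2⟩)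
  -- The part of `closure W` where `η i` is active is compact and lies in `N i ⊓ c j`, so `W₁ i`
  -- contains all that matters for the `i`-th summand on `W`.
  choose W₁ hW₁ hW₁N using fun i => exists_compactlyIn_of_isCompact
    (K := closure (W : Set X) \ (η i).zeroSet) (U := N i ⊓ c j)
    (hWj.2.diff (η i).zeroSet.isOpen) (fun y hy => by
      refine ⟨?_, hWj.1 hy.1⟩
      rcases hN i (hc j (hWj.1 hy.1)) with h | h
      · exact h
      · exact absurd h hy.2)
  have hWW₁ : ∀ i, W ≤ W₁ i ⊔ (θ i).zeroSet := by
    intro i y hy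
    by_cases h : y ∈ (η i).zeroSet
    · exact Or.inr ((hrestr i).zeroSet_le h)
    · exact Or.inl (hW₁ i ⟨subset_closure hy, h⟩)
  have hW₁c : ∀ i, W₁ i ≤ c i := fun i => (hW₁N i).le.trans (inf_le_left.trans (e i).subset)
  have hW₁j : ∀ i, W₁ i ≤ c j := fun i => (hW₁N i).le.trans inf_le_right
  -- One set containing `W` and all `W₁ i` with `i ∈ J`, so that a single transfer of the test
  -- objects serves every summand.
  obtain ⟨W₂, hW₂, hW₂j⟩ := exists_compactlyIn_of_isCompact
    (K := closure (W : Set X) ∪ ⋃ i ∈ J, closure (W₁ i : Set X)) (U := c j)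
    (hWj.2.union (J.isCompact_biUnion fun i _ => (hW₁N i).2))
    (Set.union_subset hWj.1 (Set.iUnion₂_subset fun i _ =>
      (hW₁N i).1.trans fun y hy => hy.2))
  have hWW₂ : W ≤ W₂ := fun y hy => hW₂ (Or.inl (subset_closure hy))
  have hW₁W₂ : ∀ i ∈ J, W₁ i ≤ W₂ := fun i hi y hy =>
    hW₂ (Or.inr (Set.mem_biUnion hi (subset_closure hy)))
  refine ⟨W, hWj.le, hxW, ?_⟩
  obtain ⟨h1, h2⟩ := T.exists_transfer hA hTO (hW₂j.mono (le_inf le_rfl (hc j)))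
  obtain ⟨Φ', hΦ', hag⟩ := h1 Φ hΦ
  choose Ψ' hΨ' hag' using fun i => h2 (Ψ i) (hΨ i)
  have hmono : ∀ {Θ : Eps → T.RO (c j)} {Θ' : Eps → T.RO U}, T.AgreeOn (c j) U W₂ Θ Θ' →
      T.AgreeOn U (c j) W Θ' Θ := fun h =>
    AgreeOn.symm fun W' W₀ hW' => h W' W₀ (hW'.trans hWW₂)
  refine (NetBound.sum hP J fun i hi =>
    (netBound_res_iterDifferential_sub hP hA hTO (hc j) (e i) (hW₁N i) (hW₁W₂ i hi) (R i) (R j)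
      (hR i j) hΦ hΨ hag hag').map
    ((θ i).extend hWU ((hW₁c i).trans (hc i)) (hWW₁ i))).congr hP ?_
  filter_upwards [(hmono hag).eventually_iterDifferential_locRes (hc j) hWj S
    fun i => hmono (hag' i)] with ε hε
  rw [iterDifferential_toFun_sub, map_sub, ← hε]
  simp only [map_sub, Finset.sum_sub_distrib]
  congr 1
  · have hRs : ∀ i, IsSmoothMap fun Θ =>
        (R i).toFun (T.sandwich (F.res U (c i) (hc i)) (e i).mapE Θ) :=
      fun i => (R i).smooth.comp_clm _
    let L : ∀ i, F.Sec (c i) →L[ℝ] F.Sec W := fun i =>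
      (((θ i).extend hWU ((hW₁c i).trans (hc i)) (hWW₁ i)).comp
        (F.res (c i) (W₁ i) (hW₁c i))).restrictScalars ℝ
    have h3 := iterDifferential_map S.smooth ((F.res U W hWU).restrictScalars ℝ) l (Φ' ε)
      fun i => Ψ' i ε
    have h4 := iterDifferential_sum J (fun i _ => (hRs i).map (L i)) l (Φ' ε) fun i => Ψ' i ε
    refine Eq.trans ?_ ((h4.symm.trans (iterDifferential_congr fun t => ?_)).trans h3)
    · exact Finset.sum_congr rfl fun i _ =>
        (iterDifferential_map (hRs i) (L i) l (Φ' ε) fun i => Ψ' i ε).symm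
    · rw [Finset.sum_apply]
      refine Eq.trans ?_ (hS W hWU J (fun i hi =>
        (hdisj i W hWU (hJ i hi)).trans (hrestr i).zeroSet_le) _).symm
      exact Finset.sum_congr rfl fun i _ =>
        (SheafEnd.res_extend_res hWU (hW₁c i) (hWW₁ i)).symm
  -- The differential of `R j` is spread over the summands by `∑ θ i = id` on `W`; this identity is
  -- read off in `E` through the injective inclusion.
  · set r := iterDifferential (R j).toFun l (Φ ε) fun i => Ψ i ε
    have h5 : ∑ i ∈ J, (θ i).map W hWU (F.res (c j) W hWj.le r) = F.res (c j) W hWj.le r := by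
      apply T.incl_injective
      rw [map_sum]
      simp only [hθ]
      exact hsum W hWU J hJ _
    refine Eq.trans (Finset.sum_congr rfl fun i _ => ?_) h5
    exact (SheafEnd.map_eq_extend hWj.le (hW₁j i) rfl).symm

end TestPair

end NonlinearExt

/-! ### The quotient sheaf. -/

theorem mainTheorem3 {X : Type u} [TopologicalSpace X] [T2Space X] [LocallyCompactSpace X]
    [ParacompactSpace X] (E : NonlinearExt.LCSheaf.{u, v} X) (F : NonlinearExt.LCSheaf.{u, w} X)
    (T : NonlinearExt.TestPair E F) (A D : Set (NonlinearExt.Eps → ℝ≥0))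
    (hAD : NonlinearExt.IsAdmissible A D) (hTO : ∀ U : Opens X, (T.TOloc A D U).Nonempty) :
    -- the moderate and the negligible local smooth maps form subspaces `N U ≤ M U`
    ∃ M N : ∀ U : Opens X, Submodule ℂ (T.LocBasic U),
      (∀ U R, R ∈ M U ↔ T.IsModerateLoc A D U R) ∧
      (∀ U R, R ∈ N U ↔ T.IsNegligibleLoc A D U R) ∧
      (∀ U, N U ≤ M U) ∧
      -- the restriction maps of local smooth maps exist and are unique
      ∃ ρ : ∀ U V : Opens X, V ≤ U → (T.LocBasic U →ₗ[ℂ] T.LocBasic V),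
        (∀ U V h, T.IsLocRestriction U V h (ρ U V h)) ∧
        (∀ U V h r, T.IsLocRestriction U V h r → r = ρ U V h) ∧
        -- they induce restriction maps `[R] ↦ [ρ R]` on the quotients `M U / N U`
        ∃ ρG : ∀ U V : Opens X, V ≤ U →
            ((M U ⧸ (N U).submoduleOf (M U)) →ₗ[ℂ] (M V ⧸ (N V).submoduleOf (M V))),
          (∀ U V h (R : M U), ∃ hR : ρ U V h R ∈ M V,
            ρG U V h (Submodule.Quotient.mk R) = Submodule.Quotient.mk ⟨ρ U V h R, hR⟩) ∧
          -- with which `U ↦ M U / N U` is a sheaf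
          NonlinearExt.IsVectorSheaf (fun U => M U ⧸ (N U).submoduleOf (M U)) ρG := by
  have hM := hAD.growth.isBoundClass
  have hN := NonlinearExt.isBoundClass_decayBound D
  have hNM : ∀ U, T.boundSubmodule A D U hN ≤ T.boundSubmodule A D U hM :=
    fun U R hR l Φ hΦ Ψ hΨ => (hR l Φ hΦ Ψ hΨ).mono fun _ => hAD.growthBound_of_decayBound
  have hresM : ∀ U V h, ∀ R ∈ T.boundSubmodule A D U hM, T.locRes U V h R ∈
      T.boundSubmodule A D V hM :=
    fun U V h R hR => NonlinearExt.TestPair.IsBoundLoc.locRes hM hAD.growth hTO h hR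
  have hresN : ∀ U V h, ∀ R ∈ T.boundSubmodule A D U hN, T.locRes U V h R ∈
      T.boundSubmodule A D V hN :=
    fun U V h R hR => NonlinearExt.TestPair.IsBoundLoc.locRes hN hAD.growth hTO h hR
  have hres : ∀ U V W hVU hWV (R : T.LocBasic U), T.locRes V W hWV (T.locRes U V hVU R)
      = T.locRes U W (hWV.trans hVU) R :=
    fun U V W hVU hWV R =>
      LinearMap.congr_fun (NonlinearExt.TestPair.locRes_locRes U V W hVU hWV) R
  refine ⟨fun U => T.boundSubmodule A D U hM, fun U => T.boundSubmodule A D U hN,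
    fun U R => NonlinearExt.TestPair.isModerateLoc_iff.symm,
    fun U R => NonlinearExt.TestPair.isNegligibleLoc_iff.symm, hNM, T.locRes,
    T.isLocRestriction_locRes,
    fun U V h r hr => hr.unique (T.isLocRestriction_locRes U V h),
    fun U V h => Submodule.mapQ _ _ ((T.locRes U V h).restrict (hresM U V h))
      fun R hR => hresN U V h R hR,
    fun U V h R => ⟨hresM U V h R R.2, rfl⟩, ?_, ?_, ?_, ?_⟩
  · intro U s
    obtain ⟨R, rfl⟩ := Submodule.Quotient.mk_surjective _ s
    refine congrArg Submodule.Quotient.mk (Subtype.ext ?_)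
    exact LinearMap.congr_fun (NonlinearExt.TestPair.locRes_self U) R.1
  · intro U V W hVU hWV s
    obtain ⟨R, rfl⟩ := Submodule.Quotient.mk_surjective _ s
    exact congrArg Submodule.Quotient.mk (Subtype.ext (hres U V W hVU hWV R.1))
  · intro U ι c hc hU s hs
    obtain ⟨R, rfl⟩ := Submodule.Quotient.mk_surjective _ s
    refine (Submodule.Quotient.mk_eq_zero _).2 ?_
    refine NonlinearExt.TestPair.isBoundLoc_of_locally hN hAD.growth hTO fun x hx => ?_
    obtain ⟨i, hi⟩ := Opens.mem_iSup.1 (hU hx)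
    exact ⟨c i, hc i, hi, (Submodule.Quotient.mk_eq_zero _).1 (hs i)⟩
  · intro U ι c hc hU s hs
    choose R hR using fun i => Submodule.Quotient.mk_surjective _ (s i)
    obtain rfl : (fun i => Submodule.Quotient.mk (R i)) = s := funext hR
    obtain ⟨S, hS⟩ := NonlinearExt.TestPair.exists_glue_locBasic hN hAD.growth hTO hc hU
      (fun i => (R i).1) fun i j => (Submodule.Quotient.eq _).1 (hs i j)
    have hSM : S ∈ T.boundSubmodule A D U hM := by
      refine NonlinearExt.TestPair.isBoundLoc_of_locally hM hAD.growth hTO fun x hx => ?_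
      obtain ⟨i, hi⟩ := Opens.mem_iSup.1 (hU hx)
      refine ⟨c i, hc i, hi, ?_⟩
      -- Locally `S` is the sum of the negligible `S - R i` and the moderate `R i`.
      have := (T.boundSubmodule A D (c i) hM).add_mem (hNM _ (hS i)) (R i).2
      rwa [sub_add_cancel] at this
    exact ⟨Submodule.Quotient.mk ⟨S, hSM⟩, fun i => (Submodule.Quotient.eq _).2 (hS i)⟩
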